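/- Let $n\ge 3$, $m\ge 2$, $n+m\ge 8$, $\ell\ge 1$, $\alpha_0=\sqrt{(m-1)/(n-1)}$ and $\beta=\frac{2(n-1)}{m+(1+\alpha_0^2)^{-1}}$. Write points of $[0,\infty)\times\mathbb R^\ell$ as $(r,y)$ and $D=(D_r,D_y)$. For $u=u(r,y)$ put $\Delta u=u_{rr}+\frac{n-1}{r}u_r+\Delta_y u$ (the Laplacian of $u(|x|,y)$ on $\mathbb R^{n}\times\mathbb R^\ell$), $Q(u)=D^2u(Du,Du)$ and $$\mathcal M(u)=\Delta u-\frac{Q(u)}{1+|Du|^2}-\frac{m-1}{u}.$$ There is $\tau_0=\tau_0(n,m,\ell)\in(0,\frac12]$ such that for all constants $B_{jk},c_{jk}$ ($j,k\ge 0$) there are constants $C_{jk}$, depending only on $n,m,\ell$ and these constants, with the following property. Let $K\subset\mathbb R^\ell$ be closed and non-empty, $U=\mathbb R^\ell\setminus K$, and let $h\in C^\infty(\mathbb R^\ell)$ satisfy $h>0$ on $U$, $h=0$ on $K$, $h+|Dh|+|D^2h|<\tau_0$, and $|D^kh(y)|\le B_{jk}\tau_0\,\mathrm{dist}(y,\partial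 U)^j$ for all $j,k\ge 0$. Let $\tau\in(0,1]$ and let $u=u(r,y)$ be $C^\infty$ on $(0,\infty)\times U$ with - $u>0$ and $\mathcal M(u)=0$ for $y\in U$, $0<r<\frac12h^2(y)$; - $u=\alpha_0r$ for $y\in U$, $r\ge h^2(y)$; - $|D(u-\alpha_0r)|<\tau h^2(y)$ and $|D^k(u-\alpha_0r)|\le c_{jk}\tau h^j(y)$ for all $j,k\ge 0$, for $y\in U$, $r>\frac14h^2(y)$. Then there is a positive $C^\infty$ function $f$ on $\{(r,y):y\in U,\ r>\frac14h^2(y)\}$ that solves there $$\tfrac12\Bigl(m+\frac1{1+f|Du|^2}\Bigr)Df\cdot Du=-f\Bigl(\Delta u-\frac{f\,Q(u)}{1+f|Du|^2}\Bigr)+\frac{m-1}{u}$$ (the equation expressing that the symmetric graph $|\xi|=u(|x|,y)$ is minimal for the metric $\sum dx_i^2+f(|x|,y)\sum d\xi_j^2+\sum dy_k^2$), with $f=1$ on $\{y\in U,\ \frac14h^2(y)\le r\le\frac12h^2(y)\}$, and with the following estimates for all $j\ge0$, $k\ge1$ and $y\in U$: $$|f-1|+r^k|D^kf|\le C_{jk}\,\tau\,h^j(y)\qquad\text{for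 } \tfrac14h^2(y)<r\le 1,$$ and, for all $r>\frac14h^2(y)$, all $a,b\ge0$ with $a+b=k$ and all $v_1,\dots,v_b\in\mathbb R^\ell$ with $|v_i|\le1$, $$|f-1|+r^{a+\min(b,\beta)}\,\bigl|D_r^aD_{v_1}\cdots D_{v_b}f\bigr|\le C_{jk}\,\tau\,h^j(y),$$ where $D_{v}$ is the derivative in the $y$-direction $v$. -/

import Mathlib

open scoped ContDiff

noncomputable section

/-- The variables `y ∈ ℝ^ℓ`. -/
abbrev YSpace (ℓ : ℕ) : Type := EuclideanSpace ℝ (Fin ℓ)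

/-- The pairs `(r, y) ∈ ℝ × ℝ^ℓ`, with the Euclidean norm; `q.fst = r` and `q.snd = y`. Functions on
this space stand for functions `u(r, y)`, `r = |x|`, of `(x, y) ∈ ℝ^n × ℝ^ℓ`, and `D = (D_r, D_y)`
is the derivative on this space. -/
abbrev RYSpace (ℓ : ℕ) : Type := WithLp 2 (ℝ × YSpace ℓ)

/-- The direction of `r`. -/
def radialDir (ℓ : ℕ) : RYSpace ℓ := WithLp.toLp 2 ((1 : ℝ), (0 : YSpace ℓ))

/-- The vector `v ∈ ℝ^ℓ` as a direction in the `y` variables. -/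
def yDir {ℓ : ℕ} (v : YSpace ℓ) : RYSpace ℓ := WithLp.toLp 2 ((0 : ℝ), v)

/-- The slope `α₀ = √((m - 1) / (n - 1))` of the minimal cone `|ξ| = α₀ |x|`. -/
def coneSlope (n m : ℕ) : ℝ := Real.sqrt (((m : ℝ) - 1) / ((n : ℝ) - 1))

/-- The Laplacian on `ℝ^n × ℝ^ℓ` of the function `u(|x|, y)`, at points with `|x| = r > 0`:
`u_rr + ∑ᵢ u_{yᵢ yᵢ} + (n - 1) u_r / r`. -/
def radialLaplacian {ℓ : ℕ} (n : ℕ) (u : RYSpace ℓ → ℝ) (q : RYSpace ℓ) : ℝ :=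
  Laplacian.laplacian u q + ((n : ℝ) - 1) / q.fst * fderiv ℝ u q (radialDir ℓ)

/-- `Q(u) = u_r² u_rr + ∑ᵢⱼ u_{yᵢ} u_{yⱼ} u_{yᵢ yⱼ} + 2 u_r ∑ⱼ u_{yⱼ} u_{r yⱼ}`, which is
`D²u(Du, Du)`. -/
def hessQuad {ℓ : ℕ} (u : RYSpace ℓ → ℝ) (q : RYSpace ℓ) : ℝ :=
  iteratedFDeriv ℝ 2 u q ![gradient u q, gradient u q]

/-- The operator of the symmetric minimal surface equation on `ℝ^n × ℝ^ℓ`, for `u = u(|x|, y)`: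
`𝓜(u) = Δu - Q(u) / (1 + |Du|²) - (m - 1) / u`. -/
def smeOp {ℓ : ℕ} (n m : ℕ) (u : RYSpace ℓ → ℝ) (q : RYSpace ℓ) : ℝ :=
  radialLaplacian n u q - hessQuad u q / (1 + ‖gradient u q‖ ^ 2) - ((m : ℝ) - 1) / u q

/-- The first order quasilinear equation for `f` at `q = (r, y)`; it is the Euler-Lagrange equation
of `∫ √(1 + f |Du|²) f^((m-1)/2) u^(m-1) dx dy` and so says that the symmetric graph `|ξ| = u(|x|, y)`
is minimal for the metric `∑ dxᵢ² + f(|x|, y) ∑ dξⱼ² + ∑ dyₖ²`. -/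
def MetricEqn {ℓ : ℕ} (n m : ℕ) (u f : RYSpace ℓ → ℝ) (q : RYSpace ℓ) : Prop :=
  (1 / 2 : ℝ) * ((m : ℝ) + (1 + f q * ‖gradient u q‖ ^ 2)⁻¹) *
      inner ℝ (gradient f q) (gradient u q) =
    -f q * (radialLaplacian n u q -
        f q * (hessQuad u q / (1 + f q * ‖gradient u q‖ ^ 2))) +
      ((m : ℝ) - 1) / u q

/-- `h` is a smooth function on `ℝ^ℓ`, zero exactly on `K`, small in `C²` and vanishing to infinite
order, with all derivatives, on approach to the boundary of `U = ℝ^ℓ \ K`; `B j k` are the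
constants of the last condition `dist(y, ∂U)^(-j) |D^k h(y)| ≤ B j k τ₀`. -/
structure IsHeight {ℓ : ℕ} (K : Set (YSpace ℓ)) (τ₀ : ℝ) (B : ℕ → ℕ → ℝ)
    (h : YSpace ℓ → ℝ) : Prop where
  contDiff : ContDiff ℝ ∞ h
  pos : ∀ y ∉ K, 0 < h y
  zero : ∀ y ∈ K, h y = 0
  small : ∀ y, h y + ‖fderiv ℝ h y‖ + ‖iteratedFDeriv ℝ 2 h y‖ < τ₀
  decay : ∀ j k : ℕ, ∀ y,
    ‖iteratedFDeriv ℝ k h y‖ ≤ B j k * τ₀ * Metric.infDist y (frontier Kᶜ) ^ j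

/-- `u = u(r, y)` is smooth over `U = ℝ^ℓ \ K`, is a positive solution of the symmetric minimal
surface equation for `r < h² / 2`, equals `α₀ r` for `r ≥ h²`, and is close to `α₀ r` for
`r > h² / 4`, with constants `c j k`. -/
structure IsNearCone {ℓ : ℕ} (n m : ℕ) (K : Set (YSpace ℓ)) (h : YSpace ℓ → ℝ) (τ : ℝ)
    (c : ℕ → ℕ → ℝ) (u : RYSpace ℓ → ℝ) : Prop where
  contDiffOn : ContDiffOn ℝ ∞ u {q | 0 < q.fst ∧ q.snd ∉ K}
  sme : ∀ q : RYSpace ℓ, q.snd ∉ K → 0 < q.fst → q.fst < h q.snd ^ 2 / 2 →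
    0 < u q ∧ smeOp n m u q = 0
  eq_cone : ∀ q : RYSpace ℓ, q.snd ∉ K → h q.snd ^ 2 ≤ q.fst → u q = coneSlope n m * q.fst
  grad_small : ∀ q : RYSpace ℓ, q.snd ∉ K → h q.snd ^ 2 / 4 < q.fst →
    ‖fderiv ℝ (fun p : RYSpace ℓ => u p - coneSlope n m * p.fst) q‖ < τ * h q.snd ^ 2
  deriv_small : ∀ j k : ℕ, ∀ q : RYSpace ℓ, q.snd ∉ K → h q.snd ^ 2 / 4 < q.fst →
    ‖iteratedFDeriv ℝ k (fun p : RYSpace ℓ => u p - coneSlope n m * p.fst) q‖ ≤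
      c j k * τ * h q.snd ^ j

/-- The rate `β = 2 (n - 1) / (m + (1 + α₀²)⁻¹)` at which `f - 1` decays as `r → ∞`. -/
def decayRate (n m : ℕ) : ℝ :=
  2 * ((n : ℝ) - 1) / ((m : ℝ) + (1 + coneSlope n m ^ 2)⁻¹)

end

/-!
The equation for `f` is a first order quasilinear equation: it prescribes the derivative of `f`
along `Du`. Since `Du` is close to the direction of `r`, the factor `f` is obtained by solving an
ordinary differential equation along the characteristics, which run outward from the set where
`f = 1`. Near that set `f = 1` is a solution, because there `u` solves the symmetric minimal
surface equation, and beyond `r = h²` the equation is that of the exact cone, which can be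
integrated explicitly. What has to be shown is that all estimates are uniform and of infinite
order in `h`.

*Rescaling.* About a point `y` outside `K` lengths are divided by `h(y)²`. The rescaled `u` is
`α₀ r + g`, where `g` and all its derivatives are at most a constant times `τ h(y)^J`, for every
`J`; the height is nearly constant on a ball of the rescaled size `1`. The data together with a
base point are collected in the type `PointedData`, and `UnifSmoothOn` expresses that a family of
functions over such an index type is bounded, with all derivatives, by constants times a weight.

*The local problem.* For a family of perturbations of size `ε` of the cone the equation for
`f = 1 + ε φ` is a transport equation for `φ` with coefficients bounded with all derivatives,
because the defect of the minimal surface equation is itself of size `ε` (`exists_coefficients`).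
It is solved by the flow of a vector field on `E × ℝ` (`exists_unifSmoothOn_transport`). The
uniform smoothness of flows is derived from the inverse function theorem for the integral equation
on a space of bounded curves in which the index of the family is one of the variables. The
nonlinearity is truncated; Gronwall's inequality and a lower barrier show that the truncation is
inactive (`exists_unifSmoothOn_metricFactor`). This gives `exists_localMetricFactor`, and
`metricFactor_unique` shows that the solutions for different base points and different `J` agree
where they overlap (`PointedData.exists_isPointedFactor`).

*Over the cone.* With `κ = (m (1 + α₀²) + 1)⁻¹` the function `(f - 1) (1 + α₀² f)^(-κ)`, the
`coneProfile`, is a solution of `r D_r Φ = -β Φ` (`coneProfileDeriv_mul`). It is an increasing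
function of `f`, so that its inverse continues `f` to all large `r`, and `f - 1` decays like
`(h² / r)^β`.

*Estimates.* In coordinates in which `r` is divided by its size and `y` by `h²` the far part is
again a uniformly smooth family, with the decay as a factor of the weight
(`PointedData.IsPointedFactor.unifSmoothOn_farFactor`). A derivative in `y` gains no power of `r`,
so that only `min b β` powers of `r` are available for `b` such derivatives; the negative powers
of `h` that come from the rescaling are absorbed by the arbitrary order `J`
(`PointedData.IsPointedFactor.exists_bound`).
-/

open scoped BoundedContinuousFunction

universe u

/-! ### Families of smooth functions with uniform bounds on all derivatives -/

/-- The functions `f i` are smooth on `Ω`, and for every `k` their `k`-th derivatives are bounded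
there by a constant multiple of the weight `w i`, with a constant that does not depend on `i`.
The derivatives are those on the whole space, so that the notion is used on open sets `Ω`. -/
structure UnifSmoothOn {ι E F : Type*} [NormedAddCommGroup E] [NormedSpace ℝ E]
    [NormedAddCommGroup F] [NormedSpace ℝ F] (Ω : Set E) (w : ι → ℝ) (f : ι → E → F) : Prop where
  contDiffOn : ∀ i, ContDiffOn ℝ ∞ (f i) Ω
  bound : ∀ k : ℕ, ∃ C : ℝ, ∀ i, ∀ x ∈ Ω, ‖iteratedFDeriv ℝ k (f i) x‖ ≤ C * w i

namespace UnifSmoothOn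

section Calculus

variable {ι E F G H : Type*} [NormedAddCommGroup E] [NormedSpace ℝ E]
  [NormedAddCommGroup F] [NormedSpace ℝ F] [NormedAddCommGroup G] [NormedSpace ℝ G]
  [NormedAddCommGroup H] [NormedSpace ℝ H] {Ω Ω' : Set E} {w w' : ι → ℝ} {f g : ι → E → F}

theorem bound_nonneg (hf : UnifSmoothOn Ω w f) (hw : ∀ i, 0 ≤ w i) (k : ℕ) :
    ∃ C : ℝ, 0 ≤ C ∧ ∀ i, ∀ x ∈ Ω, ‖iteratedFDeriv ℝ k (f i) x‖ ≤ C * w i := by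
  obtain ⟨C, hC⟩ := hf.bound k
  exact ⟨|C|, abs_nonneg C, fun i x hx => (hC i x hx).trans
    (mul_le_mul_of_nonneg_right (le_abs_self C) (hw i))⟩

theorem norm_le (hf : UnifSmoothOn Ω w f) (hw : ∀ i, 0 ≤ w i) :
    ∃ C : ℝ, 0 ≤ C ∧ ∀ i, ∀ x ∈ Ω, ‖f i x‖ ≤ C * w i := by
  simpa using hf.bound_nonneg hw 0

theorem bound_upTo (hf : UnifSmoothOn Ω w f) (hw : ∀ i, 0 ≤ w i) (n : ℕ) :
    ∃ C : ℝ, 1 ≤ C ∧ ∀ k ≤ n, ∀ i, ∀ x ∈ Ω, ‖iteratedFDeriv ℝ k (f i) x‖ ≤ C * w i := by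
  choose C hC0 hC using hf.bound_nonneg hw
  refine ⟨1 + ∑ k ∈ Finset.range (n + 1), C k, ?_, fun k hk i x hx => (hC k i x hx).trans ?_⟩
  · have := Finset.sum_nonneg (s := Finset.range (n + 1)) fun k _ => hC0 k
    linarith
  · refine mul_le_mul_of_nonneg_right ?_ (hw i)
    have := Finset.single_le_sum (f := C) (s := Finset.range (n + 1)) (fun k _ => hC0 k)
      (Finset.mem_range.2 (Nat.lt_succ_of_le hk))
    linarith

theorem contDiffAt (hf : UnifSmoothOn Ω w f) (hΩ : IsOpen Ω) (i : ι) {x : E} (hx : x ∈ Ω) :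
    ContDiffAt ℝ ∞ (f i) x :=
  (hf.contDiffOn i).contDiffAt (hΩ.mem_nhds hx)

theorem contDiff (hf : UnifSmoothOn Set.univ w f) (i : ι) : ContDiff ℝ ∞ (f i) :=
  contDiffOn_univ.1 (hf.contDiffOn i)

theorem mono_set (hf : UnifSmoothOn Ω w f) (h : Ω' ⊆ Ω) : UnifSmoothOn Ω' w f :=
  ⟨fun i => (hf.contDiffOn i).mono h, fun k => (hf.bound k).imp fun _ hC i x hx => hC i x (h hx)⟩

theorem mono_weight (hf : UnifSmoothOn Ω w f) (hw : ∀ i, 0 ≤ w i) {c : ℝ}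
    (h : ∀ i, w i ≤ c * w' i) : UnifSmoothOn Ω w' f := by
  refine ⟨hf.contDiffOn, fun k => ?_⟩
  obtain ⟨C, hC0, hC⟩ := hf.bound_nonneg hw k
  exact ⟨C * c, fun i x hx => (hC i x hx).trans (by
    rw [mul_assoc]; exact mul_le_mul_of_nonneg_left (h i) hC0)⟩

theorem congr (hf : UnifSmoothOn Ω w f) (hΩ : IsOpen Ω) (h : ∀ i, Set.EqOn (g i) (f i) Ω) :
    UnifSmoothOn Ω w g := by
  refine ⟨fun i => (hf.contDiffOn i).congr (h i), fun k => (hf.bound k).imp fun C hC i x hx => ?_⟩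
  have : g i =ᶠ[nhds x] f i := Filter.eventuallyEq_of_mem (hΩ.mem_nhds hx) (h i)
  rw [(this.iteratedFDeriv ℝ k).eq_of_nhds]
  exact hC i x hx

theorem reindex {κ : Type*} (hf : UnifSmoothOn Ω w f) (e : κ → ι) :
    UnifSmoothOn Ω (fun j => w (e j)) (fun j => f (e j)) :=
  ⟨fun j => hf.contDiffOn (e j), fun k => (hf.bound k).imp fun _ hC j => hC (e j)⟩

theorem add (hΩ : IsOpen Ω) (hf : UnifSmoothOn Ω w f) (hg : UnifSmoothOn Ω w g) :
    UnifSmoothOn Ω w (fun i x => f i x + g i x) := by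
  refine ⟨fun i => (hf.contDiffOn i).add (hg.contDiffOn i), fun k => ?_⟩
  obtain ⟨C, hC⟩ := hf.bound k
  obtain ⟨D, hD⟩ := hg.bound k
  refine ⟨C + D, fun i x hx => ?_⟩
  have h1 : ContDiffAt ℝ k (f i) x := (hf.contDiffAt hΩ i hx).of_le (mod_cast le_top)
  have h2 : ContDiffAt ℝ k (g i) x := (hg.contDiffAt hΩ i hx).of_le (mod_cast le_top)
  rw [show (fun x => f i x + g i x) = f i + g i from rfl, iteratedFDeriv_add_apply h1 h2, add_mul]
  exact (norm_add_le _ _).trans (add_le_add (hC i x hx) (hD i x hx))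

theorem clm_comp (hΩ : IsOpen Ω) (hf : UnifSmoothOn Ω w f) (L : F →L[ℝ] G) :
    UnifSmoothOn Ω w (fun i x => L (f i x)) := by
  refine ⟨fun i => L.contDiff.comp_contDiffOn (hf.contDiffOn i), fun k => ?_⟩
  obtain ⟨C, hC⟩ := hf.bound k
  refine ⟨‖L‖ * C, fun i x hx => ?_⟩
  have h1 : ContDiffAt ℝ k (f i) x := (hf.contDiffAt hΩ i hx).of_le (mod_cast le_top)
  rw [mul_assoc]
  exact (L.norm_iteratedFDeriv_comp_left h1 le_rfl).trans
    (mul_le_mul_of_nonneg_left (hC i x hx) (norm_nonneg L))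

theorem const_smul (hΩ : IsOpen Ω) (hf : UnifSmoothOn Ω w f) (c : ℝ) :
    UnifSmoothOn Ω w (fun i x => c • f i x) :=
  hf.clm_comp hΩ (c • ContinuousLinearMap.id ℝ F)

theorem neg (hΩ : IsOpen Ω) (hf : UnifSmoothOn Ω w f) : UnifSmoothOn Ω w (fun i x => -f i x) := by
  simpa using hf.const_smul hΩ (-1)

theorem sub (hΩ : IsOpen Ω) (hf : UnifSmoothOn Ω w f) (hg : UnifSmoothOn Ω w g) :
    UnifSmoothOn Ω w (fun i x => f i x - g i x) := by
  simpa [sub_eq_add_neg] using hf.add hΩ (hg.neg hΩ)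

/-- Constants that are bounded by the weight. -/
theorem of_const {c : ι → F} {C : ℝ} (h : ∀ i, ‖c i‖ ≤ C * w i) :
    UnifSmoothOn Ω w (fun i _ => c i) := by
  refine ⟨fun i => contDiffOn_const, fun k => ?_⟩
  rcases k with _ | k
  · exact ⟨C, fun i x _ => by simpa using h i⟩
  · exact ⟨0, fun i x _ => by simp [iteratedFDeriv_succ_const]⟩

theorem sum (hΩ : IsOpen Ω) {κ : Type*} (s : Finset κ) {f : κ → ι → E → F}
    (hf : ∀ j ∈ s, UnifSmoothOn Ω w (f j)) : UnifSmoothOn Ω w (fun i x => ∑ j ∈ s, f j i x) := by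
  classical
  induction s using Finset.induction_on with
  | empty => simpa using of_const (Ω := Ω) (w := w) (c := fun _ => (0 : F)) (C := 0) (by simp)
  | insert a s ha ih =>
    simp only [Finset.sum_insert ha]
    exact (hf a (Finset.mem_insert_self a s)).add hΩ
      (ih fun j hj => hf j (Finset.mem_insert_of_mem hj))

/-- Leibniz rule: weights multiply under bilinear operations. -/
theorem bilinear (hΩ : IsOpen Ω) (hw : ∀ i, 0 ≤ w i) (hw' : ∀ i, 0 ≤ w' i)
    (B : F →L[ℝ] G →L[ℝ] H) {g : ι → E → G}
    (hf : UnifSmoothOn Ω w f) (hg : UnifSmoothOn Ω w' g) :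
    UnifSmoothOn Ω (fun i => w i * w' i) (fun i x => B (f i x) (g i x)) := by
  refine ⟨fun i => B.isBoundedBilinearMap.contDiff.comp_contDiffOn
    ((hf.contDiffOn i).prodMk (hg.contDiffOn i)), fun k => ?_⟩
  obtain ⟨C, hC0, hC⟩ := hf.bound_upTo hw k
  obtain ⟨D, hD0, hD⟩ := hg.bound_upTo hw' k
  refine ⟨‖B‖ * ∑ i ∈ Finset.range (k + 1), (k.choose i : ℝ) * C * D, fun i x hx => ?_⟩
  have := B.norm_iteratedFDerivWithin_le_of_bilinear (hf.contDiffOn i) (hg.contDiffOn i)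
    hΩ.uniqueDiffOn hx (n := k) (mod_cast le_top)
  rw [iteratedFDerivWithin_of_isOpen k hΩ hx] at this
  refine this.trans ?_
  rw [mul_assoc, Finset.sum_mul]
  refine mul_le_mul_of_nonneg_left (Finset.sum_le_sum fun j hj => ?_) (norm_nonneg B)
  rw [iteratedFDerivWithin_of_isOpen _ hΩ hx, iteratedFDerivWithin_of_isOpen _ hΩ hx]
  have h1 := hC j (Nat.lt_succ_iff.1 (Finset.mem_range.1 hj)) i x hx
  have h2 := hD (k - j) (Nat.sub_le k j) i x hx
  calc _ ≤ (k.choose j : ℝ) * (C * w i) * (D * w' i) := by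
        have := hw i
        gcongr
    _ = _ := by ring

theorem smul (hΩ : IsOpen Ω) (hw : ∀ i, 0 ≤ w i) (hw' : ∀ i, 0 ≤ w' i) {a : ι → E → ℝ}
    (ha : UnifSmoothOn Ω w a) (hf : UnifSmoothOn Ω w' f) :
    UnifSmoothOn Ω (fun i => w i * w' i) (fun i x => a i x • f i x) :=
  ha.bilinear hΩ hw hw' (ContinuousLinearMap.lsmul ℝ ℝ) hf

theorem mul (hΩ : IsOpen Ω) (hw : ∀ i, 0 ≤ w i) (hw' : ∀ i, 0 ≤ w' i) {a b : ι → E → ℝ}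
    (ha : UnifSmoothOn Ω w a) (hb : UnifSmoothOn Ω w' b) :
    UnifSmoothOn Ω (fun i => w i * w' i) (fun i x => a i x * b i x) :=
  ha.smul hΩ hw hw' hb

/-- Multiplication by a family that is bounded with all its derivatives keeps the weight. -/
theorem mul_bdd (hΩ : IsOpen Ω) (hw : ∀ i, 0 ≤ w i) {a b : ι → E → ℝ}
    (ha : UnifSmoothOn Ω w a) (hb : UnifSmoothOn Ω 1 b) :
    UnifSmoothOn Ω w (fun i x => a i x * b i x) := by
  simpa using ha.mul hΩ hw (fun _ => zero_le_one) hb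

theorem bdd_mul (hΩ : IsOpen Ω) (hw : ∀ i, 0 ≤ w i) {a b : ι → E → ℝ}
    (ha : UnifSmoothOn Ω 1 a) (hb : UnifSmoothOn Ω w b) :
    UnifSmoothOn Ω w (fun i x => a i x * b i x) := by
  simpa using ha.mul hΩ (fun _ => zero_le_one) hw hb

theorem clm_apply (hΩ : IsOpen Ω) (hw : ∀ i, 0 ≤ w i) {a : ι → E → F →L[ℝ] G}
    (ha : UnifSmoothOn Ω w a) (hf : UnifSmoothOn Ω 1 f) :
    UnifSmoothOn Ω w (fun i x => a i x (f i x)) := by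
  simpa using ha.bilinear hΩ hw (fun _ => zero_le_one) (ContinuousLinearMap.id ℝ (F →L[ℝ] G)) hf

protected theorem fderiv (hΩ : IsOpen Ω) (hf : UnifSmoothOn Ω w f) :
    UnifSmoothOn Ω w (fun i => fderiv ℝ (f i)) :=
  ⟨fun i => (hf.contDiffOn i).fderiv_of_isOpen hΩ (by simp), fun k => by
    obtain ⟨C, hC⟩ := hf.bound (k + 1)
    exact ⟨C, fun i x hx => norm_iteratedFDeriv_fderiv.trans_le (hC i x hx)⟩⟩

theorem of_fderiv (hf : ∀ i, ContDiffOn ℝ ∞ (f i) Ω) {C : ℝ}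
    (hC : ∀ i, ∀ x ∈ Ω, ‖f i x‖ ≤ C * w i) (h' : UnifSmoothOn Ω w (fun i => fderiv ℝ (f i))) :
    UnifSmoothOn Ω w f := by
  refine ⟨hf, fun k => ?_⟩
  rcases k with _ | k
  · exact ⟨C, fun i x hx => by simpa using hC i x hx⟩
  · obtain ⟨D, hD⟩ := h'.bound k
    exact ⟨D, fun i x hx => norm_iteratedFDeriv_fderiv.symm.trans_le (hD i x hx)⟩

/-- Composition on the right with maps whose derivatives of order at least one are bounded; the
maps themselves need not be bounded. -/
theorem comp {S : Set F} (hS : IsOpen S) (hΩ : IsOpen Ω) (hw : ∀ i, 0 ≤ w i) {f : ι → F → G}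
    (hf : UnifSmoothOn S w f) {A : ι → E → F} (hA : ∀ i, ContDiffOn ℝ ∞ (A i) Ω)
    (hAS : ∀ i, Set.MapsTo (A i) Ω S)
    (hA' : ∀ k : ℕ, 1 ≤ k → ∃ C : ℝ, ∀ i, ∀ x ∈ Ω, ‖iteratedFDeriv ℝ k (A i) x‖ ≤ C) :
    UnifSmoothOn Ω w (fun i x => f i (A i x)) := by
  refine ⟨fun i => (hf.contDiffOn i).comp (hA i) (hAS i), fun k => ?_⟩
  obtain ⟨C, hC1, hC⟩ := hf.bound_upTo hw k
  have hA'' : ∀ k : ℕ, ∃ C : ℝ, 0 ≤ C ∧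
      (1 ≤ k → ∀ i, ∀ x ∈ Ω, ‖iteratedFDeriv ℝ k (A i) x‖ ≤ C) := by
    intro k
    by_cases hk : 1 ≤ k
    · obtain ⟨D, hD⟩ := hA' k hk
      exact ⟨|D|, abs_nonneg D, fun _ i x hx => (hD i x hx).trans (le_abs_self D)⟩
    · exact ⟨0, le_rfl, fun h => absurd h hk⟩
  choose D0 hD0 hD0' using hA''
  obtain ⟨D, hD1, hD⟩ : ∃ D : ℝ, 1 ≤ D ∧ ∀ j, 1 ≤ j → j ≤ k → ∀ i, ∀ x ∈ Ω,
      ‖iteratedFDeriv ℝ j (A i) x‖ ≤ D := by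
    refine ⟨1 + ∑ j ∈ Finset.range (k + 1), D0 j, ?_, fun j hj hjk i x hx => ?_⟩
    · have := Finset.sum_nonneg (s := Finset.range (k + 1)) fun j _ => hD0 j
      linarith
    · have := Finset.single_le_sum (f := D0) (s := Finset.range (k + 1)) (fun k _ => hD0 k)
        (Finset.mem_range.2 (Nat.lt_succ_of_le hjk))
      linarith [hD0' j hj i x hx]
  refine ⟨k.factorial * C * D ^ k, fun i x hx => ?_⟩
  have := norm_iteratedFDerivWithin_comp_le (hf.contDiffOn i) (hA i) (n := k) (mod_cast le_top)
    hS.uniqueDiffOn hΩ.uniqueDiffOn (hAS i) hx (C := C * w i) (D := D)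
    (fun j hj => by
      rw [iteratedFDerivWithin_of_isOpen j hS (hAS i hx)]
      exact hC j hj i _ (hAS i hx))
    (fun j hj hjk => by
      rw [iteratedFDerivWithin_of_isOpen j hΩ hx]
      exact (hD j hj hjk i x hx).trans (le_self_pow₀ hD1 (by omega)))
  rw [iteratedFDerivWithin_of_isOpen k hΩ hx] at this
  refine this.trans (le_of_eq (by ring))

/-- Composition on the right with perturbations of a linear map. -/
theorem comp_clm_add {S : Set F} (hS : IsOpen S) (hΩ : IsOpen Ω) (hw : ∀ i, 0 ≤ w i)
    {f : ι → F → G} (hf : UnifSmoothOn S w f) (L : E →L[ℝ] F) {a : ι → E → F}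
    (ha : UnifSmoothOn Ω 1 a) (hL : ∀ i, Set.MapsTo (fun x => L x + a i x) Ω S) :
    UnifSmoothOn Ω w (fun i x => f i (L x + a i x)) := by
  refine hf.comp hS hΩ hw (fun i => L.contDiff.contDiffOn.add (ha.contDiffOn i)) hL
    fun k hk => ?_
  obtain ⟨C, hC⟩ := ha.bound k
  refine ⟨‖L‖ + C, fun i x hx => ?_⟩
  rw [show (fun x => L x + a i x) = L + a i from rfl, iteratedFDeriv_add_apply
    L.contDiff.contDiffAt ((ha.contDiffAt hΩ i hx).of_le (mod_cast le_top))]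
  refine (norm_add_le _ _).trans (add_le_add ?_ (by simpa using hC i x hx))
  rcases k with _ | _ | k
  · omega
  · rw [norm_iteratedFDeriv_one, L.fderiv]
  · rw [← norm_iteratedFDeriv_fderiv, show fderiv ℝ (L : E → F) = fun _ => L from
      funext fun _ => L.fderiv, iteratedFDeriv_succ_const]
    simp

theorem comp_clm {S : Set F} (hS : IsOpen S) (hΩ : IsOpen Ω) (hw : ∀ i, 0 ≤ w i) {f : ι → F → G}
    (hf : UnifSmoothOn S w f) (L : E →L[ℝ] F) (hL : Set.MapsTo L Ω S) :
    UnifSmoothOn Ω w (fun i x => f i (L x)) := by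
  have h0 : UnifSmoothOn Ω 1 (fun (_ : ι) (_ : E) => (0 : F)) := of_const (C := 0) (by simp)
  simpa using hf.comp_clm_add hS hΩ hw L h0 (fun i x hx => by simpa using hL hx)

/-- Composition on the left with one smooth function: the values stay in a compact part of its
domain. -/
theorem comp_fixed (hΩ : IsOpen Ω) (hf : UnifSmoothOn Ω 1 f) {O K : Set F} (hO : IsOpen O)
    (hK : IsCompact K) (hKO : K ⊆ O) (hfK : ∀ i, Set.MapsTo (f i) Ω K) {Φ : F → G}
    (hΦ : ContDiffOn ℝ ∞ Φ O) : UnifSmoothOn Ω 1 (fun i x => Φ (f i x)) := by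
  refine ⟨fun i => hΦ.comp (hf.contDiffOn i) fun x hx => hKO (hfK i hx), fun k => ?_⟩
  have hcont : ∀ j : ℕ, ∃ C : ℝ, ∀ y ∈ K, ‖iteratedFDeriv ℝ j Φ y‖ ≤ C := by
    intro j
    have h1 : ContinuousOn (iteratedFDeriv ℝ j Φ) O :=
      (hΦ.continuousOn_iteratedFDerivWithin (m := j) (mod_cast le_top) hO.uniqueDiffOn).congr
        fun y hy => (iteratedFDerivWithin_of_isOpen j hO hy).symm
    exact hK.exists_bound_of_continuousOn (h1.mono hKO)
  choose C hC using hcont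
  obtain ⟨D, hD1, hD⟩ := hf.bound_upTo (fun _ => zero_le_one) k
  refine ⟨k.factorial * (∑ j ∈ Finset.range (k + 1), |C j|) * D ^ k, fun i x hx => ?_⟩
  have := norm_iteratedFDerivWithin_comp_le hΦ (hf.contDiffOn i) (n := k) (mod_cast le_top)
    hO.uniqueDiffOn hΩ.uniqueDiffOn (fun x hx => hKO (hfK i hx)) hx
    (C := ∑ j ∈ Finset.range (k + 1), |C j|) (D := D)
    (fun j hj => by
      rw [iteratedFDerivWithin_of_isOpen j hO (hKO (hfK i hx))]
      refine ((hC j _ (hfK i hx)).trans (le_abs_self _)).trans ?_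
      exact Finset.single_le_sum (f := fun j => |C j|) (fun k _ => abs_nonneg _)
        (Finset.mem_range.2 (Nat.lt_succ_of_le hj)))
    (fun j hj hjk => by
      rw [iteratedFDerivWithin_of_isOpen j hΩ hx]
      refine le_trans ?_ (le_self_pow₀ hD1 (by omega))
      simpa using hD j hjk i x hx)
  rw [iteratedFDerivWithin_of_isOpen k hΩ hx] at this
  simpa [Function.comp_def] using this

theorem comp_contDiff [FiniteDimensional ℝ F] (hΩ : IsOpen Ω) (hf : UnifSmoothOn Ω 1 f) {Φ : F → G}
    (hΦ : ContDiff ℝ ∞ Φ) : UnifSmoothOn Ω 1 (fun i x => Φ (f i x)) := by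
  have := FiniteDimensional.proper_real F
  obtain ⟨C, -, hC⟩ := hf.norm_le fun _ => zero_le_one
  refine hf.comp_fixed hΩ isOpen_univ (isCompact_closedBall 0 C) (Set.subset_univ _)
    (fun i x hx => ?_) hΦ.contDiffOn
  simpa using hC i x hx

/-- If `Φ 0 = 0`, composition on the left with `Φ` keeps a weight that is at most one. -/
theorem comp_fixed_zero (hΩ : IsOpen Ω) (hw : ∀ i, 0 ≤ w i) (hw1 : ∀ i, w i ≤ 1)
    (hf : UnifSmoothOn Ω w f) {O K : Set F} (hO : IsOpen O)
    (hK : IsCompact K) (hKc : Convex ℝ K) (hK0 : (0 : F) ∈ K) (hKO : K ⊆ O)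
    (hfK : ∀ i, Set.MapsTo (f i) Ω K) {Φ : F → G}
    (hΦ : ContDiffOn ℝ ∞ Φ O) (hΦ0 : Φ 0 = 0) : UnifSmoothOn Ω w (fun i x => Φ (f i x)) := by
  have hf1 : UnifSmoothOn Ω 1 f := hf.mono_weight hw (c := 1) (by simpa using hw1)
  have hΦ' : ContDiffOn ℝ ∞ (fderiv ℝ Φ) O := hΦ.fderiv_of_isOpen hO (by simp)
  obtain ⟨M, hM⟩ := hK.exists_bound_of_continuousOn (hΦ'.continuousOn.mono hKO)
  obtain ⟨C, hC0, hC⟩ := hf.norm_le hw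
  refine of_fderiv (C := |M| * C)
    (fun i => hΦ.comp (hf.contDiffOn i) fun x hx => hKO (hfK i hx)) (fun i x hx => ?_) ?_
  -- the mean value inequality on `K` gives the bound without derivatives, the chain rule the others
  · have := hKc.norm_image_sub_le_of_norm_fderiv_le (𝕜 := ℝ) (f := Φ) (C := |M|)
      (fun y hy => (hΦ.contDiffAt (hO.mem_nhds (hKO hy))).differentiableAt (by simp))
      (fun y hy => (hM y hy).trans (le_abs_self M)) hK0 (hfK i hx)
    rw [hΦ0, sub_zero, sub_zero] at this
    rw [mul_assoc]
    exact this.trans (mul_le_mul_of_nonneg_left (hC i x hx) (abs_nonneg M))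
  · have h1 := hf1.comp_fixed hΩ hO hK hKO hfK hΦ'
    have h2 := h1.bilinear hΩ (fun _ => zero_le_one) hw (ContinuousLinearMap.compL ℝ E F G)
      (hf.fderiv hΩ)
    have h3 : UnifSmoothOn Ω w (fun i x => (ContinuousLinearMap.compL ℝ E F G)
        (fderiv ℝ Φ (f i x)) (fderiv ℝ (f i) x)) := by simpa using h2
    refine h3.congr hΩ fun i x hx => ?_
    have hd1 : DifferentiableAt ℝ Φ (f i x) :=
      (hΦ.contDiffAt (hO.mem_nhds (hKO (hfK i hx)))).differentiableAt (by simp)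
    have hd2 : DifferentiableAt ℝ (f i) x := (hf.contDiffAt hΩ i hx).differentiableAt (by simp)
    exact fderiv_comp x hd1 hd2

theorem inv (hΩ : IsOpen Ω) {f : ι → E → ℝ} (hf : UnifSmoothOn Ω 1 f) {c : ℝ} (hc : 0 < c)
    (h : ∀ i, ∀ x ∈ Ω, c ≤ f i x) : UnifSmoothOn Ω 1 (fun i x => (f i x)⁻¹) := by
  obtain ⟨C, -, hC⟩ := hf.norm_le fun _ => zero_le_one
  refine hf.comp_fixed hΩ isOpen_Ioi (isCompact_Icc (a := c) (b := C)) (O := Set.Ioi 0)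
    (fun x hx => hc.trans_le hx.1) (fun i x hx => ⟨h i x hx, ?_⟩)
    (contDiffOn_id.inv fun x hx => (ne_of_gt hx))
  exact (le_abs_self _).trans (by simpa using hC i x hx)

theorem prodMk (hΩ : IsOpen Ω) {g : ι → E → G} (hf : UnifSmoothOn Ω w f)
    (hg : UnifSmoothOn Ω w g) : UnifSmoothOn Ω w (fun i x => (f i x, g i x)) := by
  have h1 := hf.clm_comp hΩ (ContinuousLinearMap.inl ℝ F G)
  have h2 := hg.clm_comp hΩ (ContinuousLinearMap.inr ℝ F G)
  simpa using h1.add hΩ h2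

/-- Division by a constant that compares with the weight normalizes the weight. -/
theorem inv_smul (hΩ : IsOpen Ω) (hw : ∀ i, 0 < w i) (hf : UnifSmoothOn Ω w f) :
    UnifSmoothOn Ω 1 (fun i x => (w i)⁻¹ • f i x) := by
  have h1 : UnifSmoothOn Ω (fun i => (w i)⁻¹) (fun i (_ : E) => (w i)⁻¹) :=
    of_const (C := 1) fun i => by simp [abs_of_pos (hw i)]
  have := h1.smul hΩ (fun i => (inv_pos.2 (hw i)).le) (fun i => (hw i).le) hf
  refine this.mono_weight (fun i => ?_) (c := 1) fun i => ?_
  · rw [inv_mul_cancel₀ (hw i).ne']; exact zero_le_one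
  · rw [inv_mul_cancel₀ (hw i).ne']; simp

end Calculus

end UnifSmoothOn

/-! ### Superposition operators on bounded functions -/


section Superposition

variable {ι : Type*} [TopologicalSpace ι] [DiscreteTopology ι]

section

variable {E F : Type*} [NormedAddCommGroup E] [NormedSpace ℝ E]
  [NormedAddCommGroup F] [NormedSpace ℝ F]

/-- The superposition operator `γ ↦ V (γ)` of a family of functions with uniformly bounded
derivatives, on bounded families of curves. The index `i` is a variable of the bounded functions,
with the discrete topology, so that smoothness in the supremum norm contains uniformity in `i`. -/
noncomputable def superposition {V : ι → E → F} (hV : UnifSmoothOn Set.univ 1 V)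
    (γ : ι × ℝ →ᵇ E) : ι × ℝ →ᵇ F :=
  BoundedContinuousFunction.ofNormedAddCommGroup (fun p => V p.1 (γ p))
    (continuous_prod_of_discrete_left.2 fun i => (hV.contDiff i).continuous.comp
      (γ.continuous.comp (Continuous.prodMk_right i)))
    (hV.norm_le fun _ => zero_le_one).choose
    fun p => by simpa using (hV.norm_le fun _ => zero_le_one).choose_spec.2 p.1 (γ p) trivial

@[simp]
theorem superposition_apply {V : ι → E → F} (hV : UnifSmoothOn Set.univ 1 V)
    (γ : ι × ℝ →ᵇ E) (p : ι × ℝ) : superposition hV γ p = V p.1 (γ p) := rfl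

/-- Pointwise application of a bounded family of operators to a bounded family of vectors. -/
noncomputable def pointwiseApplyL {α : Type*} [TopologicalSpace α] (E F : Type*)
    [NormedAddCommGroup E] [NormedSpace ℝ E] [NormedAddCommGroup F] [NormedSpace ℝ F] :
    (α →ᵇ (E →L[ℝ] F)) →L[ℝ] (α →ᵇ E) →L[ℝ] (α →ᵇ F) :=
  LinearMap.mkContinuous₂
    (LinearMap.mk₂ ℝ
      (fun (A : α →ᵇ (E →L[ℝ] F)) (γ : α →ᵇ E) =>
        (BoundedContinuousFunction.ofNormedAddCommGroup (fun p => A p (γ p))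
          (A.continuous.clm_apply γ.continuous) (‖A‖ * ‖γ‖)
          fun p => (A p).le_of_opNorm_le_of_le (A.norm_coe_le_norm p) (γ.norm_coe_le_norm p) :
          α →ᵇ F))
      (fun A B γ => by ext p; simp) (fun c A γ => by ext p; simp)
      (fun A γ δ => by ext p; simp) (fun c A γ => by ext p; simp))
    1 fun A γ => by
      rw [one_mul, BoundedContinuousFunction.norm_le (by positivity)]
      exact fun p =>
        (A p).le_of_opNorm_le_of_le (A.norm_coe_le_norm p) (γ.norm_coe_le_norm p)

theorem norm_sub_sub_fderiv_le {f : E → F} (hf : ContDiff ℝ ∞ f) {C : ℝ}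
    (hC : ∀ x, ‖iteratedFDeriv ℝ 2 f x‖ ≤ C) (x h : E) :
    ‖f (x + h) - f x - fderiv ℝ f x h‖ ≤ C * ‖h‖ ^ 2 := by
  have hC0 : 0 ≤ C := (norm_nonneg _).trans (hC x)
  have hd : Differentiable ℝ (fderiv ℝ f) :=
    (hf.fderiv_right (m := ∞) (by simp)).differentiable (by simp)
  have h2 : ∀ z, ‖fderiv ℝ f z - fderiv ℝ f x‖ ≤ C * ‖z - x‖ := fun z =>
    Convex.norm_image_sub_le_of_norm_fderiv_le (𝕜 := ℝ) (fun y _ => hd y)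
      (fun y _ => by
        rw [← norm_iteratedFDeriv_one, norm_iteratedFDeriv_fderiv]
        exact hC y) convex_univ trivial trivial
  have h3 := Convex.norm_image_sub_le_of_norm_fderiv_le' (𝕜 := ℝ) (f := f) (φ := fderiv ℝ f x)
    (C := C * ‖h‖) (s := Metric.closedBall x ‖h‖) (x := x) (y := x + h)
    (fun y _ => hf.differentiable (by simp) y)
    (fun y hy => (h2 y).trans (by
      have := mem_closedBall_iff_norm.1 hy
      gcongr)) (convex_closedBall _ _) (by simp) (by simp)
  rw [add_sub_cancel_left] at h3
  exact h3.trans_eq (by ring)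

theorem hasFDerivAt_superposition {V : ι → E → F} (hV : UnifSmoothOn Set.univ 1 V)
    (γ : ι × ℝ →ᵇ E) :
    HasFDerivAt (superposition hV)
      (pointwiseApplyL E F (superposition (hV.fderiv isOpen_univ) γ)) γ := by
  obtain ⟨C, hC0, hC⟩ := hV.bound_nonneg (fun _ => zero_le_one) 2
  rw [hasFDerivAt_iff_isLittleO_nhds_zero]
  refine Asymptotics.IsBigO.trans_isLittleO (g := fun h : ι × ℝ →ᵇ E => ‖h‖ ^ 2) ?_
    (Asymptotics.isLittleO_norm_pow_id one_lt_two)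
  refine Asymptotics.IsBigO.of_bound C (Filter.Eventually.of_forall fun h => ?_)
  rw [Real.norm_of_nonneg (by positivity), BoundedContinuousFunction.norm_le (by positivity)]
  intro p
  refine (norm_sub_sub_fderiv_le (hV.contDiff p.1) (C := C) (fun x => by
    simpa using hC p.1 x trivial) (γ p) (h p)).trans ?_
  have := h.norm_coe_le_norm p
  gcongr

end

theorem contDiff_superposition {E F : Type u} [NormedAddCommGroup E] [NormedSpace ℝ E]
    [NormedAddCommGroup F] [NormedSpace ℝ F] {V : ι → E → F} (hV : UnifSmoothOn Set.univ 1 V) :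
    ContDiff ℝ ∞ (superposition hV) := by
  rw [contDiff_infty]
  intro n
  induction n generalizing F with
  | zero =>
    exact contDiff_zero.2 (continuous_iff_continuousAt.2 fun γ =>
      (hasFDerivAt_superposition hV γ).continuousAt)
  | succ n ih =>
    push_cast
    have h1 := ih (hV.fderiv isOpen_univ)
    have h2 : ContDiff ℝ n (fun A => pointwiseApplyL (α := ι × ℝ) E F A) :=
      ContinuousLinearMap.contDiff _
    exact contDiff_succ_iff_hasFDerivAt.2
      ⟨fun γ => pointwiseApplyL E F (superposition (hV.fderiv isOpen_univ) γ),
        h2.comp h1, hasFDerivAt_superposition hV⟩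

end Superposition

/-! ### Flows of families of vector fields -/

section Flow

theorem abs_clamp_le {T : ℝ} (hT : 0 ≤ T) (t : ℝ) : |max (-T) (min T t)| ≤ T :=
  abs_le.2 ⟨le_max_left _ _, max_le (by linarith) (min_le_left _ _)⟩

theorem intervalIntegrable_curve {κ : Type*} [TopologicalSpace κ] {X : Type*}
    [NormedAddCommGroup X] (γ : κ × ℝ →ᵇ X) (j : κ) (a b : ℝ) :
    IntervalIntegrable (fun s => γ (j, s)) MeasureTheory.volume a b :=
  (γ.continuous.comp (Continuous.prodMk_right j)).intervalIntegrable a b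

theorem norm_integral_curve_le {κ : Type*} [TopologicalSpace κ] {X : Type*}
    [NormedAddCommGroup X] [NormedSpace ℝ X] {T : ℝ} (hT : 0 ≤ T) (γ : κ × ℝ →ᵇ X) (p : κ × ℝ) :
    ‖∫ s in (0 : ℝ)..max (-T) (min T p.2), γ (p.1, s)‖ ≤ T * ‖γ‖ := by
  refine (intervalIntegral.norm_integral_le_of_norm_le_const
    fun s _ => γ.norm_coe_le_norm (p.1, s)).trans ?_
  rw [sub_zero, mul_comm]
  exact mul_le_mul_of_nonneg_right (abs_clamp_le hT p.2) (norm_nonneg γ)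

/-- Integration in time from `0`, stopped at `±T` so that bounded curves go to bounded curves. -/
noncomputable def stoppedIntegral (κ : Type*) [TopologicalSpace κ] [DiscreteTopology κ]
    (X : Type*) [NormedAddCommGroup X] [NormedSpace ℝ X] {T : ℝ} (hT : 0 ≤ T) :
    (κ × ℝ →ᵇ X) →L[ℝ] (κ × ℝ →ᵇ X) :=
  let L : (κ × ℝ →ᵇ X) →ₗ[ℝ] (κ × ℝ →ᵇ X) :=
    { toFun := fun γ => BoundedContinuousFunction.ofNormedAddCommGroup
        (fun p : κ × ℝ => ∫ s in (0 : ℝ)..max (-T) (min T p.2), γ (p.1, s))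
        (continuous_prod_of_discrete_left.2 fun j =>
          (intervalIntegral.continuous_primitive (intervalIntegrable_curve γ j) 0).comp
            (continuous_const.max (continuous_const.min continuous_id)))
        (T * ‖γ‖) (norm_integral_curve_le hT γ)
      map_add' := fun γ δ => by
        ext p
        exact intervalIntegral.integral_add (intervalIntegrable_curve γ p.1 _ _)
          (intervalIntegrable_curve δ p.1 _ _)
      map_smul' := fun c γ => by
        ext p
        exact intervalIntegral.integral_smul c _ }
  L.mkContinuous T fun γ =>
    (BoundedContinuousFunction.norm_le (mul_nonneg hT (norm_nonneg γ))).2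
      (norm_integral_curve_le hT γ)

variable {κ : Type*} [TopologicalSpace κ] [DiscreteTopology κ]
  {X : Type u} [NormedAddCommGroup X] [NormedSpace ℝ X]

theorem stoppedIntegral_apply {T : ℝ} (hT : 0 ≤ T) (γ : κ × ℝ →ᵇ X) (p : κ × ℝ) :
    stoppedIntegral κ X hT γ p = ∫ s in (0 : ℝ)..max (-T) (min T p.2), γ (p.1, s) := rfl

theorem norm_stoppedIntegral_le {T : ℝ} (hT : 0 ≤ T) : ‖stoppedIntegral κ X hT‖ ≤ T :=
  ContinuousLinearMap.opNorm_le_bound _ hT fun γ =>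
    (BoundedContinuousFunction.norm_le (mul_nonneg hT (norm_nonneg γ))).2
      (norm_integral_curve_le hT γ)

theorem norm_superposition_sub_le {W : κ → X → X} (hW : UnifSmoothOn Set.univ 1 W) {C : ℝ}
    (hC0 : 0 ≤ C) (hC : ∀ j x, ‖iteratedFDeriv ℝ 1 (W j) x‖ ≤ C) (γ δ : κ × ℝ →ᵇ X) :
    ‖superposition hW γ - superposition hW δ‖ ≤ C * ‖γ - δ‖ := by
  rw [BoundedContinuousFunction.norm_le (by positivity)]
  intro p
  have := Convex.norm_image_sub_le_of_norm_fderiv_le (𝕜 := ℝ) (f := W p.1) (C := C)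
    (s := Set.univ) (x := δ p) (y := γ p) (fun y _ => (hW.contDiff p.1).differentiable (by simp) y)
    (fun y _ => by rw [← norm_iteratedFDeriv_one]; exact hC p.1 y) convex_univ trivial trivial
  exact this.trans (mul_le_mul_of_nonneg_left ((γ - δ).norm_coe_le_norm p) hC0)

/-- For a short time, the integral equation of a family of vector fields is solved by a smooth map
into the space of bounded families of curves. -/
theorem exists_smooth_solution_operator [CompleteSpace X] {W : κ → X → X}
    (hW : UnifSmoothOn Set.univ 1 W) :
    ∃ (T : ℝ) (hT : 0 < T) (S : X → (κ × ℝ →ᵇ X)), ContDiff ℝ ∞ S ∧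
      ∀ v, S v = BoundedContinuousFunction.const (κ × ℝ) v +
        stoppedIntegral κ X hT.le (superposition hW (S v)) := by
  obtain ⟨C, hC0, hC⟩ := hW.bound_nonneg (fun _ => zero_le_one) 1
  simp only [Pi.one_apply, mul_one] at hC
  have hC' : ∀ j x, ‖iteratedFDeriv ℝ 1 (W j) x‖ ≤ C := fun j x => hC j x trivial
  set T : ℝ := 1 / (2 * (C + 1)) with hTdef
  have hT : 0 < T := by positivity
  have hTC : T * C ≤ 1 / 2 := by
    rw [hTdef, div_mul_eq_mul_div, div_le_div_iff₀ (by positivity) (by positivity)]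
    linarith
  set J := stoppedIntegral κ X hT.le
  have hJ : ‖J‖ ≤ T := norm_stoppedIntegral_le hT.le
  -- `Θ` is a perturbation of the identity with Lipschitz constant `1/2`, hence a homeomorphism; its
  -- derivative `1 - D γ` is invertible everywhere, so the inverse is smooth.
  set Θ : (κ × ℝ →ᵇ X) → (κ × ℝ →ᵇ X) := fun γ => γ - J (superposition hW γ) with hΘ
  have happ : ApproximatesLinearOn Θ
      ((ContinuousLinearEquiv.refl ℝ (κ × ℝ →ᵇ X) : (κ × ℝ →ᵇ X) ≃L[ℝ] (κ × ℝ →ᵇ X)) :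
        (κ × ℝ →ᵇ X) →L[ℝ] (κ × ℝ →ᵇ X)) Set.univ (1 / 2) := by
    intro γ _ δ _
    have h1 : Θ γ - Θ δ - (γ - δ) = -J (superposition hW γ - superposition hW δ) := by
      simp only [hΘ, map_sub]; abel
    have h2 : ‖J (superposition hW γ - superposition hW δ)‖ ≤ T * (C * ‖γ - δ‖) :=
      J.le_of_opNorm_le_of_le hJ (norm_superposition_sub_le hW hC0 hC' γ δ)
    calc _ = ‖J (superposition hW γ - superposition hW δ)‖ := by
          rw [← norm_neg (J _), ← h1]; rfl
      _ ≤ T * C * ‖γ - δ‖ := by rw [mul_assoc]; exact h2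
      _ ≤ _ := by
          have := mul_le_mul_of_nonneg_right hTC (norm_nonneg (γ - δ))
          simpa using this
  have hsub : Subsingleton (κ × ℝ →ᵇ X) ∨ (1 / 2 : NNReal) <
      ‖((ContinuousLinearEquiv.refl ℝ (κ × ℝ →ᵇ X)).symm :
        (κ × ℝ →ᵇ X) →L[ℝ] (κ × ℝ →ᵇ X))‖₊⁻¹ := by
    rcases subsingleton_or_nontrivial (κ × ℝ →ᵇ X) with h | h
    · exact Or.inl h
    · right
      have : ‖((ContinuousLinearEquiv.refl ℝ (κ × ℝ →ᵇ X)).symm :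
        (κ × ℝ →ᵇ X) →L[ℝ] (κ × ℝ →ᵇ X))‖₊ = 1 := by
        simp
      rw [this, inv_one]
      exact NNReal.half_lt_self one_ne_zero
  set e := happ.toHomeomorph Θ hsub with he
  have heΘ : ∀ γ, e γ = Θ γ := fun γ => rfl
  have hΘd : ContDiff ℝ ∞ Θ := contDiff_id.sub (J.contDiff.comp (contDiff_superposition hW))
  set D : (κ × ℝ →ᵇ X) → (κ × ℝ →ᵇ X) →L[ℝ] (κ × ℝ →ᵇ X) := fun γ =>
    J ∘L pointwiseApplyL X X (superposition (hW.fderiv isOpen_univ) γ) with hD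
  have hDn : ∀ γ, ‖D γ‖ < 1 := by
    intro γ
    refine lt_of_le_of_lt (ContinuousLinearMap.opNorm_le_bound _ (by norm_num : (0:ℝ) ≤ 1 / 2)
      fun δ => ?_) (by norm_num : (1 / 2 : ℝ) < 1)
    have h1 : ‖pointwiseApplyL X X (superposition (hW.fderiv isOpen_univ) γ) δ‖ ≤ C * ‖δ‖ := by
      rw [BoundedContinuousFunction.norm_le (by positivity)]
      intro p
      refine ContinuousLinearMap.le_of_opNorm_le_of_le _ ?_ (δ.norm_coe_le_norm p)
      rw [superposition_apply, ← norm_iteratedFDeriv_one]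
      exact hC' _ _
    calc _ ≤ T * (C * ‖δ‖) := J.le_of_opNorm_le_of_le hJ h1
      _ = T * C * ‖δ‖ := by ring
      _ ≤ _ := mul_le_mul_of_nonneg_right hTC (norm_nonneg δ)
  have hderiv : ∀ γ, HasFDerivAt Θ (((ContinuousLinearEquiv.unitsEquiv ℝ (κ × ℝ →ᵇ X)
      (Units.oneSub (D γ) (hDn γ))) : (κ × ℝ →ᵇ X) ≃L[ℝ] (κ × ℝ →ᵇ X)) :
        (κ × ℝ →ᵇ X) →L[ℝ] (κ × ℝ →ᵇ X)) γ := by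
    intro γ
    have h1 := (hasFDerivAt_id γ).sub (J.hasFDerivAt.comp γ (hasFDerivAt_superposition hW γ))
    exact h1.congr_fderiv rfl
  have hsymm : ContDiff ℝ ∞ e.symm := e.contDiff_symm (fun γ => hderiv γ) hΘd
  refine ⟨T, hT, fun v => e.symm (BoundedContinuousFunction.const _ v), ?_, fun v => ?_⟩
  · have hc : ContDiff ℝ ∞ (fun v : X => BoundedContinuousFunction.const (κ × ℝ) v) := by
      let L : X →ₗ[ℝ] (κ × ℝ →ᵇ X) :=
        { toFun := fun v => BoundedContinuousFunction.const (κ × ℝ) v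
          map_add' := fun v w => by ext p; rfl
          map_smul' := fun c v => by ext p; rfl }
      exact (L.mkContinuous 1 fun v => by
        rw [one_mul]
        exact (BoundedContinuousFunction.norm_le (norm_nonneg v)).2 fun p => le_rfl).contDiff
    exact hsymm.comp hc
  · have h1 : Θ (e.symm (BoundedContinuousFunction.const _ v)) =
        BoundedContinuousFunction.const _ v := by
      rw [← heΘ, Homeomorph.apply_symm_apply]
    exact sub_eq_iff_eq_add.1 h1

end Flow

section GlobalFlow

variable {X : Type u} [NormedAddCommGroup X] [NormedSpace ℝ X]

theorem eqOn_of_integralCurve {V : X → X} {K : NNReal} (hK : LipschitzWith K V) {γ δ : ℝ → X}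
    {T : ℝ} (hγ : ∀ t ∈ Set.Ioo (-T) T, HasDerivAt γ (V (γ t)) t)
    (hδ : ∀ t ∈ Set.Ioo (-T) T, HasDerivAt δ (V (δ t)) t) (h0 : γ 0 = δ 0) :
    Set.EqOn γ δ (Set.Ioo (-T) T) := by
  intro t ht
  have hT : 0 < T := by linarith [ht.1, ht.2]
  exact ODE_solution_unique_of_mem_Ioo (v := fun _ => V) (s := fun _ => Set.univ) (K := K)
    (fun _ _ => hK.lipschitzOnWith) (t₀ := 0) ⟨by linarith, hT⟩
    (fun t ht => ⟨hγ t ht, trivial⟩) (fun t ht => ⟨hδ t ht, trivial⟩) h0 ht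

theorem exists_integralCurve_Ioo [CompleteSpace X] {V : X → X} {K M : NNReal}
    (hK : LipschitzWith K V) (hM : ∀ x, ‖V x‖ ≤ M) (x : X) (T : ℝ) (hT : 0 < T) :
    ∃ γ : ℝ → X, γ 0 = x ∧ ∀ t ∈ Set.Ioo (-T) T, HasDerivAt γ (V (γ t)) t := by
  have h0 : (0 : ℝ) ∈ Set.Icc (-T) T := ⟨by linarith, hT.le⟩
  have hp : IsPicardLindelof (fun _ => V) (⟨0, h0⟩ : Set.Icc (-T) T) x (M * T.toNNReal) 0 M K :=
    { lipschitzOnWith := fun _ _ => hK.lipschitzOnWith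
      continuousOn := fun _ _ => continuousOn_const
      norm_le := fun _ _ y _ => hM y
      mul_max_le := by simp [Real.coe_toNNReal T hT.le] }
  obtain ⟨γ, hγ0, hγ⟩ := hp.exists_eq_forall_mem_Icc_hasDerivWithinAt₀
  exact ⟨γ, hγ0, fun t ht => (hγ t (Set.Ioo_subset_Icc_self ht)).hasDerivAt
    (Icc_mem_nhds ht.1 ht.2)⟩

theorem exists_integralCurve [CompleteSpace X] {V : X → X} {K M : NNReal}
    (hK : LipschitzWith K V) (hM : ∀ x, ‖V x‖ ≤ M) (x : X) :
    ∃ γ : ℝ → X, γ 0 = x ∧ ∀ t, HasDerivAt γ (V (γ t)) t := by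
  choose γ hγ0 hγ using fun n : ℕ =>
    exists_integralCurve_Ioo hK hM x ((n : ℝ) + 1) (by positivity)
  have hagree : ∀ (m n : ℕ) (t : ℝ), |t| < m + 1 → |t| < n + 1 → γ m t = γ n t := by
    have key : ∀ (m n : ℕ) (t : ℝ), m ≤ n → |t| < m + 1 → γ m t = γ n t := by
      intro m n t hmn ht
      have hmn' : (m : ℝ) ≤ n := by exact_mod_cast hmn
      exact eqOn_of_integralCurve hK (hγ m)
        (fun s hs => hγ n s ⟨by linarith [hs.1], by linarith [hs.2]⟩)
        ((hγ0 m).trans (hγ0 n).symm) (abs_lt.1 ht)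
    intro m n t hm hn
    rcases le_total m n with h | h
    · exact key m n t h hm
    · exact (key n m t h hn).symm
  refine ⟨fun t => γ ⌈|t|⌉₊ t, by simpa using hγ0 0, fun t => ?_⟩
  have hlt : ∀ s : ℝ, |s| < (⌈|s|⌉₊ : ℝ) + 1 := fun s => (Nat.le_ceil _).trans_lt (lt_add_one _)
  have h1 := hγ ⌈|t|⌉₊ t (abs_lt.1 (hlt t))
  refine h1.congr_of_eventuallyEq ?_
  have hopen : {s : ℝ | |s| < (⌈|t|⌉₊ : ℝ) + 1} ∈ nhds t :=
    (isOpen_lt continuous_abs continuous_const).mem_nhds (hlt t)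
  filter_upwards [hopen] with s hs
  exact hagree _ _ s (hlt s) hs

end GlobalFlow

/-- `Φ i t` is the time `t` map of the vector field `V i`. -/
structure IsFlowOf {ι : Type*} {X : Type u} [NormedAddCommGroup X] [NormedSpace ℝ X]
    (V : ι → X → X) (Φ : ι → ℝ → X → X) : Prop where
  zero : ∀ i x, Φ i 0 x = x
  hasDerivAt : ∀ i x t, HasDerivAt (fun t => Φ i t x) (V i (Φ i t x)) t

section

variable {ι : Type*} {X : Type u} [NormedAddCommGroup X] [NormedSpace ℝ X] {V : ι → X → X}

theorem UnifSmoothOn.lipschitzWith (hV : UnifSmoothOn Set.univ 1 V) :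
    ∃ K : NNReal, ∀ i, LipschitzWith K (V i) := by
  obtain ⟨C, hC0, hC⟩ := hV.bound_nonneg (fun _ => zero_le_one) 1
  lift C to NNReal using hC0
  refine ⟨C, fun i => lipschitzWith_of_nnnorm_fderiv_le (𝕜 := ℝ)
    ((hV.contDiff i).differentiable (by simp)) fun x => ?_⟩
  have := hC i x trivial
  rw [norm_iteratedFDeriv_one] at this
  rw [← NNReal.coe_le_coe]
  simpa using this

theorem exists_isFlowOf [CompleteSpace X] (hV : UnifSmoothOn Set.univ 1 V) :
    ∃ Φ, IsFlowOf V Φ := by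
  obtain ⟨K, hK⟩ := hV.lipschitzWith
  obtain ⟨C, hC0, hC⟩ := hV.norm_le fun _ => zero_le_one
  lift C to NNReal using hC0
  choose Φ h0 h1 using fun (i : ι) (x : X) => exists_integralCurve (hK i) (M := C)
    (fun y => by simpa using hC i y trivial) x
  exact ⟨fun i t x => Φ i x t, fun i x => h0 i x, fun i x t => h1 i x t⟩

namespace IsFlowOf

variable {Φ : ι → ℝ → X → X}

theorem eq_of_integralCurve (hΦ : IsFlowOf V Φ) (hV : UnifSmoothOn Set.univ 1 V) (i : ι)
    {γ : ℝ → X} (hγ : ∀ t, HasDerivAt γ (V i (γ t)) t) (t : ℝ) : Φ i t (γ 0) = γ t := by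
  obtain ⟨K, hK⟩ := hV.lipschitzWith
  exact eqOn_of_integralCurve (hK i) (T := |t| + 1) (fun s _ => hΦ.hasDerivAt i (γ 0) s)
    (fun s _ => hγ s) (hΦ.zero i _) (abs_lt.1 (lt_add_one |t|))

theorem add (hΦ : IsFlowOf V Φ) (hV : UnifSmoothOn Set.univ 1 V) (i : ι) (s t : ℝ) (x : X) :
    Φ i s (Φ i t x) = Φ i (s + t) x := by
  have h := hΦ.eq_of_integralCurve hV i (γ := fun r => Φ i (r + t) x)
    (fun r => (hΦ.hasDerivAt i x (r + t)).comp_add_const r t) s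
  simpa using h

/-- For a short time the displacement of the flow is smooth, with uniform bounds. The base point
is made part of the index, so that a bound at the origin becomes a bound everywhere. -/
theorem exists_unifSmoothOn_displacement [CompleteSpace X] (hΦ : IsFlowOf V Φ)
    (hV : UnifSmoothOn Set.univ 1 V) :
    ∃ T : ℝ, 0 < T ∧ ∀ t ∈ Set.Ioo (-T) T, UnifSmoothOn Set.univ 1 (fun i x => Φ i t x - x) := by
  let _ : TopologicalSpace (ι × X) := ⊥
  have : DiscreteTopology (ι × X) := ⟨rfl⟩
  obtain ⟨K, hK⟩ := hV.lipschitzWith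
  -- the fields `V i` seen from the moving origin `x`
  set W : ι × X → X → X := fun j v => V j.1 (j.2 + v) with hWdef
  have hW : UnifSmoothOn Set.univ 1 W := by
    refine ⟨fun j => ((hV.contDiff j.1).comp (contDiff_const.add contDiff_id)).contDiffOn,
      fun k => (hV.bound k).imp fun C hC j v _ => ?_⟩
    rw [hWdef, iteratedFDeriv_comp_add_left]
    exact hC j.1 _ trivial
  obtain ⟨T, hT, S, hS, hSeq⟩ := exists_smooth_solution_operator hW
  refine ⟨T, hT, fun t ht => ?_⟩
  have hcurve : ∀ (i : ι) (x v : X) (s : ℝ), s ∈ Set.Ioo (-T) T →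
      S v ((i, x), s) + x = Φ i s (x + v) := by
    intro i x v
    refine eqOn_of_integralCurve (hK i) (fun s hs => ?_)
      (fun s _ => hΦ.hasDerivAt i (x + v) s) ?_
    · have hcont : Continuous fun r => superposition hW (S v) ((i, x), r) :=
        (superposition hW (S v)).continuous.comp (Continuous.prodMk_right (i, x))
      have h1 : HasDerivAt (fun r => (v + ∫ q in (0 : ℝ)..r,
          superposition hW (S v) ((i, x), q)) + x) (superposition hW (S v) ((i, x), s)) s :=
        ((hcont.integral_hasStrictDerivAt 0 s).hasDerivAt.const_add v).add_const x
      have h2 : superposition hW (S v) ((i, x), s) = V i (S v ((i, x), s) + x) := by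
        simp [hWdef, add_comm]
      rw [← h2]
      refine h1.congr_of_eventuallyEq ?_
      filter_upwards [Ioo_mem_nhds hs.1 hs.2] with r hr
      conv_lhs => rw [hSeq v]
      rw [BoundedContinuousFunction.add_apply, stoppedIntegral_apply, min_eq_right hr.2.le,
        max_eq_right hr.1.le]
      rfl
    · rw [hΦ.zero, hSeq v, BoundedContinuousFunction.add_apply, stoppedIntegral_apply,
        min_eq_right hT.le, max_eq_right (by linarith)]
      simp [add_comm]
  -- the displacement is evaluation of the smooth map `S` at one index and one time
  have hdisp : ∀ (i : ι) (x : X), (fun v => Φ i t (x + v) - (x + v)) =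
      fun v => BoundedContinuousFunction.evalCLM ℝ ((i, x), t) (S v) - v := by
    intro i x
    ext v
    rw [← hcurve i x v t ht]
    simp only [BoundedContinuousFunction.evalCLM_apply]
    abel
  have hsm : ∀ (i : ι) (x : X),
      ContDiff ℝ ∞ (fun v => BoundedContinuousFunction.evalCLM ℝ ((i, x), t) (S v) - v) :=
    fun i x => ((ContinuousLinearMap.contDiff _).comp hS).sub contDiff_id
  refine ⟨fun i => ?_, fun k => ?_⟩
  · have h1 := hsm i 0
    rw [← hdisp i 0] at h1
    simpa using h1.contDiffOn
  · refine ⟨‖iteratedFDeriv ℝ k S 0‖ + ‖iteratedFDeriv ℝ k (id : X → X) 0‖, fun i x _ => ?_⟩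
    have h1 : iteratedFDeriv ℝ k (fun x => Φ i t x - x) x =
        iteratedFDeriv ℝ k (fun v => Φ i t (x + v) - (x + v)) 0 := by
      have := iteratedFDeriv_comp_add_left (𝕜 := ℝ) (f := fun x => Φ i t x - x) k x 0
      simpa using this.symm
    have hSk : ContDiffAt ℝ k S 0 := hS.contDiffAt.of_le (mod_cast le_top)
    have h3 : ContDiffAt ℝ k
        (BoundedContinuousFunction.evalCLM ℝ ((i, x), t) ∘ S) 0 :=
      (ContinuousLinearMap.contDiff _).contDiffAt.comp 0 hSk
    rw [h1, hdisp i x, show (fun v => BoundedContinuousFunction.evalCLM ℝ ((i, x), t) (S v) - v) =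
      (BoundedContinuousFunction.evalCLM ℝ ((i, x), t) ∘ S) - id from rfl,
      iteratedFDeriv_sub_apply h3 contDiffAt_id, Pi.one_apply, mul_one]
    refine (norm_sub_le _ _).trans (add_le_add_left ?_ _)
    refine (ContinuousLinearMap.norm_iteratedFDeriv_comp_left _ hSk le_rfl).trans ?_
    refine mul_le_of_le_one_left (norm_nonneg _) (ContinuousLinearMap.opNorm_le_bound _
      zero_le_one fun γ => ?_)
    rw [one_mul]
    exact γ.norm_coe_le_norm _

/-- The displacement of the flow is smooth for all times: long times are reached by iteration. -/
theorem unifSmoothOn_displacement [CompleteSpace X] (hΦ : IsFlowOf V Φ)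
    (hV : UnifSmoothOn Set.univ 1 V) (t : ℝ) :
    UnifSmoothOn Set.univ 1 (fun i x => Φ i t x - x) := by
  obtain ⟨T, hT, h⟩ := hΦ.exists_unifSmoothOn_displacement hV
  obtain ⟨N, hN⟩ := exists_nat_gt (|t| / T)
  have hN0 : (0 : ℝ) < N := (div_nonneg (abs_nonneg t) hT.le).trans_lt hN
  set s := t / N
  have hs : s ∈ Set.Ioo (-T) T := by
    refine abs_lt.1 ?_
    rw [abs_div, Nat.abs_cast, div_lt_iff₀ hN0, mul_comm]
    exact (div_lt_iff₀ hT).1 hN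
  have key : ∀ n : ℕ, UnifSmoothOn Set.univ 1 (fun i x => Φ i (n * s) x - x) := by
    intro n
    induction n with
    | zero =>
      simpa [hΦ.zero] using UnifSmoothOn.of_const (ι := ι) (E := X) (Ω := Set.univ) (w := 1)
        (c := fun _ => (0 : X)) (C := 0) (by simp)
    | succ n ih =>
      have h1 := (h s hs).comp_clm_add isOpen_univ isOpen_univ (fun _ => zero_le_one)
        (ContinuousLinearMap.id ℝ X) ih (fun i => Set.mapsTo_univ _ _)
      simp only [ContinuousLinearMap.id_apply, add_sub_cancel] at h1
      refine (h1.add isOpen_univ ih).congr isOpen_univ fun i x _ => ?_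
      have h3 : ((n + 1 : ℕ) : ℝ) * s = s + n * s := by push_cast; ring
      simp only [h3, ← hΦ.add hV]
      abel
  have := key N
  rwa [mul_div_cancel₀ t hN0.ne'] at this

end IsFlowOf

end

/-! ### First order equations -/

/-- The initial value problem `∂_v φ = g(x, φ)`, with `φ = 0` where `σ ≤ a`, has a solution up to
`σ = a + T`, with uniform bounds on all derivatives. It is read off from the flow of `(v, g)`: go
back along `v` for the time `T`, and return with the second component starting from `0`. -/
theorem exists_unifSmoothOn_transport {ι : Type*} {E : Type u} [NormedAddCommGroup E]
    [NormedSpace ℝ E] [CompleteSpace E] (σ : E →L[ℝ] ℝ) {v : ι → E → E}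
    (hv : UnifSmoothOn Set.univ 1 v) (hσ : ∀ i x, σ (v i x) = 1) {g : ι → E × ℝ → ℝ}
    (hg : UnifSmoothOn Set.univ 1 g) {a : ℝ} (hga : ∀ i (x : E × ℝ), σ x.1 ≤ a → g i x = 0)
    {T : ℝ} (hT : 0 ≤ T) :
    ∃ φ : ι → E → ℝ, UnifSmoothOn Set.univ 1 φ ∧ (∀ i x, σ x ≤ a → φ i x = 0) ∧
      ∀ i x, σ x < a + T → fderiv ℝ (φ i) x (v i x) = g i (x, φ i x) := by
  set V : ι → E × ℝ → E × ℝ := fun i p => (v i p.1, g i p) with hVdef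
  have hV : UnifSmoothOn Set.univ 1 V :=
    (hv.comp_clm isOpen_univ isOpen_univ (fun _ => zero_le_one)
      (ContinuousLinearMap.fst ℝ E ℝ) (Set.mapsTo_univ _ _)).prodMk isOpen_univ hg
  obtain ⟨Ψ, hΨ⟩ := exists_isFlowOf hV
  have hd1 : ∀ i p t, HasDerivAt (fun t => (Ψ i t p).1) (v i (Ψ i t p).1) t := fun i p t =>
    (hΨ.hasDerivAt i p t).fst
  have hd2 : ∀ i p t, HasDerivAt (fun t => (Ψ i t p).2) (g i (Ψ i t p)) t := fun i p t =>
    (hΨ.hasDerivAt i p t).snd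
  have hσt : ∀ i p t, σ (Ψ i t p).1 = σ p.1 + t := by
    intro i p t
    have h1 : ∀ t, HasDerivAt (fun t => σ (Ψ i t p).1 - t) 0 t := fun t => by
      have h := (σ.hasFDerivAt.comp_hasDerivAt t (hd1 i p t)).sub (hasDerivAt_id t)
      rw [hσ, sub_self] at h
      exact h
    have h2 := is_const_of_deriv_eq_zero (fun t => (h1 t).differentiableAt)
      (fun t => (h1 t).deriv) t 0
    simp only [hΨ.zero, sub_zero] at h2
    linarith
  -- The second component stays `0` as long as the first is in `{σ ≤ a}`.
  have hzero : ∀ i (x : E) t, σ x ≤ a → σ x + t ≤ a → (Ψ i t (x, 0)).2 = 0 := by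
    intro i x t hx hxt
    have h1 : ∀ s ∈ Set.uIcc 0 t, HasDerivWithinAt (fun t => (Ψ i t (x, 0)).2) 0
        (Set.uIcc 0 t) s := by
      intro s hs
      have hs' : s ≤ max 0 t := hs.2
      have h2 : g i (Ψ i s (x, 0)) = 0 := hga i _ (by
        rw [hσt]
        rcases max_choice 0 t with h | h <;> rw [h] at hs' <;> simp <;> linarith)
      have h3 := (hd2 i (x, 0) s).hasDerivWithinAt (s := Set.uIcc 0 t)
      rwa [h2] at h3
    have h3 := (convex_uIcc (0 : ℝ) t).norm_image_sub_le_of_norm_hasDerivWithin_le (C := 0) h1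
      (fun s _ => by simp) Set.left_mem_uIcc Set.right_mem_uIcc
    simpa [hΨ.zero] using h3
  -- `x₀` is the point on the characteristic through `x`, at time `-T`.
  set x₀ : ι → E → E := fun i x => (Ψ i (-T) (x, 0)).1 with hx₀
  have hx₀σ : ∀ i x, σ (x₀ i x) = σ x - T := fun i x => by
    rw [hx₀]; simp only [hσt]; ring
  have hfwd : ∀ i (p : E × ℝ) s t, (Ψ i t ((Ψ i s p).1, 0)).1 = (Ψ i (t + s) p).1 := by
    intro i p s t
    obtain ⟨K, hK⟩ := hv.lipschitzWith
    have h1 := eqOn_of_integralCurve (hK i) (T := |t| + 1)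
      (fun r _ => hd1 i ((Ψ i s p).1, 0) r)
      (fun r _ => (hd1 i p (r + s)).comp_add_const r s) (by simp [hΨ.zero])
    exact h1 (abs_lt.1 (lt_add_one |t|))
  have hback : ∀ i x, (Ψ i T (x₀ i x, 0)).1 = x := fun i x => by
    rw [hx₀]; simp only [hfwd]; simp [hΨ.zero]
  set φ : ι → E → ℝ := fun i x => (Ψ i T (x₀ i x, 0)).2 with hφdef
  have hφ : UnifSmoothOn Set.univ 1 φ := by
    have hT1 := hΨ.unifSmoothOn_displacement hV (-T)
    have hT2 := hΨ.unifSmoothOn_displacement hV T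
    have h1 := ((hT1.comp_clm isOpen_univ isOpen_univ (fun _ => zero_le_one)
      (ContinuousLinearMap.inl ℝ E ℝ) (Set.mapsTo_univ _ _)).clm_comp isOpen_univ
        (ContinuousLinearMap.fst ℝ E ℝ)).clm_comp isOpen_univ (ContinuousLinearMap.inl ℝ E ℝ)
    have h2 := (hT2.comp_clm_add isOpen_univ isOpen_univ (fun _ => zero_le_one)
      (ContinuousLinearMap.inl ℝ E ℝ) h1 (fun i => Set.mapsTo_univ _ _)).clm_comp isOpen_univ
        (ContinuousLinearMap.snd ℝ E ℝ)
    refine h2.congr isOpen_univ fun i x _ => ?_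
    simp [hφdef, hx₀]
  refine ⟨φ, hφ, fun i x hx => ?_, fun i x hx => ?_⟩
  · exact hzero i _ T (by rw [hx₀σ]; linarith) (by rw [hx₀σ]; linarith)
  · -- `φ` along the curve through `(x, φ x)` is the second component of the curve.
    have hcurve : ∀ᶠ t in nhds (0 : ℝ),
        φ i (Ψ i (T + t) (x₀ i x, 0)).1 = (Ψ i (T + t) (x₀ i x, 0)).2 := by
      have hpos : 0 < a + T - σ x := by linarith
      filter_upwards [Iio_mem_nhds hpos] with t ht
      have ht' : t < a + T - σ x := ht
      have h1 : x₀ i (Ψ i (T + t) (x₀ i x, 0)).1 = (Ψ i t (x₀ i x, 0)).1 := by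
        rw [hx₀]; simp only [hfwd]; congr 2; ring
      have h2 : ((Ψ i t (x₀ i x, 0)).1, (0 : ℝ)) = Ψ i t (x₀ i x, 0) := by
        refine Prod.ext rfl (hzero i _ t ?_ ?_).symm <;> rw [hx₀σ] <;> linarith
      rw [hφdef]
      simp only [h1, h2, hΨ.add hV]
    have hx1 : Ψ i (T + 0) (x₀ i x, 0) = (x, φ i x) := by
      rw [add_zero]; exact Prod.ext (hback i x) rfl
    have e1 : HasDerivAt (fun t => φ i (Ψ i (T + t) (x₀ i x, 0)).1)
        (fderiv ℝ (φ i) x (v i x)) 0 := by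
      have h3 := (hd1 i (x₀ i x, 0) (T + 0)).comp_const_add T 0
      have h4 : HasFDerivAt (φ i) (fderiv ℝ (φ i) x) (Ψ i (T + 0) (x₀ i x, 0)).1 := by
        rw [hx1]; exact ((hφ.contDiff i).differentiable (by simp) x).hasFDerivAt
      have h5 := h4.comp_hasDerivAt (0 : ℝ) h3
      rw [hx1] at h5
      exact h5
    have e2 : HasDerivAt (fun t => (Ψ i (T + t) (x₀ i x, 0)).2) (g i (x, φ i x)) 0 := by
      have h3 := (hd2 i (x₀ i x, 0) (T + 0)).comp_const_add T 0
      rwa [hx1] at h3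
    exact (e1.congr_of_eventuallyEq (hcurve.mono fun t ht => ht.symm)).unique e2

/-! ### The nonlinear transport equation -/

/-- With `p = |Du|²`, `L = Δu`, `Q = Q(u)` and `w = (m - 1) / u`, the equation for the metric factor
`f` is `metricDen m p f * ⟨Df, Du⟩ = metricNum p L Q w f`; this is the quadratic polynomial on the
right. -/
noncomputable def metricNum (p L Q w f : ℝ) : ℝ := -f ^ 2 * (p * L - Q) + f * (p * w - L) + w

/-- The factor of `⟨Df, Du⟩` once the equation for `f` is cleared of the denominator
`1 + f |Du|²`. -/
noncomputable def metricDen (m p f : ℝ) : ℝ := (m * (1 + f * p) + 1) / 2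

/-- The difference quotient of `metricNum` between `1` and `f`. -/
noncomputable def metricSlope (p L Q w f : ℝ) : ℝ := -(f + 1) * (p * L - Q) - L + p * w

theorem metricNum_eq (p L Q w f : ℝ) :
    metricNum p L Q w f = ((1 + p) * (w - L) + Q) + (f - 1) * metricSlope p L Q w f := by
  simp only [metricNum, metricSlope]; ring

theorem half_le_metricDen {m p f : ℝ} (hm : 0 ≤ m) (hp : 0 ≤ p) (hf : 0 ≤ f) :
    1 / 2 ≤ metricDen m p f := by
  have : 0 ≤ m * (1 + f * p) := by positivity
  rw [metricDen]; linarith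

theorem metricDen_pos {m p f : ℝ} (hm : 0 ≤ m) (hp : 0 ≤ p) (hf : 0 ≤ f) : 0 < metricDen m p f :=
  lt_of_lt_of_le (by norm_num) (half_le_metricDen hm hp hf)

/-- Numerator and denominator both grow linearly, up to the factor `f - 1` of the numerator. -/
theorem abs_metricSlope_div_le {m p L Q w f p₀ C : ℝ} (hm : 1 ≤ m) (hp₀ : 0 < p₀) (hp₁ : p₀ ≤ 1)
    (hp : p₀ ≤ p) (hC : |p * L - Q| + |L| + |p * w| ≤ C) (hf : 0 < f) :
    |metricSlope p L Q w f / metricDen m p f| ≤ 2 * C / p₀ := by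
  have hpp : 0 < p := hp₀.trans_le hp
  have hden : 0 < metricDen m p f := metricDen_pos (by linarith) hpp.le hf.le
  have h1 : |metricSlope p L Q w f| ≤ (f + 1) * C := by
    have e1 : |-(f + 1) * (p * L - Q)| = (f + 1) * |p * L - Q| := by
      rw [abs_mul, abs_neg, abs_of_pos (by linarith : 0 < f + 1)]
    have e2 : |metricSlope p L Q w f| ≤ (f + 1) * |p * L - Q| + |L| + |p * w| := by
      rw [← e1, metricSlope]
      exact (abs_add_le _ _).trans (add_le_add_left (abs_sub _ _) _)
    nlinarith [abs_nonneg L, abs_nonneg (p * w)]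
  have h2 : p₀ * (f + 1) ≤ 2 * metricDen m p f := by
    rw [metricDen]
    nlinarith [mul_le_mul_of_nonneg_left hp hf.le, mul_nonneg hf.le hpp.le]
  rw [abs_div, abs_of_pos hden, div_le_div_iff₀ hden hp₀]
  have hC0 : 0 ≤ C := le_trans (by positivity) hC
  nlinarith [mul_le_mul_of_nonneg_left h2 hC0, mul_le_mul_of_nonneg_right h1 hp₀.le]

/-- The right-hand side of the equation for `f` is Lipschitz on all of `(0, ∞)`. -/
theorem abs_metricNum_div_sub_le {m p L Q w f g p₀ C : ℝ} (hm : 1 ≤ m) (hp₀ : 0 < p₀)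
    (hp : p₀ ≤ p) (hpC : p ≤ C) (h1 : |p * L - Q| ≤ C) (h2 : |p * w - L| ≤ C) (h3 : |w| ≤ C)
    (hf : 0 < f) (hg : 0 < g) :
    |metricNum p L Q w f / metricDen m p f - metricNum p L Q w g / metricDen m p g| ≤
      (4 * C / (m * p₀) + C + m * C ^ 2) * |f - g| := by
  have hm0 : 0 < m := by linarith
  have hpp : 0 < p := hp₀.trans_le hp
  have hC : 0 < C := hpp.trans_le hpC
  have hf' : 0 < metricDen m p f := metricDen_pos hm0.le hpp.le hf.le
  have hg' : 0 < metricDen m p g := metricDen_pos hm0.le hpp.le hg.le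
  -- the denominator is `d + e f`, and the difference of the two quotients is a multiple of `f - g`
  set d : ℝ := (m + 1) / 2 with hd
  set e : ℝ := m * p / 2 with he
  have hd1 : 1 ≤ d := by rw [hd]; linarith
  have he0 : 0 < e := by rw [he]; positivity
  have Df : metricDen m p f = d + e * f := by rw [metricDen, hd, he]; ring
  have Dg : metricDen m p g = d + e * g := by rw [metricDen, hd, he]; ring
  have key : metricNum p L Q w f / metricDen m p f - metricNum p L Q w g / metricDen m p g =
      (-(p * L - Q) * ((d * (f + g) + e * (f * g)) / (metricDen m p f * metricDen m p g)) +
        (p * w - L) * (d / (metricDen m p f * metricDen m p g)) -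
        w * (e / (metricDen m p f * metricDen m p g))) * (f - g) := by
    field_simp
    rw [Df, Dg, metricNum, metricNum]; ring
  rw [key, abs_mul]
  refine mul_le_mul_of_nonneg_right ?_ (abs_nonneg _)
  have hprod : metricDen m p f * metricDen m p g = d ^ 2 + d * e * (f + g) + e ^ 2 * (f * g) := by
    rw [Df, Dg]; ring
  have hP : 0 < metricDen m p f * metricDen m p g := mul_pos hf' hg'
  have hfg : 0 < f * g := mul_pos hf hg
  have hfg' : 0 < f + g := add_pos hf hg
  have b1 : (d * (f + g) + e * (f * g)) / (metricDen m p f * metricDen m p g) ≤ 4 / (m * p₀) := by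
    have : (d * (f + g) + e * (f * g)) / (metricDen m p f * metricDen m p g) ≤ 2 / e := by
      rw [div_le_div_iff₀ hP he0, hprod]
      have := mul_pos (mul_pos (lt_of_lt_of_le one_pos hd1) he0) hfg'
      nlinarith [mul_pos (mul_pos he0 he0) hfg, sq_nonneg d]
    refine this.trans ?_
    rw [he, div_le_div_iff₀ (by positivity) (by positivity)]
    nlinarith [mul_le_mul_of_nonneg_left hp hm0.le]
  have hge : d ^ 2 ≤ metricDen m p f * metricDen m p g := by
    rw [hprod]
    have := mul_pos (mul_pos (lt_of_lt_of_le one_pos hd1) he0) hfg'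
    have := mul_pos (mul_pos he0 he0) hfg
    nlinarith
  have b2 : d / (metricDen m p f * metricDen m p g) ≤ 1 := by
    rw [div_le_one hP]
    exact (le_self_pow₀ hd1 two_ne_zero).trans hge
  have b3 : e / (metricDen m p f * metricDen m p g) ≤ m * C := by
    rw [div_le_iff₀ hP]
    have hmC := mul_pos hm0 hC
    have h4 : 1 ≤ metricDen m p f * metricDen m p g := (one_le_pow₀ hd1).trans hge
    have h5 : e ≤ m * C := by
      rw [he]; linarith [mul_le_mul_of_nonneg_left hpC hm0.le]
    exact h5.trans (le_mul_of_one_le_right hmC.le h4)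
  have c1 : 0 ≤ (d * (f + g) + e * (f * g)) / (metricDen m p f * metricDen m p g) := by positivity
  have c2 : 0 ≤ d / (metricDen m p f * metricDen m p g) := by positivity
  have c3 : 0 ≤ e / (metricDen m p f * metricDen m p g) := by positivity
  refine (abs_sub _ _).trans (add_le_add ((abs_add_le _ _).trans (add_le_add ?_ ?_)) ?_)
  · rw [abs_mul, abs_neg, abs_of_nonneg c1]
    calc _ ≤ C * (4 / (m * p₀)) := mul_le_mul h1 b1 c1 hC.le
      _ = _ := by ring
  · rw [abs_mul, abs_of_nonneg c2]
    calc _ ≤ C * 1 := mul_le_mul h2 b2 c2 hC.le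
      _ = _ := by ring
  · rw [abs_mul, abs_of_nonneg c3]
    calc _ ≤ C * (m * C) := mul_le_mul h3 b3 c3 hC.le
      _ = _ := by ring

/-- For small `f` the right-hand side of the equation is positive: a barrier that keeps solutions
away from `0`. -/
theorem metricNum_pos {p L Q w f w₀ C : ℝ} (hw : w₀ ≤ w) (hC : |p * L - Q| + |p * w - L| ≤ C)
    (hf : 0 ≤ f) (hf1 : f ≤ 1) (hfC : f * C < w₀) : 0 < metricNum p L Q w f := by
  have h1 := (abs_le.1 (le_refl |p * L - Q|)).2
  have h2 := (abs_le.1 (le_refl |p * w - L|)).1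
  have h3 : f ^ 2 * (p * L - Q) ≤ f * |p * L - Q| := by
    calc f ^ 2 * (p * L - Q) ≤ f ^ 2 * |p * L - Q| := by gcongr
      _ ≤ f * |p * L - Q| := by
        refine mul_le_mul_of_nonneg_right ?_ (abs_nonneg _)
        nlinarith
  rw [metricNum]
  nlinarith [mul_le_mul_of_nonneg_left hC hf]

/-! ### Cutoff functions of one variable -/

theorem unifSmoothOn_of_hasCompactSupport {ι E F : Type*} [NormedAddCommGroup E] [NormedSpace ℝ E]
    [NormedAddCommGroup F] [NormedSpace ℝ F] {f : E → F} (hf : ContDiff ℝ ∞ f)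
    (hc : HasCompactSupport f) : UnifSmoothOn Set.univ 1 (fun _ : ι => f) := by
  refine ⟨fun _ => hf.contDiffOn, fun k => ?_⟩
  obtain ⟨C, hC⟩ := (hf.continuous_iteratedFDeriv (m := k)
    (mod_cast le_top)).bounded_above_of_compact_support (hc.iteratedFDeriv k)
  exact ⟨C, fun _ x _ => by simpa using hC x⟩

/-- A compactly supported truncation of the identity that is exact on `[-R, R]`. -/
theorem exists_smooth_truncation (R : ℝ) : ∃ κ : ℝ → ℝ, ContDiff ℝ ∞ κ ∧ HasCompactSupport κ ∧
    (∀ t, |κ t| ≤ |t|) ∧ ∀ t, |t| ≤ R → κ t = t := by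
  let β : ContDiffBump (0 : ℝ) := ⟨|R| + 1, |R| + 2, by positivity, by linarith⟩
  refine ⟨fun t => β t * t, β.contDiff.mul contDiff_id, β.hasCompactSupport.mul_right,
    fun t => ?_, fun t ht => ?_⟩
  · rw [abs_mul, abs_of_nonneg β.nonneg]
    exact mul_le_of_le_one_left (abs_nonneg t) β.le_one
  · have : β t = 1 := β.one_of_mem_closedBall (by
      rw [mem_closedBall_zero_iff, Real.norm_eq_abs]
      exact ht.trans ((le_abs_self R).trans (by change |R| ≤ |R| + 1; linarith)))
    simp only [this, one_mul]

/-- A truncation of the identity from below that is exact above the level `c`. -/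
theorem exists_smooth_lower_truncation {c : ℝ} (hc : 0 < c) : ∃ θ : ℝ → ℝ, ContDiff ℝ ∞ θ ∧
    (∀ t, c / 2 ≤ θ t) ∧ ∀ t, c ≤ t → θ t = t := by
  refine ⟨fun t => c / 2 + (t - c / 2) * Real.smoothTransition ((t - c / 2) / (c / 2)),
    by
      refine contDiff_const.add ((contDiff_id.sub contDiff_const).mul
        (Real.smoothTransition.contDiff.comp ?_))
      exact (contDiff_id.sub contDiff_const).div_const _, fun t => ?_, fun t ht => ?_⟩
  · beta_reduce
    rcases le_total t (c / 2) with h | h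
    · rw [Real.smoothTransition.zero_of_nonpos
        (div_nonpos_of_nonpos_of_nonneg (by linarith) (by linarith))]
      simp
    · have := mul_nonneg (sub_nonneg.2 h)
        (Real.smoothTransition.nonneg ((t - c / 2) / (c / 2)))
      linarith
  · beta_reduce
    rw [Real.smoothTransition.one_of_one_le]
    · ring
    · rw [le_div_iff₀ (by positivity)]; linarith

/-! ### The metric factor in the abstract -/

/-- The integral curve through `x`, parametrized so that `σ` is the arc parameter counted from the
level `a`. -/
theorem exists_characteristic {X : Type*} [NormedAddCommGroup X] [NormedSpace ℝ X]
    [CompleteSpace X] {ι : Type*} (σ : X →L[ℝ] ℝ) {v : ι → X → X}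
    (hv : UnifSmoothOn Set.univ 1 v) (hσ : ∀ i x, σ (v i x) = 1) (i : ι) (a : ℝ) (x : X) :
    ∃ γ : ℝ → X, γ (σ x - a) = x ∧ (∀ t, HasDerivAt γ (v i (γ t)) t) ∧ ∀ t, σ (γ t) = a + t := by
  obtain ⟨L, hL⟩ := hv.lipschitzWith
  obtain ⟨M, hM0, hM⟩ := hv.norm_le fun _ => zero_le_one
  obtain ⟨δ, hδ0, hδ⟩ := exists_integralCurve (hL i) (M := ⟨M, hM0⟩)
    (fun x => by
      have := hM i x trivial
      rwa [Pi.one_apply, mul_one] at this) x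
  refine ⟨fun t => δ (t - (σ x - a)), by simpa using hδ0, fun t => ?_, fun t => ?_⟩
  · simpa using (hδ (t - (σ x - a))).comp_sub_const t (σ x - a)
  · have h1 : ∀ s, HasDerivAt (fun s => σ (δ s) - s) 0 s := fun s => by
      have := (σ.hasFDerivAt.comp_hasDerivAt s (hδ s)).sub (hasDerivAt_id s)
      rw [hσ, sub_self] at this
      exact this
    have h2 := is_const_of_deriv_eq_zero (fun s => (h1 s).differentiableAt)
      (fun s => (h1 s).deriv) (t - (σ x - a)) 0
    rw [hδ0] at h2
    change σ (δ (t - (σ x - a))) = a + t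
    linarith

/-- The initial value problem for the metric factor `f = 1 + ε φ`: along a vector field `v` that
crosses the levels of `σ` with unit speed, `f` changes at the rate `d * metricNum / metricDen`,
and `f = 1` below the level `a`. When the defect `metricNum p L Q w 1` is of size `ε`, so is
`f - 1`, with all its derivatives. -/
theorem exists_unifSmoothOn_metricFactor {ι : Type*} {E : Type u} [NormedAddCommGroup E]
    [NormedSpace ℝ E] [CompleteSpace E] (σ : E →L[ℝ] ℝ) {v : ι → E → E}
    (hv : UnifSmoothOn Set.univ 1 v) (hσ : ∀ i x, σ (v i x) = 1)
    {p L Q w d : ι → E → ℝ} {ε : ι → ℝ} {m p₀ w₀ a T : ℝ} (hm : 1 ≤ m)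
    (hp : UnifSmoothOn Set.univ 1 p) (hL : UnifSmoothOn Set.univ 1 L)
    (hQ : UnifSmoothOn Set.univ 1 Q) (hw : UnifSmoothOn Set.univ 1 w)
    (hd : UnifSmoothOn Set.univ 1 d) (hε0 : ∀ i, 0 < ε i) (hε1 : ∀ i, ε i ≤ 1)
    (hN : UnifSmoothOn Set.univ ε
      fun i x => (1 + p i x) * (w i x - L i x) + Q i x)
    (hp₀ : 0 < p₀) (hpp : ∀ i x, p₀ ≤ p i x) (hw₀ : 0 < w₀) (hww : ∀ i x, w₀ ≤ w i x)
    (hd0 : ∀ i x, 0 ≤ d i x) (hda : ∀ i x, σ x ≤ a → d i x = 0) (hT : 0 < T) :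
    ∃ φ : ι → E → ℝ, UnifSmoothOn Set.univ 1 φ ∧ (∀ i x, σ x ≤ a → φ i x = 0) ∧
      ∃ c₁ : ℝ, 0 < c₁ ∧ ∀ i x, σ x < a + T → c₁ ≤ 1 + ε i * φ i x ∧
        ε i * fderiv ℝ (φ i) x (v i x) =
          d i x * (metricNum (p i x) (L i x) (Q i x) (w i x) (1 + ε i * φ i x) /
            metricDen m (p i x) (1 + ε i * φ i x)) := by
  have w1 : ∀ i : ι, (0 : ℝ) ≤ (1 : ι → ℝ) i := fun _ => zero_le_one
  -- Uniform bounds of the coefficients; `p₀` is lowered so that `p₀ ≤ 1`.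
  have hp1 : ∃ p₁ : ℝ, 0 < p₁ ∧ p₁ ≤ 1 ∧ ∀ i x, p₁ ≤ p i x :=
    ⟨min p₀ 1, by positivity, min_le_right _ _, fun i x => (min_le_left _ _).trans (hpp i x)⟩
  clear hpp hp₀ p₀
  obtain ⟨p₀, hp₀, hp₁, hpp⟩ := hp1
  have hpos : ∀ i x, 0 < p i x := fun i x => hp₀.trans_le (hpp i x)
  have hm0 : 0 ≤ m := by linarith
  obtain ⟨C1, hC1, h1⟩ := ((hp.mul_bdd isOpen_univ w1 hL).sub isOpen_univ hQ).norm_le w1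
  obtain ⟨C2, hC2, h2⟩ := hL.norm_le w1
  obtain ⟨C3, hC3, h3⟩ := (hp.mul_bdd isOpen_univ w1 hw).norm_le w1
  obtain ⟨D, hD, h4⟩ := hd.norm_le w1
  have hN' := hN.inv_smul isOpen_univ hε0
  obtain ⟨CN, hCN, h5⟩ := hN'.norm_le w1
  simp only [Set.mem_univ, forall_true_left, Pi.one_apply, mul_one, Real.norm_eq_abs,
    smul_eq_mul] at h1 h2 h3 h4 h5
  set A : ℝ := D * (2 * (C1 + C2 + C3) / p₀) with hA
  set B : ℝ := D * (2 * CN) with hB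
  have hA0 : 0 ≤ A := by positivity
  have hB0 : 0 ≤ B := by positivity
  -- `2 c₁` is a level below which the right-hand side is positive, by `metricNum_pos`.
  set c₁ : ℝ := min (1 / 2) (w₀ / (4 * (C1 + C3 + C2 + 1))) with hc₁
  have hc0 : 0 < c₁ := by positivity
  have hc2 : 2 * c₁ ≤ 1 := by linarith [min_le_left (1 / 2) (w₀ / (4 * (C1 + C3 + C2 + 1)))]
  have hc3 : 2 * c₁ * (C1 + C3 + C2) < w₀ := by
    have h6 : c₁ * (4 * (C1 + C3 + C2 + 1)) ≤ w₀ :=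
      (le_div_iff₀ (by positivity)).1 (min_le_right _ _)
    nlinarith
  obtain ⟨κ, hκ, hκc, hκ1, hκ2⟩ := exists_smooth_truncation (gronwallBound 0 A B T)
  obtain ⟨θ, hθ, hθ1, hθ2⟩ := exists_smooth_lower_truncation hc0
  have hθ0 : ∀ t, 0 < θ t := fun t => (half_pos hc0).trans_le (hθ1 t)
  -- The equation for `φ`, truncated to be bounded with all derivatives: `κ` cuts `φ` off at the
  -- Gronwall bound and `θ` keeps `f` away from `0`; both turn out to be inactive.
  let F : ι → E × ℝ → ℝ := fun i x => θ (1 + ε i * κ x.2)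
  let g : ι → E × ℝ → ℝ := fun i x => d i x.1 *
    ((metricSlope (p i x.1) (L i x.1) (Q i x.1) (w i x.1) (F i x) * κ x.2 +
      (ε i)⁻¹ • ((1 + p i x.1) * (w i x.1 - L i x.1) + Q i x.1)) *
      (metricDen m (p i x.1) (F i x))⁻¹)
  have hg : UnifSmoothOn Set.univ 1 g := by
    have lift : ∀ {b : ι → E → ℝ}, UnifSmoothOn Set.univ 1 b →
        UnifSmoothOn Set.univ 1 (fun i (x : E × ℝ) => b i x.1) := fun hb =>
      hb.comp_clm isOpen_univ isOpen_univ w1 (ContinuousLinearMap.fst ℝ E ℝ)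
        (Set.mapsTo_univ _ _)
    have cst : ∀ b : ℝ, UnifSmoothOn Set.univ 1 (fun (_ : ι) (_ : E × ℝ) => b) := fun b =>
      UnifSmoothOn.of_const (C := |b|) (by simp)
    have hκ' : UnifSmoothOn Set.univ 1 (fun (_ : ι) (x : E × ℝ) => κ x.2) :=
      (unifSmoothOn_of_hasCompactSupport (ι := ι) hκ hκc).comp_clm isOpen_univ isOpen_univ w1
        (ContinuousLinearMap.snd ℝ E ℝ) (Set.mapsTo_univ _ _)
    have hε' : UnifSmoothOn Set.univ 1 (fun (i : ι) (_ : E × ℝ) => ε i) :=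
      UnifSmoothOn.of_const (C := 1) fun i => by
        simpa [abs_of_pos (hε0 i)] using hε1 i
    have hF : UnifSmoothOn Set.univ 1 F :=
      ((cst 1).add isOpen_univ (hε'.mul_bdd isOpen_univ w1 hκ')).comp_contDiff isOpen_univ hθ
    have hslope : UnifSmoothOn Set.univ 1 (fun i x =>
        metricSlope (p i x.1) (L i x.1) (Q i x.1) (w i x.1) (F i x)) :=
      ((((hF.add isOpen_univ (cst 1)).neg isOpen_univ).mul_bdd isOpen_univ w1
        (((lift hp).mul_bdd isOpen_univ w1 (lift hL)).sub isOpen_univ (lift hQ))).sub isOpen_univ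
        (lift hL)).add isOpen_univ ((lift hp).mul_bdd isOpen_univ w1 (lift hw))
    have hden : UnifSmoothOn Set.univ 1 (fun i x => metricDen m (p i x.1) (F i x)) :=
      (((((cst 1).add isOpen_univ (hF.mul_bdd isOpen_univ w1 (lift hp))).const_smul isOpen_univ
        m).add isOpen_univ (cst 1)).mul_bdd isOpen_univ w1 (cst 2⁻¹)).congr isOpen_univ
        fun i x _ => by simp [metricDen, div_eq_mul_inv]
    exact (lift hd).mul_bdd isOpen_univ w1 (((hslope.mul_bdd isOpen_univ w1 hκ').add isOpen_univ
      (lift hN')).mul_bdd isOpen_univ w1 (hden.inv isOpen_univ (c := 1 / 2) (by norm_num)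
        fun i x _ => half_le_metricDen hm0 (hpos i x.1).le (hθ0 _).le))
  obtain ⟨φ, hφ, hφa, hφg⟩ := exists_unifSmoothOn_transport σ hv hσ hg
    (fun i x hx => by simp only [g, hda i x.1 hx, zero_mul]) hT.le
  refine ⟨φ, hφ, hφa, c₁, hc0, ?_⟩
  have hgb : ∀ i x t, |g i (x, t)| ≤ A * |t| + B := fun i x t => by
    have hden := half_le_metricDen (f := F i (x, t)) hm0 (hpos i x).le (hθ0 _).le
    have hden0 : 0 < metricDen m (p i x) (F i (x, t)) := by linarith
    have e1 := abs_metricSlope_div_le (Q := Q i x) (L := L i x) (w := w i x) (f := F i (x, t))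
      hm hp₀ hp₁ (hpp i x) (add_le_add (add_le_add (h1 i x) (h2 i x)) (h3 i x)) (hθ0 _)
    have e2 : (metricDen m (p i x) (F i (x, t)))⁻¹ ≤ 2 := by
      rw [inv_le_comm₀ hden0 two_pos]; linarith
    simp only [g]
    rw [abs_mul, hA, hB, mul_assoc, ← mul_add, add_mul]
    refine mul_le_mul (h4 i x) ((abs_add_le _ _).trans (add_le_add ?_ ?_)) (abs_nonneg _) hD
    · rw [mul_right_comm, ← div_eq_mul_inv, abs_mul]
      exact mul_le_mul e1 (hκ1 t) (abs_nonneg _) ((abs_nonneg _).trans e1)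
    · rw [abs_mul, mul_comm 2 CN, abs_of_pos (inv_pos.2 hden0)]
      exact mul_le_mul (h5 i x) e2 (inv_pos.2 hden0).le hCN
  -- along a characteristic
  have curve : ∀ i x, a < σ x → σ x < a + T → ∃ γ : ℝ → E, γ (σ x - a) = x ∧
      (∀ t, σ (γ t) = a + t) ∧
      ∀ t < T, HasDerivAt (fun t => φ i (γ t)) (g i (γ t, φ i (γ t))) t := fun i x h h' => by
    obtain ⟨γ, e1, e2, e3⟩ := exists_characteristic σ hv hσ i a x
    refine ⟨γ, e1, e3, fun t ht => ?_⟩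
    rw [← hφg i (γ t) (by rw [e3]; linarith)]
    exact (((hφ.contDiff i).differentiable (by simp)) (γ t)).hasFDerivAt.comp_hasDerivAt t (e2 t)
  have hφR : ∀ i x, σ x < a + T → |φ i x| ≤ gronwallBound 0 A B T := fun i x h => by
    rcases le_or_gt (σ x) a with h' | h'
    · rw [hφa i x h', abs_zero]
      have := gronwallBound_mono le_rfl hB0 hA0 hT.le
      rwa [gronwallBound_x0] at this
    · obtain ⟨γ, e1, e2, e3⟩ := curve i x h' h
      have e4 := norm_le_gronwallBound_of_norm_deriv_right_le (f := fun t => φ i (γ t))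
        (f' := fun t => g i (γ t, φ i (γ t))) (δ := 0) (K := A) (ε := B) (a := 0) (b := σ x - a)
        (fun t ht => (e3 t (by linarith [ht.2])).continuousAt.continuousWithinAt)
        (fun t ht => (e3 t (by linarith [ht.2])).hasDerivWithinAt)
        (by simp [hφa i (γ 0) (by rw [e2, add_zero])])
        (fun t _ => hgb i _ _) (σ x - a) ⟨by linarith, le_rfl⟩
      simp only [e1, sub_zero, Real.norm_eq_abs] at e4
      exact e4.trans (gronwallBound_mono le_rfl hB0 hA0 (by linarith))
  have hgN : ∀ i x, σ x < a + T → c₁ ≤ 1 + ε i * φ i x → ε i * g i (x, φ i x) =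
      d i x * (metricNum (p i x) (L i x) (Q i x) (w i x) (1 + ε i * φ i x) /
            metricDen m (p i x) (1 + ε i * φ i x)) := fun i x h h' => by
    have hκe : κ (φ i x) = φ i x := hκ2 _ (hφR i x h)
    have hFe : F i (x, φ i x) = 1 + ε i * φ i x := by
      simp only [F, hκe]; exact hθ2 _ h'
    simp only [g, hFe, hκe, smul_eq_mul]
    have := (hε0 i).ne'
    rw [metricNum_eq, div_eq_mul_inv]
    field_simp
    ring
  -- `f` stays above the decreasing barrier `2 c₁ - (c₁ / T) t`: at a contact `f' ≥ 0`.
  have hlow : ∀ i x, σ x < a + T → c₁ ≤ 1 + ε i * φ i x := fun i x h => by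
    rcases le_or_gt (σ x) a with h' | h'
    · rw [hφa i x h']; linarith
    · obtain ⟨γ, e1, e2, e3⟩ := curve i x h' h
      have e4 := image_le_of_deriv_right_lt_deriv_boundary (f := fun t => -(1 + ε i * φ i (γ t)))
        (f' := fun t => -(ε i * g i (γ t, φ i (γ t)))) (a := 0) (b := σ x - a)
        (B := fun t => -(2 * c₁) + c₁ / T * t) (B' := fun _ => c₁ / T)
        (fun t ht => (((e3 t (by linarith [ht.2])).const_mul (ε i)).const_add
          1).neg.continuousAt.continuousWithinAt)
        (fun t ht => (((e3 t (by linarith [ht.2])).const_mul (ε i)).const_add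
          1).neg.hasDerivWithinAt)
        (by simp [hφa i (γ 0) (by rw [e2, add_zero])]; linarith)
        (fun t => by simpa using ((hasDerivAt_id t).const_mul (c₁ / T)).const_add (-(2 * c₁)))
        (fun t ht hB => by
          have ht' : t / T ≤ 1 := by rw [div_le_one hT]; linarith [ht.2]
          have ht0 : 0 ≤ t / T := div_nonneg ht.1 hT.le
          have hval : 1 + ε i * φ i (γ t) = 2 * c₁ - c₁ * (t / T) := by
            have : c₁ / T * t = c₁ * (t / T) := by ring
            simp only [this] at hB
            linarith
          have hl : c₁ ≤ 1 + ε i * φ i (γ t) := by nlinarith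
          have hu : 1 + ε i * φ i (γ t) ≤ 2 * c₁ := by nlinarith
          rw [hgN i (γ t) (by rw [e2]; linarith [ht.2]) hl]
          have hpos : 0 ≤ d i (γ t) * (metricNum (p i (γ t)) (L i (γ t)) (Q i (γ t)) (w i (γ t))
              (1 + ε i * φ i (γ t)) / metricDen m (p i (γ t)) (1 + ε i * φ i (γ t))) := by
            refine mul_nonneg (hd0 _ _) (div_nonneg (metricNum_pos (C := C1 + C3 + C2)
              (hww i (γ t)) ?_ (by linarith) (by linarith) ?_).le
              (metricDen_pos hm0 (hpos i _).le (by linarith)).le)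
            · rw [add_assoc]
              exact add_le_add (h1 i _) ((abs_sub _ _).trans (add_le_add (h3 i _) (h2 i _)))
            · exact (mul_le_mul_of_nonneg_right hu (by positivity)).trans_lt hc3
          have : 0 < c₁ / T := by positivity
          linarith)
        (x := σ x - a) ⟨by linarith, le_rfl⟩
      simp only [e1] at e4
      have : c₁ / T * (σ x - a) ≤ c₁ := by
        rw [div_mul_eq_mul_div, div_le_iff₀ hT]
        exact mul_le_mul_of_nonneg_left (by linarith) hc0.le
      linarith
  exact fun i x h => ⟨hlow i x h, by rw [hφg i x h]; exact hgN i x h (hlow i x h)⟩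

/-! ### The equation for the metric factor -/

/-- The value that the equation for the metric factor prescribes for `⟨Df, Du⟩` at `q` when
`f q = f`. -/
noncomputable def metricRHS {ℓ : ℕ} (n m : ℕ) (u : RYSpace ℓ → ℝ) (q : RYSpace ℓ) (f : ℝ) : ℝ :=
  metricNum (‖gradient u q‖ ^ 2) (radialLaplacian n u q) (hessQuad u q) (((m : ℝ) - 1) / u q) f /
    metricDen m (‖gradient u q‖ ^ 2) f

/-- The equation for the metric factor, solved for the derivative of `f` along `Du`. -/
theorem metricEqn_iff {ℓ n m : ℕ} {u f : RYSpace ℓ → ℝ} {q : RYSpace ℓ} (hf : 0 < f q) :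
    MetricEqn n m u f q ↔ fderiv ℝ f q (gradient u q) = metricRHS n m u q (f q) := by
  have hp : 0 ≤ ‖gradient u q‖ ^ 2 := by positivity
  have hden := metricDen_pos (Nat.cast_nonneg (α := ℝ) m) hp hf.le
  have h1 : 0 < 1 + f q * ‖gradient u q‖ ^ 2 := by positivity
  rw [MetricEqn, metricRHS, inner_gradient_left, eq_div_iff hden.ne',
    ← mul_left_inj' h1.ne' (a := _ * _)]
  generalize (m - 1 : ℝ) / u q = w
  have e1 : (1 / 2 : ℝ) * (m + (1 + f q * ‖gradient u q‖ ^ 2)⁻¹) *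
      fderiv ℝ f q (gradient u q) * (1 + f q * ‖gradient u q‖ ^ 2) =
      fderiv ℝ f q (gradient u q) * metricDen m (‖gradient u q‖ ^ 2) (f q) := by
    rw [metricDen]; field_simp
  have e2 : (-f q * (radialLaplacian n u q -
      f q * (hessQuad u q / (1 + f q * ‖gradient u q‖ ^ 2))) + w) *
      (1 + f q * ‖gradient u q‖ ^ 2) =
      metricNum (‖gradient u q‖ ^ 2) (radialLaplacian n u q) (hessQuad u q) w (f q) := by
    rw [metricNum]; field_simp; ring
  rw [e1, e2]

/-- The constant `f = 1` solves the equation for the metric factor over solutions of the symmetric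
minimal surface equation. -/
theorem metricRHS_one_of_smeOp_eq_zero {ℓ n m : ℕ} {u : RYSpace ℓ → ℝ} {q : RYSpace ℓ}
    (h : smeOp n m u q = 0) : metricRHS n m u q 1 = 0 := by
  have h1 : 0 < 1 + ‖gradient u q‖ ^ 2 := by positivity
  have : metricNum (‖gradient u q‖ ^ 2) (radialLaplacian n u q) (hessQuad u q)
      (((m : ℝ) - 1) / u q) 1 = -(1 + ‖gradient u q‖ ^ 2) * smeOp n m u q := by
    rw [metricNum, smeOp]; generalize (m - 1 : ℝ) / u q = w; field_simp; ring
  rw [metricRHS, this, h, mul_zero, zero_div]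

section congr
variable {ℓ n m : ℕ} {u u' : RYSpace ℓ → ℝ} {q : RYSpace ℓ}

theorem gradient_congr (h : u =ᶠ[nhds q] u') : gradient u q = gradient u' q := by
  rw [gradient, gradient, h.fderiv_eq]

theorem radialLaplacian_congr (h : u =ᶠ[nhds q] u') :
    radialLaplacian n u q = radialLaplacian n u' q := by
  rw [radialLaplacian, radialLaplacian, h.fderiv_eq,
    (InnerProductSpace.laplacian_congr_nhds h).eq_of_nhds]

theorem hessQuad_congr (h : u =ᶠ[nhds q] u') : hessQuad u q = hessQuad u' q := by
  rw [hessQuad, hessQuad, gradient_congr h, (h.iteratedFDeriv ℝ 2).eq_of_nhds]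

theorem metricRHS_congr (h : u =ᶠ[nhds q] u') (f : ℝ) :
    metricRHS n m u q f = metricRHS n m u' q f := by
  rw [metricRHS, metricRHS, gradient_congr h, radialLaplacian_congr h, hessQuad_congr h,
    h.eq_of_nhds]

end congr

/-! ### Perturbations of the cone -/

/-- The projection to the variable `r`. -/
noncomputable abbrev radialL (ℓ : ℕ) : RYSpace ℓ →L[ℝ] ℝ := WithLp.fstL 2 ℝ ℝ (YSpace ℓ)

/-- The Riesz representation, which takes derivatives to gradients. -/
noncomputable def rieszL (ℓ : ℕ) : (RYSpace ℓ →L[ℝ] ℝ) →L[ℝ] RYSpace ℓ :=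
  LinearMap.mkContinuous
    { toFun := (InnerProductSpace.toDual ℝ (RYSpace ℓ)).symm
      map_add' := fun x y => by simp
      map_smul' := fun c x => by simp } 1 fun x => by simp

theorem norm_gradient {ℓ : ℕ} (u : RYSpace ℓ → ℝ) (q : RYSpace ℓ) :
    ‖gradient u q‖ = ‖fderiv ℝ u q‖ := by
  rw [gradient, LinearIsometryEquiv.norm_map]

theorem inner_radialDir {ℓ : ℕ} (q : RYSpace ℓ) : inner ℝ (radialDir ℓ) q = q.fst := by
  rw [WithLp.prod_inner_apply]; simp [radialDir]

theorem norm_radialDir (ℓ : ℕ) : ‖radialDir ℓ‖ = 1 := by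
  rw [WithLp.prod_norm_eq_of_L2]; simp [radialDir]

theorem gradient_fst {ℓ : ℕ} (u : RYSpace ℓ → ℝ) (q : RYSpace ℓ) :
    (gradient u q).fst = fderiv ℝ u q (radialDir ℓ) := by
  rw [← inner_gradient_left, real_inner_comm, inner_radialDir]

theorem norm_gradient_sq {ℓ : ℕ} (u : RYSpace ℓ → ℝ) (q : RYSpace ℓ) :
    ‖gradient u q‖ ^ 2 = fderiv ℝ u q (gradient u q) := by
  rw [← inner_gradient_left, real_inner_self_eq_norm_sq]

/-- The perturbation `α r + g` of the linear function `α r`. -/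
noncomputable def perturbedCone {ℓ : ℕ} (α : ℝ) (g : RYSpace ℓ → ℝ) (q : RYSpace ℓ) : ℝ :=
  α * q.fst + g q

section pointwise
variable {ℓ : ℕ} {α : ℝ} {g : RYSpace ℓ → ℝ}

theorem fderiv_perturbedCone (hg : ContDiff ℝ ∞ g) (q : RYSpace ℓ) :
    fderiv ℝ (perturbedCone α g) q = α • radialL ℓ + fderiv ℝ g q := by
  have h : HasFDerivAt (perturbedCone α g) (α • radialL ℓ + fderiv ℝ g q) q :=
    ((radialL ℓ).hasFDerivAt.const_mul α).add
      (hg.differentiable (by simp)).differentiableAt.hasFDerivAt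
  exact h.fderiv

theorem fderiv_perturbedCone_radialDir (hg : ContDiff ℝ ∞ g) (q : RYSpace ℓ) :
    fderiv ℝ (perturbedCone α g) q (radialDir ℓ) = α + fderiv ℝ g q (radialDir ℓ) := by
  rw [fderiv_perturbedCone hg]; simp [radialDir]

theorem gradient_perturbedCone (hg : ContDiff ℝ ∞ g) (q : RYSpace ℓ) :
    gradient (perturbedCone α g) q = α • radialDir ℓ + gradient g q := by
  refine ext_inner_right ℝ fun x => ?_
  rw [inner_gradient_left, fderiv_perturbedCone hg, inner_add_left, inner_gradient_left,
    real_inner_smul_left, inner_radialDir]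
  simp

theorem fderiv_fderiv_perturbedCone (hg : ContDiff ℝ ∞ g) (q : RYSpace ℓ) :
    fderiv ℝ (fderiv ℝ (perturbedCone α g)) q = fderiv ℝ (fderiv ℝ g) q := by
  have : fderiv ℝ (perturbedCone α g) = fun q => α • radialL ℓ + fderiv ℝ g q :=
    funext fun q => fderiv_perturbedCone hg q
  rw [this]
  exact fderiv_const_add _

theorem hessQuad_perturbedCone (hg : ContDiff ℝ ∞ g) (q : RYSpace ℓ) :
    hessQuad (perturbedCone α g) q =
      fderiv ℝ (fderiv ℝ g) q (gradient (perturbedCone α g) q)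
        (gradient (perturbedCone α g) q) := by
  rw [hessQuad, iteratedFDeriv_two_apply, fderiv_fderiv_perturbedCone hg]; rfl

theorem laplacian_perturbedCone (hg : ContDiff ℝ ∞ g) (q : RYSpace ℓ) :
    Laplacian.laplacian (perturbedCone α g) q =
      ∑ j, fderiv ℝ (fderiv ℝ g) q (stdOrthonormalBasis ℝ (RYSpace ℓ) j)
        (stdOrthonormalBasis ℝ (RYSpace ℓ) j) := by
  rw [InnerProductSpace.laplacian_eq_iteratedFDeriv_stdOrthonormalBasis]
  refine Finset.sum_congr rfl fun j _ => ?_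
  rw [iteratedFDeriv_two_apply, fderiv_fderiv_perturbedCone hg]; rfl

theorem le_gradient_perturbedCone_fst (hg : ContDiff ℝ ∞ g) (q : RYSpace ℓ)
    (h1 : ‖fderiv ℝ g q‖ ≤ α / 20) :
    19 / 20 * α ≤ (gradient (perturbedCone α g) q).fst := by
  have h2 : ‖fderiv ℝ g q (radialDir ℓ)‖ ≤ α / 20 :=
    ((fderiv ℝ g q).le_opNorm _).trans (by rwa [norm_radialDir, mul_one])
  rw [gradient_fst, fderiv_perturbedCone_radialDir hg]
  linarith [(abs_le.1 h2).1]

theorem norm_gradient_perturbedCone_snd_le (hg : ContDiff ℝ ∞ g) (q : RYSpace ℓ)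
    (h1 : ‖fderiv ℝ g q‖ ≤ α / 20) :
    ‖(gradient (perturbedCone α g) q).snd‖ ≤ α / 20 := by
  have : (gradient (perturbedCone α g) q).snd = (gradient g q).snd := by
    rw [gradient_perturbedCone hg]; simp [radialDir]
  rw [this]
  exact (WithLp.norm_snd_le _ _).trans (by rwa [norm_gradient])

end pointwise

theorem coneSlope_pos {n m : ℕ} (hn : 2 ≤ n) (hm : 2 ≤ m) : 0 < coneSlope n m := by
  have h1 : (2 : ℝ) ≤ n := mod_cast hn
  have h2 : (2 : ℝ) ≤ m := mod_cast hm
  exact Real.sqrt_pos.2 (div_pos (by linarith) (by linarith))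

/-- The linear function `α₀ r` solves the symmetric minimal surface equation. -/
theorem coneSlope_sq {n m : ℕ} (hn : 2 ≤ n) (hm : 2 ≤ m) :
    ((n : ℝ) - 1) * coneSlope n m ^ 2 = m - 1 := by
  have h1 : (2 : ℝ) ≤ n := mod_cast hn
  have h2 : (2 : ℝ) ≤ m := mod_cast hm
  have h3 : (n : ℝ) - 1 ≠ 0 := by linarith
  rw [coneSlope, Real.sq_sqrt (div_nonneg (by linarith) (by linarith))]
  field_simp

/-- A bounded modification of the identity, bounded below by a positive constant. -/
theorem exists_smooth_modification : ∃ η : ℝ → ℝ,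
    (∀ ι : Type*, UnifSmoothOn Set.univ 1 (fun _ : ι => η)) ∧ (∀ s, 1 / 5 ≤ η s) ∧
      ∀ s, 3 / 10 ≤ s → s ≤ 5 / 2 → η s = s := by
  let β : ContDiffBump (7 / 5 : ℝ) := ⟨11 / 10, 6 / 5, by norm_num, by norm_num⟩
  refine ⟨fun s => 1 / 2 + β s * (s - 1 / 2), fun ι => ?_, fun s => ?_, fun s h1 h2 => ?_⟩
  · exact (UnifSmoothOn.of_const (C := 1) (c := fun _ => (1 / 2 : ℝ)) (by simp; norm_num)).add
      isOpen_univ (unifSmoothOn_of_hasCompactSupport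
        (β.contDiff.mul (contDiff_id.sub contDiff_const)) β.hasCompactSupport.mul_right)
  · beta_reduce
    rcases le_or_gt (6 / 5) (dist s (7 / 5)) with h | h
    · rw [β.zero_of_le_dist h]; norm_num
    · rw [Real.dist_eq] at h
      have := (abs_lt.1 h).1
      nlinarith [β.nonneg (x := s), β.le_one (x := s)]
  · have : β s = 1 := β.one_of_mem_closedBall (by
      rw [Metric.mem_closedBall, Real.dist_eq]
      exact abs_le.2 ⟨by change -(11 / 10 : ℝ) ≤ _; linarith,
        by change _ ≤ (11 / 10 : ℝ); linarith⟩)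
    simp only [this]; ring

/-- A cutoff function that rises from `0` to `1` between the levels `3/10` and `2/5`. -/
theorem exists_smooth_switch : ∃ χ : ℝ → ℝ,
    (∀ ι : Type*, UnifSmoothOn Set.univ 1 (fun _ : ι => χ)) ∧ (∀ s, 0 ≤ χ s) ∧ (∀ s, χ s ≤ 1) ∧
      (∀ s, s ≤ 3 / 10 → χ s = 0) ∧ ∀ s, 2 / 5 ≤ s → s ≤ 5 / 2 → χ s = 1 := by
  let β : ContDiffBump (29 / 20 : ℝ) := ⟨21 / 20, 23 / 20, by norm_num, by norm_num⟩
  refine ⟨β, fun ι => unifSmoothOn_of_hasCompactSupport β.contDiff β.hasCompactSupport,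
    fun s => β.nonneg, fun s => β.le_one, fun s h => β.zero_of_le_dist ?_, fun s h1 h2 =>
    β.one_of_mem_closedBall ?_⟩
  · rw [Real.dist_eq, abs_of_neg (by linarith)]; change (23 / 20 : ℝ) ≤ _; linarith
  · rw [Metric.mem_closedBall, Real.dist_eq]
    exact abs_le.2 ⟨by change -(21 / 20 : ℝ) ≤ _; linarith, by change _ ≤ (21 / 20 : ℝ); linarith⟩

section family
variable {ι : Type*} {ℓ : ℕ} {α : ℝ} {ε : ι → ℝ} {g : ι → RYSpace ℓ → ℝ}

theorem unifSmoothOn_fderiv_perturbedCone (hg : UnifSmoothOn Set.univ 1 g) :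
    UnifSmoothOn Set.univ 1 (fun i => fderiv ℝ (perturbedCone α (g i))) :=
  ((UnifSmoothOn.of_const (C := ‖α • radialL ℓ‖) (c := fun _ => α • radialL ℓ) (by simp)).add
    isOpen_univ (hg.fderiv isOpen_univ)).congr isOpen_univ
    fun i q _ => fderiv_perturbedCone (hg.contDiff i) q

theorem unifSmoothOn_gradient_perturbedCone (hg : UnifSmoothOn Set.univ 1 g) :
    UnifSmoothOn Set.univ 1 (fun i => gradient (perturbedCone α (g i))) :=
  (unifSmoothOn_fderiv_perturbedCone hg).clm_comp isOpen_univ (rieszL ℓ)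

/-- The direction of the characteristics, with unit speed in `r`. -/
noncomputable def characteristicField (u : RYSpace ℓ → ℝ) (q : RYSpace ℓ) : RYSpace ℓ :=
  (gradient u q).fst⁻¹ • gradient u q

theorem unifSmoothOn_characteristicField (hα : 0 < α) (hg : UnifSmoothOn Set.univ 1 g)
    (h1 : ∀ i q, ‖fderiv ℝ (g i) q‖ ≤ α / 20) :
    UnifSmoothOn Set.univ 1 (fun i => characteristicField (perturbedCone α (g i))) := by
  have hD := unifSmoothOn_gradient_perturbedCone (α := α) hg
  have := ((hD.clm_comp isOpen_univ (radialL ℓ)).inv isOpen_univ (c := 19 / 20 * α) (by positivity)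
    fun i q _ => le_gradient_perturbedCone_fst (hg.contDiff i) q (h1 i q)).smul isOpen_univ
    (fun _ => zero_le_one) (fun _ => zero_le_one) hD
  exact this.mono_weight (c := 1) (by simp) (by simp)

theorem characteristicField_fst (hα : 0 < α) (hg : UnifSmoothOn Set.univ 1 g)
    (h1 : ∀ i q, ‖fderiv ℝ (g i) q‖ ≤ α / 20) (i : ι) (q : RYSpace ℓ) :
    radialL ℓ (characteristicField (perturbedCone α (g i)) q) = 1 := by
  have := le_gradient_perturbedCone_fst (hg.contDiff i) q (h1 i q)
  rw [characteristicField, map_smul, smul_eq_mul]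
  exact inv_mul_cancel₀ (by linarith : (gradient (perturbedCone α (g i)) q).fst ≠ 0 )

/-- The coefficients of the equation for the metric factor extend from the strip
`3/10 ≤ r ≤ 5/2` to smooth functions on the whole space, and the defect of the minimal surface
equation is as small as the perturbation. -/
theorem exists_coefficients {n m : ℕ} (hn : 2 ≤ n) (hm : 2 ≤ m)
    (hg : UnifSmoothOn Set.univ ε g) (hε0 : ∀ i, 0 < ε i) (hε1 : ∀ i, ε i ≤ 1)
    (h0 : ∀ i q, |g i q| ≤ coneSlope n m / 20)
    (h1 : ∀ i q, ‖fderiv ℝ (g i) q‖ ≤ coneSlope n m / 20) :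
    ∃ p L Q w : ι → RYSpace ℓ → ℝ, UnifSmoothOn Set.univ 1 p ∧ UnifSmoothOn Set.univ 1 L ∧
      UnifSmoothOn Set.univ 1 Q ∧ UnifSmoothOn Set.univ 1 w ∧
      UnifSmoothOn Set.univ ε (fun i x => (1 + p i x) * (w i x - L i x) + Q i x) ∧
      (∃ p₀ : ℝ, 0 < p₀ ∧ ∀ i q, p₀ ≤ p i q) ∧ (∃ w₀ : ℝ, 0 < w₀ ∧ ∀ i q, w₀ ≤ w i q) ∧
      ∀ (i) (q : RYSpace ℓ), 3 / 10 ≤ q.fst → q.fst ≤ 5 / 2 → ∀ f,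
        metricRHS n m (perturbedCone (coneSlope n m) (g i)) q f =
          metricNum (p i q) (L i q) (Q i q) (w i q) f / metricDen m (p i q) f := by
  have hα := coneSlope_pos hn hm
  have hα2 := coneSlope_sq hn hm
  set α := coneSlope n m
  have hm1 : (2 : ℝ) ≤ m := mod_cast hm
  have O := isOpen_univ (X := RYSpace ℓ)
  have w1 : ∀ i : ι, (0 : ℝ) ≤ (1 : ι → ℝ) i := fun _ => zero_le_one
  have wε : ∀ i : ι, 0 ≤ ε i := fun i => (hε0 i).le
  have toOne : ∀ {F : Type} [NormedAddCommGroup F] [NormedSpace ℝ F] {b : ι → RYSpace ℓ → F},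
      UnifSmoothOn Set.univ ε b → UnifSmoothOn Set.univ 1 b := fun hb =>
    hb.mono_weight wε (c := 1) (by simpa using hε1)
  have cst : ∀ {F : Type} [NormedAddCommGroup F] [NormedSpace ℝ F] (b : F),
      UnifSmoothOn Set.univ 1 (fun (_ : ι) (_ : RYSpace ℓ) => b) := fun b =>
    UnifSmoothOn.of_const (C := ‖b‖) (by simp)
  obtain ⟨η, hη, hη1, hη2⟩ := exists_smooth_modification
  have hη' : UnifSmoothOn Set.univ 1 (fun (_ : ι) (q : RYSpace ℓ) => η q.fst) :=
    (hη ι).comp_clm isOpen_univ O w1 (radialL ℓ) (Set.mapsTo_univ _ _)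
  have hη0 : ∀ s, 0 < η s := fun s => lt_of_lt_of_le (by norm_num) (hη1 s)
  have hg1 := toOne hg
  have hD := unifSmoothOn_fderiv_perturbedCone (α := α) hg1
  have hG := unifSmoothOn_gradient_perturbedCone (α := α) hg1
  have hDD := (hg.fderiv O).fderiv O
  have hlap : UnifSmoothOn Set.univ ε
      (fun i => Laplacian.laplacian (perturbedCone α (g i))) :=
    (UnifSmoothOn.sum O Finset.univ fun j _ => (hDD.clm_apply O wε
      (cst (stdOrthonormalBasis ℝ (RYSpace ℓ) j))).clm_apply O wε
      (cst (stdOrthonormalBasis ℝ (RYSpace ℓ) j))).congr O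
      fun i q _ => laplacian_perturbedCone (hg1.contDiff i) q
  have hQ : UnifSmoothOn Set.univ ε (fun i => hessQuad (perturbedCone α (g i))) :=
    ((hDD.clm_apply O wε hG).clm_apply O wε hG).congr O
      fun i q _ => hessQuad_perturbedCone (hg1.contDiff i) q
  have hp : UnifSmoothOn Set.univ 1 (fun i q => ‖gradient (perturbedCone α (g i)) q‖ ^ 2) :=
    (hD.clm_apply O w1 hG).congr O fun i q _ => norm_gradient_sq _ q
  have hηi : UnifSmoothOn Set.univ 1 (fun (_ : ι) (q : RYSpace ℓ) => (η q.fst)⁻¹) :=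
    hη'.inv O (c := 1 / 5) (by norm_num) fun i q _ => hη1 q.fst
  have hlow : ∀ i (q : RYSpace ℓ), 3 / 20 * α ≤ α * η q.fst + g i q := fun i q => by
    have := (abs_le.1 (h0 i q)).1
    nlinarith [hη1 q.fst]
  have hui : UnifSmoothOn Set.univ 1
      (fun (i : ι) (q : RYSpace ℓ) => (α * η q.fst + g i q)⁻¹) :=
    ((hη'.const_smul O α).add O hg1).inv O (c := 3 / 20 * α) (by positivity) fun i q _ => hlow i q
  have hrad : UnifSmoothOn Set.univ 1
      (fun i q => fderiv ℝ (perturbedCone α (g i)) q (radialDir ℓ)) := hD.clm_apply O w1 (cst _)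
  have hgr : UnifSmoothOn Set.univ ε (fun i q => fderiv ℝ (g i) q (radialDir ℓ)) :=
    (hg.fderiv O).clm_apply O wε (cst _)
  have hw : UnifSmoothOn Set.univ 1
      (fun (i : ι) (q : RYSpace ℓ) => ((m : ℝ) - 1) * (α * η q.fst + g i q)⁻¹) :=
    hui.const_smul O ((m : ℝ) - 1)
  obtain ⟨C, hC0, hC⟩ := hη'.norm_le w1
  refine ⟨fun i q => ‖gradient (perturbedCone α (g i)) q‖ ^ 2,
    fun i q => Laplacian.laplacian (perturbedCone α (g i)) q +
      ((n : ℝ) - 1) * ((η q.fst)⁻¹ * fderiv ℝ (perturbedCone α (g i)) q (radialDir ℓ)),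
    fun i => hessQuad (perturbedCone α (g i)),
    fun i q => ((m : ℝ) - 1) * (α * η q.fst + g i q)⁻¹, hp,
    (toOne hlap).add O ((hηi.mul_bdd O w1 hrad).const_smul O _), toOne hQ, hw, ?_,
    ⟨(19 / 20 * α) ^ 2, by positivity, fun i q => ?_⟩,
    ⟨(m - 1) * (α * C + α)⁻¹, ?_, fun i q => ?_⟩, fun i q h2 h3 f => ?_⟩
  · -- the cone itself is a solution, `(n - 1) α = (m - 1) / α`
    have hmain : UnifSmoothOn Set.univ ε (fun (i : ι) (q : RYSpace ℓ) =>
        (-(((m : ℝ) - 1) / α)) • (g i q * ((α * η q.fst + g i q)⁻¹ * (η q.fst)⁻¹)) -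
          (Laplacian.laplacian (perturbedCone α (g i)) q +
            ((n : ℝ) - 1) • ((η q.fst)⁻¹ * fderiv ℝ (g i) q (radialDir ℓ)))) :=
      ((hg.mul_bdd O wε (hui.mul_bdd O w1 hηi)).const_smul O _).sub O
        (hlap.add O ((hηi.bdd_mul O wε hgr).const_smul O _))
    refine ((((cst (1 : ℝ)).add O hp).bdd_mul O wε hmain).add O hQ).congr O fun i q _ => ?_
    have e1 := (hη0 q.fst).ne'
    have e2 : α * η q.fst + g i q ≠ 0 :=
      (lt_of_lt_of_le (by positivity) (hlow i q)).ne'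
    simp only [smul_eq_mul, fderiv_perturbedCone_radialDir (hg1.contDiff i)]
    congr 2
    have e3 : ((n : ℝ) - 1) = (m - 1) / α ^ 2 := by rw [← hα2]; field_simp
    rw [e3]
    field_simp
    ring
  · have h2 := le_gradient_perturbedCone_fst (hg1.contDiff i) q (h1 i q)
    have h3 := WithLp.norm_fst_le _ (gradient (perturbedCone α (g i)) q)
    rw [Real.norm_eq_abs] at h3
    exact pow_le_pow_left₀ (by positivity) (h2.trans ((le_abs_self _).trans h3)) 2
  · have : 0 < (m : ℝ) - 1 := by linarith
    positivity
  · have h2 : 0 < α * η q.fst + g i q := lt_of_lt_of_le (by positivity) (hlow i q)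
    refine mul_le_mul_of_nonneg_left (inv_anti₀ h2 (add_le_add ?_ ?_)) (by linarith)
    · have := hC i q trivial
      rw [Real.norm_eq_abs, Pi.one_apply, mul_one] at this
      exact mul_le_mul_of_nonneg_left ((le_abs_self _).trans this) hα.le
    · linarith [(abs_le.1 (h0 i q)).2]
  · simp only [metricRHS, radialLaplacian, hη2 _ h2 h3, perturbedCone]
    congr 2
    ring

end family

/-! ### Local existence and uniqueness of the metric factor -/

/-- Over a family of small perturbations of the cone, of size `ε`, the equation for the metric
factor has solutions `f = 1 + ε φ` with `φ` bounded with all its derivatives. The factor `χ`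
switches the equation on between the levels `3/10` and `2/5`. -/
theorem exists_localMetricFactor {ι : Type*} {ℓ n m : ℕ} {ε : ι → ℝ} {g : ι → RYSpace ℓ → ℝ}
    (hn : 2 ≤ n) (hm : 2 ≤ m)
    (hg : UnifSmoothOn Set.univ ε g) (hε0 : ∀ i, 0 < ε i) (hε1 : ∀ i, ε i ≤ 1)
    (h0 : ∀ i q, |g i q| ≤ coneSlope n m / 20)
    (h1 : ∀ i q, ‖fderiv ℝ (g i) q‖ ≤ coneSlope n m / 20) :
    ∃ χ : ℝ → ℝ, (∀ s, |χ s| ≤ 1) ∧ (∀ s, 2 / 5 ≤ s → s ≤ 5 / 2 → χ s = 1) ∧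
      ∃ φ : ι → RYSpace ℓ → ℝ, UnifSmoothOn Set.univ 1 φ ∧
        (∀ (i) (q : RYSpace ℓ), q.fst ≤ 3 / 10 → φ i q = 0) ∧
        ∃ c₁ : ℝ, 0 < c₁ ∧ ∀ (i) (q : RYSpace ℓ), q.fst < 2 → c₁ ≤ 1 + ε i * φ i q ∧
          ε i * fderiv ℝ (φ i) q (gradient (perturbedCone (coneSlope n m) (g i)) q) =
            χ q.fst * metricRHS n m (perturbedCone (coneSlope n m) (g i)) q (1 + ε i * φ i q) := by
  have hα := coneSlope_pos hn hm
  have hm1 : (2 : ℝ) ≤ m := mod_cast hm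
  have O := isOpen_univ (X := RYSpace ℓ)
  have w1 : ∀ i : ι, (0 : ℝ) ≤ (1 : ι → ℝ) i := fun _ => zero_le_one
  have hg1 : UnifSmoothOn Set.univ 1 g :=
    hg.mono_weight (fun i => (hε0 i).le) (c := 1) (by simpa using hε1)
  obtain ⟨χ, hχ, hχ0, hχ1, hχ2, hχ3⟩ := exists_smooth_switch
  obtain ⟨p, L, Q, w, hp, hL, hQ, hw, hN, ⟨p₀, hp₀, hpp⟩, ⟨w₀, hw₀, hww⟩, hR⟩ :=
    exists_coefficients hn hm hg hε0 hε1 h0 h1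
  set α := coneSlope n m
  have hfst : ∀ i q, 0 < (gradient (perturbedCone α (g i)) q).fst := fun i q =>
    lt_of_lt_of_le (by positivity) (le_gradient_perturbedCone_fst (hg1.contDiff i) q (h1 i q))
  have hd : UnifSmoothOn Set.univ 1 (fun i (q : RYSpace ℓ) =>
      χ q.fst * (gradient (perturbedCone α (g i)) q).fst⁻¹) :=
    ((hχ ι).comp_clm isOpen_univ O w1 (radialL ℓ) (Set.mapsTo_univ _ _)).mul_bdd O w1
      (((unifSmoothOn_gradient_perturbedCone hg1).clm_comp O (radialL ℓ)).inv O
        (c := 19 / 20 * α) (by positivity)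
        fun i q _ => le_gradient_perturbedCone_fst (hg1.contDiff i) q (h1 i q))
  obtain ⟨φ, hφ, hφ0, c₁, hc₁, hφc⟩ := exists_unifSmoothOn_metricFactor (radialL ℓ)
    (unifSmoothOn_characteristicField hα hg1 h1) (characteristicField_fst hα hg1 h1)
    (m := m) (a := 3 / 10) (T := 17 / 10) (by linarith) hp hL hQ hw hd hε0 hε1 hN hp₀ hpp hw₀ hww
    (fun i q => mul_nonneg (hχ0 _) (inv_pos.2 (hfst i q)).le)
    (fun i q hq => by simp only [hχ2 q.fst hq, zero_mul]) (by norm_num)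
  refine ⟨χ, fun s => abs_le.2 ⟨by linarith [hχ0 s], hχ1 s⟩, hχ3, φ, hφ, hφ0, c₁, hc₁,
    fun i q hq => ?_⟩
  obtain ⟨h2, h3⟩ := hφc i q (lt_of_lt_of_eq hq (by norm_num))
  refine ⟨h2, ?_⟩
  rw [characteristicField, map_smul, smul_eq_mul] at h3
  have h4 := (hfst i q).ne'
  have h5 : ε i * fderiv ℝ (φ i) q (gradient (perturbedCone α (g i)) q) =
      χ q.fst * (metricNum (p i q) (L i q) (Q i q) (w i q) (1 + ε i * φ i q) /
        metricDen m (p i q) (1 + ε i * φ i q)) := by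
    have : ε i * fderiv ℝ (φ i) q (gradient (perturbedCone α (g i)) q) =
      (gradient (perturbedCone α (g i)) q).fst * (ε i *
        ((gradient (perturbedCone α (g i)) q).fst⁻¹ *
          fderiv ℝ (φ i) q (gradient (perturbedCone α (g i)) q))) := by
      field_simp
    rw [this, h3]
    field_simp
  rw [h5]
  rcases le_or_gt q.fst (3 / 10) with h6 | h6
  · rw [hχ2 _ h6, zero_mul, zero_mul]
  · rw [hR i q h6.le (by linarith)]

/-- The backward cone that contains the characteristic through `q` above the level `b`. The
slope of the characteristics against the `r`-axis is at most `(α/20) / (19α/20) = 1/19 < 3/50`. -/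
def backwardCone {ℓ : ℕ} (b : ℝ) (q : RYSpace ℓ) : Set (RYSpace ℓ) :=
  {p | b ≤ p.fst ∧ p.fst ≤ q.fst ∧ ‖p.snd - q.snd‖ ≤ 3 / 50 * (q.fst - p.fst)}

/-- Two solutions of the equation for the metric factor that agree at the level `b` agree: the
equation is an ordinary differential equation along the characteristic, with Lipschitz right-hand
side on `(0, ∞)`. -/
theorem metricFactor_unique {ℓ n m : ℕ} {g : RYSpace ℓ → ℝ} (hn : 2 ≤ n) (hm : 2 ≤ m)
    (hg : UnifSmoothOn Set.univ 1 (fun _ : Unit => g))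
    (h0 : ∀ q, |g q| ≤ coneSlope n m / 20) (h1 : ∀ q, ‖fderiv ℝ g q‖ ≤ coneSlope n m / 20)
    {b : ℝ} {q : RYSpace ℓ} (hb : 3 / 10 ≤ b) (hbq : b ≤ q.fst) (hq : q.fst ≤ 5 / 2)
    {χ : ℝ → ℝ} (hχ : ∀ s, |χ s| ≤ 1) {f₁ f₂ : RYSpace ℓ → ℝ}
    (hf₁ : ∀ p ∈ backwardCone b q, 0 < f₁ p ∧ DifferentiableAt ℝ f₁ p ∧
      fderiv ℝ f₁ p (gradient (perturbedCone (coneSlope n m) g) p) =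
        χ p.fst * metricRHS n m (perturbedCone (coneSlope n m) g) p (f₁ p))
    (hf₂ : ∀ p ∈ backwardCone b q, 0 < f₂ p ∧ DifferentiableAt ℝ f₂ p ∧
      fderiv ℝ f₂ p (gradient (perturbedCone (coneSlope n m) g) p) =
        χ p.fst * metricRHS n m (perturbedCone (coneSlope n m) g) p (f₂ p))
    (heq : ∀ p ∈ backwardCone b q, p.fst = b → f₁ p = f₂ p) : f₁ q = f₂ q := by
  have hα := coneSlope_pos hn hm
  have hm1 : (2 : ℝ) ≤ m := mod_cast hm
  have O := isOpen_univ (X := RYSpace ℓ)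
  have w1 : ∀ i : Unit, (0 : ℝ) ≤ (1 : Unit → ℝ) i := fun _ => zero_le_one
  obtain ⟨p, L, Q, w, hp, hL, hQ, hw, -, ⟨p₀, hp₀, hpp⟩, -, hR⟩ :=
    exists_coefficients hn hm hg (ε := fun _ => 1) (fun _ => one_pos) (fun _ => le_rfl)
      (fun _ => h0) (fun _ => h1)
  set α := coneSlope n m
  set u := perturbedCone α g
  obtain ⟨C1, hC1, k1⟩ := ((hp.mul_bdd O w1 hL).sub O hQ).norm_le w1
  obtain ⟨C2, hC2, k2⟩ := ((hp.mul_bdd O w1 hw).sub O hL).norm_le w1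
  obtain ⟨C3, hC3, k3⟩ := hw.norm_le w1
  obtain ⟨C4, hC4, k4⟩ := hp.norm_le w1
  simp only [Set.mem_univ, forall_true_left, Pi.one_apply, mul_one, Real.norm_eq_abs]
    at k1 k2 k3 k4
  set C := C1 + C2 + C3 + C4
  obtain ⟨γ, e1, e2, e3⟩ := exists_characteristic (radialL ℓ)
    (unifSmoothOn_characteristicField hα hg (fun _ => h1))
    (characteristicField_fst hα hg (fun _ => h1)) () b q
  change γ (q.fst - b) = q at e1
  have e3' : ∀ t, (γ t).fst = b + t := e3
  have hfst : ∀ p, 19 / 20 * α ≤ (gradient u p).fst := fun p =>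
    le_gradient_perturbedCone_fst (hg.contDiff ()) p (h1 p)
  have hfst0 : ∀ p, 0 < (gradient u p).fst := fun p => lt_of_lt_of_le (by positivity) (hfst p)
  -- the characteristic stays in the cone
  have hsnd : ∀ s t, ‖(γ s).snd - (γ t).snd‖ ≤ 3 / 50 * ‖s - t‖ := fun s t =>
    Convex.norm_image_sub_le_of_norm_hasDerivWithin_le (f := fun t => (γ t).snd)
      (fun t _ => ((WithLp.sndL 2 ℝ ℝ (YSpace ℓ)).hasFDerivAt.comp_hasDerivAt t
        (e2 t)).hasDerivWithinAt)
      (fun t _ => by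
        rw [characteristicField, map_smul, norm_smul, norm_inv, Real.norm_eq_abs,
          abs_of_pos (hfst0 _), ← div_eq_inv_mul, div_le_iff₀ (hfst0 _)]
        have := norm_gradient_perturbedCone_snd_le (α := α) (hg.contDiff ()) (γ t) (h1 _)
        refine this.trans ?_
        have := hfst (γ t)
        linarith) convex_univ trivial trivial
  have hcone : ∀ t ∈ Set.Icc 0 (q.fst - b), γ t ∈ backwardCone b q := fun t ht => by
    refine ⟨by rw [e3']; linarith [ht.1], by rw [e3']; linarith [ht.2], ?_⟩
    have := hsnd t (q.fst - b)
    rw [e1, Real.norm_eq_abs, abs_of_nonpos (by linarith [ht.2])] at this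
    rw [e3']
    linarith
  set K := (19 / 20 * α)⁻¹ * (4 * C / (m * p₀) + C + m * C ^ 2)
  have hder : ∀ f : RYSpace ℓ → ℝ, (∀ p ∈ backwardCone b q, 0 < f p ∧ DifferentiableAt ℝ f p ∧
      fderiv ℝ f p (gradient u p) = χ p.fst * metricRHS n m u p (f p)) →
      ∀ t ∈ Set.Icc 0 (q.fst - b), HasDerivAt (fun t => f (γ t))
        ((gradient u (γ t)).fst⁻¹ * (χ (γ t).fst * metricRHS n m u (γ t) (f (γ t)))) t :=
      fun f hf t ht => by
    obtain ⟨-, hd, he⟩ := hf _ (hcone t ht)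
    have := hd.hasFDerivAt.comp_hasDerivAt t (e2 t)
    rwa [characteristicField, map_smul, smul_eq_mul, he] at this
  have key := eq_zero_of_abs_deriv_le_mul_abs_self_of_eq_zero_right
    (f := fun t => f₁ (γ t) - f₂ (γ t)) (K := K) (a := 0) (b := q.fst - b)
    (f' := fun t =>
      (gradient u (γ t)).fst⁻¹ * (χ (γ t).fst * metricRHS n m u (γ t) (f₁ (γ t))) -
      (gradient u (γ t)).fst⁻¹ * (χ (γ t).fst * metricRHS n m u (γ t) (f₂ (γ t))))
    (fun t ht => ((hder f₁ hf₁ t ht).sub (hder f₂ hf₂ t ht)).continuousAt.continuousWithinAt)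
    (fun t ht => ((hder f₁ hf₁ t ⟨ht.1, ht.2.le⟩).sub
      (hder f₂ hf₂ t ⟨ht.1, ht.2.le⟩)).hasDerivWithinAt)
    (sub_eq_zero.2 (heq _ (hcone 0 ⟨le_rfl, by linarith⟩) (by rw [e3', add_zero])))
    (fun t ht => by
      have hc := hcone t ⟨ht.1, ht.2.le⟩
      have hCsum : C1 ≤ C ∧ C2 ≤ C ∧ C3 ≤ C ∧ C4 ≤ C := by
        refine ⟨?_, ?_, ?_, ?_⟩ <;> simp only [C] <;> linarith
      have h2 := abs_metricNum_div_sub_le (m := m) (by linarith) hp₀ (hpp () (γ t))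
        (((le_abs_self _).trans (k4 () (γ t))).trans hCsum.2.2.2)
        ((k1 () (γ t)).trans hCsum.1) ((k2 () (γ t)).trans hCsum.2.1)
        ((k3 () (γ t)).trans hCsum.2.2.1) (hf₁ _ hc).1 (hf₂ _ hc).1
      have hR' := hR () (γ t) (hb.trans hc.1) (hc.2.1.trans hq)
      rw [hR', hR', ← mul_sub, ← mul_sub, norm_mul, norm_mul, Real.norm_eq_abs, Real.norm_eq_abs,
        Real.norm_eq_abs, Real.norm_eq_abs, abs_of_pos (inv_pos.2 (hfst0 _)), mul_assoc]
      refine mul_le_mul (inv_anti₀ (by positivity) (hfst _)) ?_ (by positivity) (by positivity)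
      exact (mul_le_of_le_one_left (abs_nonneg _) (hχ _)).trans h2)
    (q.fst - b) ⟨by linarith, le_rfl⟩
  simp only [e1] at key
  exact sub_eq_zero.1 key

/-! ### Rescaling -/

section rescaling
variable {E F : Type*} [NormedAddCommGroup E] [NormedSpace ℝ E] [NormedAddCommGroup F]
  [NormedSpace ℝ F]

theorem iteratedFDeriv_comp_add_smul (f : E → F) {t : ℝ} (ht : t ≠ 0) (a x : E) (k : ℕ) :
    iteratedFDeriv ℝ k (fun p => f (a + t • p)) x = t ^ k • iteratedFDeriv ℝ k f (a + t • x) := by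
  let e : E ≃L[ℝ] E := ContinuousLinearEquiv.smulLeft (Units.mk0 t ht)
  have he : ∀ p, e p = t • p := fun p => rfl
  have h1 := e.iteratedFDerivWithin_comp_right (fun p => f (a + p)) uniqueDiffOn_univ
    (x := x) trivial k
  rw [Set.preimage_univ, iteratedFDerivWithin_univ, iteratedFDerivWithin_univ,
    iteratedFDeriv_comp_add_left] at h1
  change iteratedFDeriv ℝ k (fun p => f (a + t • p)) x = _ at h1
  rw [h1]
  ext v
  rw [ContinuousMultilinearMap.compContinuousLinearMap_apply, smul_apply, he]
  change iteratedFDeriv ℝ k f (a + t • x) (fun i => t • v i) = _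
  rw [ContinuousMultilinearMap.map_smul_univ]
  simp

theorem fderiv_comp_add_smul (f : E → F) {t : ℝ} (a x : E) :
    fderiv ℝ (fun p => f (a + t • p)) x = t • fderiv ℝ f (a + t • x) := by
  have := fderiv_comp_smul (f := fun p => f (a + p)) (x := x) t
  rw [fderiv_comp_add_left] at this
  exact this

end rescaling

/-- The rescaling of `u` about `a` that preserves its gradient. -/
noncomputable def rescale {ℓ : ℕ} (t : ℝ) (a : RYSpace ℓ) (u : RYSpace ℓ → ℝ) (p : RYSpace ℓ) : ℝ :=
  t⁻¹ * u (a + t • p)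

section rescale
variable {ℓ n m : ℕ} {t : ℝ} (a : RYSpace ℓ) (u f : RYSpace ℓ → ℝ) (p : RYSpace ℓ)

theorem fderiv_rescale (ht : t ≠ 0) :
    fderiv ℝ (rescale t a u) p = fderiv ℝ u (a + t • p) := by
  have : rescale t a u = t⁻¹ • fun p => u (a + t • p) := rfl
  rw [this, fderiv_const_smul_field, Pi.smul_apply, fderiv_comp_add_smul, smul_smul,
    inv_mul_cancel₀ ht, one_smul]

theorem gradient_rescale (ht : t ≠ 0) :
    gradient (rescale t a u) p = gradient u (a + t • p) := by
  rw [gradient, gradient, fderiv_rescale a u p ht]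

theorem fderiv_fderiv_rescale (ht : t ≠ 0) :
    fderiv ℝ (fderiv ℝ (rescale t a u)) p = t • fderiv ℝ (fderiv ℝ u) (a + t • p) := by
  rw [← fderiv_comp_add_smul]
  exact congrFun (congrArg _ (funext fun p => fderiv_rescale a u p ht)) p

theorem hessQuad_rescale (ht : t ≠ 0) :
    hessQuad (rescale t a u) p = t * hessQuad u (a + t • p) := by
  rw [hessQuad, hessQuad, iteratedFDeriv_two_apply, iteratedFDeriv_two_apply,
    fderiv_fderiv_rescale a u p ht, gradient_rescale a u p ht]
  rfl

theorem radialLaplacian_rescale (ht : t ≠ 0) (ha : a.fst = 0) :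
    radialLaplacian n (rescale t a u) p = t * radialLaplacian n u (a + t • p) := by
  have h1 : (a + t • p).fst = t * p.fst := by
    change a.fst + t * p.fst = _
    rw [ha, zero_add]
  rw [radialLaplacian, radialLaplacian, h1, fderiv_rescale a u p ht,
    InnerProductSpace.laplacian_eq_iteratedFDeriv_stdOrthonormalBasis,
    InnerProductSpace.laplacian_eq_iteratedFDeriv_stdOrthonormalBasis, mul_add, Finset.mul_sum]
  congr 1
  · refine Finset.sum_congr rfl fun j _ => ?_
    rw [iteratedFDeriv_two_apply, iteratedFDeriv_two_apply, fderiv_fderiv_rescale a u p ht]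
    rfl
  · rw [← mul_assoc, mul_comm t p.fst, ← div_div, mul_div_cancel₀ _ ht]

theorem metricRHS_rescale (ht : t ≠ 0) (ha : a.fst = 0) (c : ℝ) :
    metricRHS n m (rescale t a u) p c = t * metricRHS n m u (a + t • p) c := by
  rw [metricRHS, metricRHS, gradient_rescale a u p ht, radialLaplacian_rescale a u p ht ha,
    hessQuad_rescale a u p ht, ← mul_div_assoc]
  congr 1
  simp only [metricNum, rescale, div_mul_eq_div_div, div_inv_eq_mul]
  ring

theorem smeOp_rescale (ht : t ≠ 0) (ha : a.fst = 0) :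
    smeOp n m (rescale t a u) p = t * smeOp n m u (a + t • p) := by
  rw [smeOp, smeOp, gradient_rescale a u p ht, radialLaplacian_rescale a u p ht ha,
    hessQuad_rescale a u p ht]
  simp only [rescale, div_mul_eq_div_div, div_inv_eq_mul]
  ring

/-- Both sides of the equation for the metric factor scale in the same way; compare
`metricRHS_rescale`. -/
theorem fderiv_comp_add_smul_gradient_rescale (ht : t ≠ 0) :
    fderiv ℝ (fun p => f (a + t • p)) p (gradient (rescale t a u) p) =
      t * fderiv ℝ f (a + t • p) (gradient u (a + t • p)) := by
  rw [fderiv_comp_add_smul, gradient_rescale a u p ht]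
  rfl

end rescale

/-! ### Localization at a point of the domain -/

/-- A family that vanishes outside a closed part of the domain is uniformly smooth everywhere. -/
theorem UnifSmoothOn.univ_of_eq_zero {ι E F : Type*} [NormedAddCommGroup E] [NormedSpace ℝ E]
    [NormedAddCommGroup F] [NormedSpace ℝ F] {Ω S : Set E} {w : ι → ℝ} {f : ι → E → F}
    (hf : UnifSmoothOn Ω w f) (hw : ∀ i, 0 ≤ w i) (hΩ : IsOpen Ω) (hS : IsClosed S)
    (hSΩ : S ⊆ Ω) (h : ∀ i, ∀ x ∉ S, f i x = 0) : UnifSmoothOn Set.univ w f := by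
  have h0 : ∀ i, ∀ x ∉ S, f i =ᶠ[nhds x] fun _ => 0 := fun i x hx =>
    Filter.eventuallyEq_of_mem (hS.isOpen_compl.mem_nhds hx) (h i)
  refine ⟨fun i => contDiffOn_univ.2 (contDiff_iff_contDiffAt.2 fun x => ?_), fun k => ?_⟩
  · by_cases hx : x ∈ S
    · exact hf.contDiffAt hΩ i (hSΩ hx)
    · exact contDiffAt_const.congr_of_eventuallyEq (h0 i x hx)
  · obtain ⟨C, hC0, hC⟩ := hf.bound_nonneg hw k
    refine ⟨C, fun i x _ => ?_⟩
    by_cases hx : x ∈ S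
    · exact hC i x (hSΩ hx)
    · rw [((h0 i x hx).iteratedFDeriv ℝ k).eq_of_nhds]
      have : iteratedFDeriv ℝ k (fun _ : E => (0 : F)) x = 0 := by
        rcases k with _ | k
        · ext; simp
        · simp
      rw [this, norm_zero]
      exact mul_nonneg hC0 (hw i)

/-- The cylinder on which the rescaled functions are studied. -/
def unitCylinder (ℓ : ℕ) : Set (RYSpace ℓ) := {p | 13 / 50 < p.fst ∧ ‖p.snd‖ < 1}

theorem isOpen_unitCylinder (ℓ : ℕ) : IsOpen (unitCylinder ℓ) :=
  (isOpen_lt continuous_const (WithLp.fstL 2 ℝ ℝ (YSpace ℓ)).continuous).inter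
    (isOpen_lt (WithLp.sndL 2 ℝ ℝ (YSpace ℓ)).continuous.norm continuous_const)

theorem convex_unitCylinder (ℓ : ℕ) : Convex ℝ (unitCylinder ℓ) := by
  have h1 : Convex ℝ {p : RYSpace ℓ | 13 / 50 < p.fst} :=
    convex_halfSpace_gt (WithLp.fstL 2 ℝ ℝ (YSpace ℓ)).isLinear _
  have h2 : Convex ℝ {p : RYSpace ℓ | ‖p.snd‖ < 1} := by
    have h3 : {p : RYSpace ℓ | ‖p.snd‖ < 1} =
        (WithLp.sndL 2 ℝ ℝ (YSpace ℓ)).toLinearMap ⁻¹' Metric.ball 0 1 := by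
      ext p
      rw [Set.mem_preimage, mem_ball_zero_iff]
      rfl
    rw [h3]
    exact (convex_ball (0 : YSpace ℓ) 1).linear_preimage _
  exact h1.inter h2

/-- A cutoff function supported in the cylinder. -/
theorem exists_cutoff (ℓ : ℕ) : ∃ ψ : RYSpace ℓ → ℝ,
    (∀ ι : Type, UnifSmoothOn Set.univ 1 (fun _ : ι => ψ)) ∧ (∀ p, 0 ≤ ψ p) ∧ (∀ p, ψ p ≤ 1) ∧
    (∀ p : RYSpace ℓ, 29 / 100 ≤ p.fst → p.fst ≤ 27 / 10 → ‖p.snd‖ ≤ 3 / 4 → ψ p = 1) ∧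
    ∀ p : RYSpace ℓ, ¬ (27 / 100 ≤ p.fst ∧ ‖p.snd‖ ≤ 9 / 10) → ψ p = 0 := by
  let a : ContDiffBump (3 / 2 : ℝ) := ⟨121 / 100, 123 / 100, by norm_num, by norm_num⟩
  let b : ContDiffBump (0 : YSpace ℓ) := ⟨3 / 4, 9 / 10, by norm_num, by norm_num⟩
  refine ⟨fun p => a p.fst * b p.snd, fun ι => ?_, fun p => mul_nonneg a.nonneg b.nonneg,
    fun p => mul_le_one₀ a.le_one b.nonneg b.le_one, fun p h1 h2 h3 => ?_, fun p h => ?_⟩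
  · have w1 : ∀ i : ι, (0 : ℝ) ≤ (1 : ι → ℝ) i := fun _ => zero_le_one
    exact ((unifSmoothOn_of_hasCompactSupport a.contDiff a.hasCompactSupport).comp_clm
      isOpen_univ isOpen_univ w1 (WithLp.fstL 2 ℝ ℝ (YSpace ℓ)) (Set.mapsTo_univ _ _)).mul_bdd
      isOpen_univ w1 ((unifSmoothOn_of_hasCompactSupport b.contDiff b.hasCompactSupport).comp_clm
      isOpen_univ isOpen_univ w1 (WithLp.sndL 2 ℝ ℝ (YSpace ℓ)) (Set.mapsTo_univ _ _))
  · have e1 : a p.fst = 1 := a.one_of_mem_closedBall (by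
      rw [Metric.mem_closedBall, Real.dist_eq]
      exact abs_le.2 ⟨by change -(121 / 100 : ℝ) ≤ _; linarith,
        by change _ ≤ (121 / 100 : ℝ); linarith⟩)
    have e2 : b p.snd = 1 := b.one_of_mem_closedBall (by
      rwa [mem_closedBall_zero_iff])
    simp only [e1, e2, one_mul]
  · by_cases h1 : 27 / 100 ≤ p.fst
    · have h2 : 9 / 10 ≤ ‖p.snd‖ := le_of_not_ge fun h2 => h ⟨h1, h2⟩
      have : b p.snd = 0 := b.zero_of_le_dist (by rw [dist_zero_right]; exact h2)
      simp only [this, mul_zero]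
    · have : a p.fst = 0 := a.zero_of_le_dist (by
        rw [Real.dist_eq, abs_of_neg (by linarith)]; change (123 / 100 : ℝ) ≤ _; linarith)
      simp only [this, zero_mul]

/-- The data of the problem together with a point of the domain. These serve as the index of the
uniform estimates, so that all constants depend only on the parameters of this type. -/
structure PointedData (n m ℓ : ℕ) (τ₀ : ℝ) (B c : ℕ → ℕ → ℝ) where
  /-- the closed set on which the height vanishes -/
  K : Set (YSpace ℓ)
  /-- the height -/
  h : YSpace ℓ → ℝ
  /-- the size of the perturbation -/
  τ : ℝ
  /-- the perturbed cone -/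
  u : RYSpace ℓ → ℝ
  /-- the point -/
  y : YSpace ℓ
  isClosed : IsClosed K
  isHeight : IsHeight K τ₀ B h
  tau_pos : 0 < τ
  tau_le : τ ≤ 1
  isNearCone : IsNearCone n m K h τ c u
  notMem : y ∉ K

namespace PointedData
variable {n m ℓ : ℕ} {τ₀ : ℝ} {B c : ℕ → ℕ → ℝ} (i : PointedData n m ℓ τ₀ B c)

/-- The height at the base point. -/
def h₀ : ℝ := i.h i.y

/-- The length scale `h(y)²` at the base point. -/
def scale : ℝ := i.h₀ ^ 2

/-- The expected size of `f - 1` near the base point. -/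
def weight (J : ℕ) : ℝ := i.τ * i.h₀ ^ J

/-- The point with rescaled coordinates `p`. -/
def toOrig (p : RYSpace ℓ) : RYSpace ℓ := yDir i.y + i.scale • p

/-- The ratio `h² / h₀²` in rescaled coordinates. -/
noncomputable def ratio (z : YSpace ℓ) : ℝ := i.h (i.y + i.scale • z) ^ 2 / i.scale

/-- The rescaled perturbation `u - α r`, not yet cut off. -/
noncomputable def pert : RYSpace ℓ → ℝ :=
  rescale i.scale (yDir i.y) (fun q => i.u q - coneSlope n m * q.fst)

theorem h₀_pos : 0 < i.h₀ := i.isHeight.pos _ i.notMem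

theorem height_lt (y : YSpace ℓ) : i.h y < τ₀ := by
  have := i.isHeight.small y
  linarith [norm_nonneg (fderiv ℝ i.h y), norm_nonneg (iteratedFDeriv ℝ 2 i.h y)]

theorem h₀_lt : i.h₀ < τ₀ := i.height_lt _

theorem scale_pos : 0 < i.scale := pow_pos i.h₀_pos 2

theorem weight_pos (J : ℕ) : 0 < i.weight J := mul_pos i.tau_pos (pow_pos i.h₀_pos J)

theorem weight_le_one (hτ₀ : τ₀ ≤ 1) (J : ℕ) : i.weight J ≤ 1 :=
  mul_le_one₀ i.tau_le (pow_pos i.h₀_pos J).le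
    (pow_le_one₀ i.h₀_pos.le (i.h₀_lt.le.trans hτ₀))

theorem toOrig_fst (p : RYSpace ℓ) : (i.toOrig p).fst = i.scale * p.fst := by
  simp [toOrig, yDir]

theorem toOrig_snd (p : RYSpace ℓ) : (i.toOrig p).snd = i.y + i.scale • p.snd := by
  simp [toOrig, yDir]

theorem height_nonneg (y : YSpace ℓ) : 0 ≤ i.h y := by
  by_cases hy : y ∈ i.K
  · exact (i.isHeight.zero y hy).ge
  · exact (i.isHeight.pos y hy).le

theorem notMem_of_pos {y : YSpace ℓ} (hy : 0 < i.h y) : y ∉ i.K := fun h =>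
  hy.ne' (i.isHeight.zero y h)

theorem abs_height_sub_le (y y' : YSpace ℓ) : |i.h y - i.h y'| ≤ τ₀ * ‖y - y'‖ := by
  have := Convex.norm_image_sub_le_of_norm_fderiv_le (𝕜 := ℝ) (f := i.h) (C := τ₀) (s := Set.univ)
    (fun y _ => (i.isHeight.contDiff.differentiable (by simp)) y) (fun y _ => by
      have := i.isHeight.small y
      linarith [i.height_nonneg y, norm_nonneg (iteratedFDeriv ℝ 2 i.h y)])
    convex_univ (Set.mem_univ y') (Set.mem_univ y)
  simpa using this

/-- On balls of radius `h₀²` the height is nearly constant. -/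
theorem abs_height_sub_h₀_le (hτ₀ : τ₀ ≤ 1 / 10) {z : YSpace ℓ} (hz : ‖z‖ ≤ 1) :
    |i.h (i.y + i.scale • z) - i.h₀| ≤ i.h₀ / 100 := by
  have h1 := i.abs_height_sub_le (i.y + i.scale • z) i.y
  have h2 := i.h₀_pos
  have h3 := i.h₀_lt
  rw [add_sub_cancel_left, norm_smul, Real.norm_eq_abs, abs_of_pos i.scale_pos] at h1
  refine h1.trans ?_
  have h4 : τ₀ * (i.scale * ‖z‖) ≤ τ₀ * i.scale :=
    mul_le_mul_of_nonneg_left (mul_le_of_le_one_right i.scale_pos.le hz) (by linarith)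
  refine h4.trans ?_
  rw [scale, sq, ← mul_assoc, div_eq_mul_inv, mul_comm i.h₀]
  have : τ₀ * i.h₀ ≤ 1 / 10 * (1 / 10) := mul_le_mul hτ₀ (by linarith) h2.le (by norm_num)
  nlinarith

theorem height_bounds (hτ₀ : τ₀ ≤ 1 / 10) {z : YSpace ℓ} (hz : ‖z‖ ≤ 1) :
    99 / 100 * i.h₀ ≤ i.h (i.y + i.scale • z) ∧
      i.h (i.y + i.scale • z) ≤ 101 / 100 * i.h₀ := by
  have := abs_le.1 (i.abs_height_sub_h₀_le hτ₀ hz)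
  constructor <;> linarith

theorem notMem_of_norm_le (hτ₀ : τ₀ ≤ 1 / 10) {z : YSpace ℓ} (hz : ‖z‖ ≤ 1) :
    i.y + i.scale • z ∉ i.K :=
  i.notMem_of_pos (lt_of_lt_of_le (by have := i.h₀_pos; positivity) (i.height_bounds hτ₀ hz).1)

theorem ratio_mul_scale (z : YSpace ℓ) : i.scale * i.ratio z = i.h (i.y + i.scale • z) ^ 2 :=
  mul_div_cancel₀ _ i.scale_pos.ne'

theorem ratio_zero : i.ratio 0 = 1 := by
  rw [ratio, smul_zero, add_zero]; exact div_self i.scale_pos.ne'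

theorem ratio_bounds (hτ₀ : τ₀ ≤ 1 / 10) {z : YSpace ℓ} (hz : ‖z‖ ≤ 1) :
    98 / 100 ≤ i.ratio z ∧ i.ratio z ≤ 103 / 100 := by
  obtain ⟨h1, h2⟩ := i.height_bounds hτ₀ hz
  have h3 := i.h₀_pos
  rw [ratio, le_div_iff₀ i.scale_pos, div_le_iff₀ i.scale_pos]
  generalize i.h (i.y + i.scale • z) = H at h1 h2 ⊢
  rw [scale]
  constructor <;> nlinarith

theorem ratio_pos (hτ₀ : τ₀ ≤ 1 / 10) {z : YSpace ℓ} (hz : ‖z‖ ≤ 1) : 0 < i.ratio z :=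
  lt_of_lt_of_le (by norm_num) (i.ratio_bounds hτ₀ hz).1

theorem abs_ratio_sub_le (hτ₀ : τ₀ ≤ 1 / 10) {z z' : YSpace ℓ} (hz : ‖z‖ ≤ 1) (hz' : ‖z'‖ ≤ 1) :
    |i.ratio z - i.ratio z'| ≤ 3 / 100 * ‖z - z'‖ := by
  have h1 := i.abs_height_sub_le (i.y + i.scale • z) (i.y + i.scale • z')
  rw [add_sub_add_left_eq_sub, ← smul_sub, norm_smul, Real.norm_eq_abs,
    abs_of_pos i.scale_pos] at h1
  obtain ⟨a1, a2⟩ := i.height_bounds hτ₀ hz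
  obtain ⟨b1, b2⟩ := i.height_bounds hτ₀ hz'
  have h3 := i.h₀_pos
  have h4 := i.h₀_lt
  rw [ratio, ratio, ← sub_div, abs_div, abs_of_pos i.scale_pos, div_le_iff₀ i.scale_pos,
    sq_sub_sq, abs_mul, abs_of_pos (by linarith)]
  have h5 : i.h (i.y + i.scale • z) + i.h (i.y + i.scale • z') ≤ 3 * i.h₀ := by linarith
  have h6 : 3 * i.h₀ * τ₀ ≤ 3 / 100 := by
    have : i.h₀ * τ₀ ≤ 1 / 10 * (1 / 10) :=
      mul_le_mul (by linarith) hτ₀ (by linarith) (by norm_num)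
    linarith
  calc _ ≤ 3 * i.h₀ * (τ₀ * (i.scale * ‖z - z'‖)) :=
        mul_le_mul h5 h1 (abs_nonneg _) (by positivity)
    _ = 3 * i.h₀ * τ₀ * (i.scale * ‖z - z'‖) := by ring
    _ ≤ 3 / 100 * (i.scale * ‖z - z'‖) :=
        mul_le_mul_of_nonneg_right h6 (mul_nonneg i.scale_pos.le (norm_nonneg _))
    _ = _ := by ring

theorem quarter_lt_toOrig_fst (hτ₀ : τ₀ ≤ 1 / 10) {p : RYSpace ℓ} (hp : p ∈ unitCylinder ℓ) :
    i.h (i.toOrig p).snd ^ 2 / 4 < (i.toOrig p).fst := by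
  have h1 := (i.ratio_bounds hτ₀ hp.2.le).2
  rw [toOrig_snd, toOrig_fst, ← ratio_mul_scale, mul_div_assoc]
  exact mul_lt_mul_of_pos_left (by linarith [hp.1]) i.scale_pos

theorem toOrig_snd_notMem (hτ₀ : τ₀ ≤ 1 / 10) {p : RYSpace ℓ} (hp : ‖p.snd‖ ≤ 1) :
    (i.toOrig p).snd ∉ i.K := by
  rw [toOrig_snd]; exact i.notMem_of_norm_le hτ₀ hp

theorem contDiff_toOrig : ContDiff ℝ ∞ i.toOrig :=
  contDiff_const.add (contDiff_id.const_smul _)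

theorem contDiffOn_slope_sub : ContDiffOn ℝ ∞ (fun q : RYSpace ℓ => i.u q - coneSlope n m * q.fst)
    {q | 0 < q.fst ∧ q.snd ∉ i.K} :=
  i.isNearCone.contDiffOn.sub (contDiff_const.mul (radialL ℓ).contDiff).contDiffOn

theorem toOrig_mem_domain (hτ₀ : τ₀ ≤ 1 / 10) {p : RYSpace ℓ} (hp0 : 0 < p.fst)
    (hp : ‖p.snd‖ ≤ 1) : i.toOrig p ∈ {q : RYSpace ℓ | 0 < q.fst ∧ q.snd ∉ i.K} :=
  ⟨by rw [toOrig_fst]; exact mul_pos i.scale_pos hp0, i.toOrig_snd_notMem hτ₀ hp⟩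

theorem mapsTo_toOrig (hτ₀ : τ₀ ≤ 1 / 10) :
    Set.MapsTo i.toOrig (unitCylinder ℓ) {q : RYSpace ℓ | 0 < q.fst ∧ q.snd ∉ i.K} :=
  fun _ hp => i.toOrig_mem_domain hτ₀ (by linarith [hp.1]) hp.2.le

theorem contDiffOn_pert (hτ₀ : τ₀ ≤ 1 / 10) : ContDiffOn ℝ ∞ i.pert (unitCylinder ℓ) :=
  contDiffOn_const.mul (i.contDiffOn_slope_sub.comp i.contDiff_toOrig.contDiffOn
    (i.mapsTo_toOrig hτ₀))

/-- All derivatives of the rescaled perturbation are of the size of the weight, since the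
derivatives of `u - α r` vanish to infinite order in `h`. -/
theorem norm_iteratedFDeriv_pert_le (hτ₀ : τ₀ ≤ 1 / 10) (J k : ℕ) {p : RYSpace ℓ}
    (hp : p ∈ unitCylinder ℓ) :
    ‖iteratedFDeriv ℝ k i.pert p‖ ≤ |c (J + 2) k| * 2 ^ (J + 2) * i.weight J := by
  have h0 := i.h₀_pos
  have ht := i.scale_pos
  have hc : ContDiffAt ℝ k (fun p => i.u (yDir i.y + i.scale • p) -
      coneSlope n m * (yDir i.y + i.scale • p).fst) p :=
    (((i.contDiffOn_slope_sub.comp i.contDiff_toOrig.contDiffOn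
    (i.mapsTo_toOrig hτ₀)).contDiffAt ((isOpen_unitCylinder ℓ).mem_nhds hp))).of_le
      (mod_cast le_top)
  have e1 : i.pert = fun p => i.scale⁻¹ • (i.u (yDir i.y + i.scale • p) -
      coneSlope n m * (yDir i.y + i.scale • p).fst) := rfl
  have e2 := iteratedFDeriv_comp_add_smul
    (fun q : RYSpace ℓ => i.u q - coneSlope n m * q.fst) ht.ne' (yDir i.y) p k
  have hb := i.isNearCone.deriv_small (J + 2) k (i.toOrig p) (i.toOrig_snd_notMem hτ₀ hp.2.le)
    (i.quarter_lt_toOrig_fst hτ₀ hp)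
  have hh := (i.height_bounds hτ₀ hp.2.le)
  rw [← toOrig_snd] at hh
  have hhJ : i.h (i.toOrig p).snd ^ (J + 2) ≤ 2 ^ (J + 2) * (i.h₀ ^ J * i.scale) := by
    rw [scale, ← pow_add, ← mul_pow]
    exact pow_le_pow_left₀ (i.height_nonneg _) (by linarith) _
  have hscale1 : i.scale ^ k ≤ 1 := by
    refine pow_le_one₀ ht.le (pow_le_one₀ h0.le ?_)
    linarith [i.h₀_lt]
  rw [e1, iteratedFDeriv_const_smul_apply' hc, e2, norm_smul, norm_smul, norm_inv, norm_pow,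
    Real.norm_eq_abs, abs_of_pos ht, weight]
  have hX : ‖iteratedFDeriv ℝ k (fun q : RYSpace ℓ => i.u q - coneSlope n m * q.fst)
      (yDir i.y + i.scale • p)‖ ≤ |c (J + 2) k| * i.τ * (2 ^ (J + 2) * (i.h₀ ^ J * i.scale)) := by
    refine hb.trans ?_
    have := i.tau_pos
    exact mul_le_mul (mul_le_mul_of_nonneg_right (le_abs_self _) this.le) hhJ
      (pow_nonneg (i.height_nonneg _) _) (by positivity)
  calc _ ≤ i.scale⁻¹ * (1 * (|c (J + 2) k| * i.τ * (2 ^ (J + 2) * (i.h₀ ^ J * i.scale)))) := by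
        refine mul_le_mul_of_nonneg_left ?_ (inv_pos.2 ht).le
        exact mul_le_mul hscale1 hX (norm_nonneg _) zero_le_one
    _ = _ := by field_simp

theorem pert_eq_zero (hτ₀ : τ₀ ≤ 1 / 10) {p : RYSpace ℓ} (hp : ‖p.snd‖ ≤ 1)
    (h : i.ratio p.snd ≤ p.fst) : i.pert p = 0 := by
  have h1 : i.u (i.toOrig p) = coneSlope n m * (i.toOrig p).fst :=
    i.isNearCone.eq_cone _ (i.toOrig_snd_notMem hτ₀ hp) (by
      rw [toOrig_snd, toOrig_fst, ← ratio_mul_scale]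
      exact mul_le_mul_of_nonneg_left h i.scale_pos.le)
  rw [pert, rescale]
  change i.scale⁻¹ * (i.u (i.toOrig p) - coneSlope n m * (i.toOrig p).fst) = 0
  rw [h1, sub_self, mul_zero]

theorem norm_fderiv_pert_le (hτ₀ : τ₀ ≤ 1 / 10) {p : RYSpace ℓ} (hp : p ∈ unitCylinder ℓ) :
    ‖fderiv ℝ i.pert p‖ ≤ 2 * τ₀ := by
  rw [pert, fderiv_rescale _ _ _ i.scale_pos.ne']
  refine (i.isNearCone.grad_small (i.toOrig p) (i.toOrig_snd_notMem hτ₀ hp.2.le)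
    (i.quarter_lt_toOrig_fst hτ₀ hp)).le.trans ?_
  have h1 := (i.height_lt (i.toOrig p).snd)
  have h2 := i.height_nonneg (i.toOrig p).snd
  have h3 : i.h (i.toOrig p).snd ^ 2 ≤ i.h (i.toOrig p).snd := by nlinarith
  calc _ ≤ 1 * i.h (i.toOrig p).snd :=
        mul_le_mul i.tau_le h3 (sq_nonneg _) zero_le_one
    _ ≤ _ := by linarith

theorem abs_pert_le (hτ₀ : τ₀ ≤ 1 / 10) {p : RYSpace ℓ} (hp : p ∈ unitCylinder ℓ) :
    |i.pert p| ≤ 2 * τ₀ := by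
  have h0 := i.h₀_lt.le.trans' i.h₀_pos.le
  have hr := (i.ratio_bounds hτ₀ hp.2.le).2
  rcases le_or_gt (11 / 10) p.fst with h | h
  · rw [i.pert_eq_zero hτ₀ hp.2.le (by linarith), abs_zero]; positivity
  · -- compare with the point at the level `11/10`, where the perturbation vanishes
    let p' : RYSpace ℓ := WithLp.toLp 2 ((11 / 10 : ℝ), p.snd)
    have hp' : p' ∈ unitCylinder ℓ := ⟨by change (13 / 50 : ℝ) < 11 / 10; norm_num, hp.2⟩
    have h1 := (convex_unitCylinder ℓ).norm_image_sub_le_of_norm_fderiv_le (𝕜 := ℝ) (f := i.pert)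
      (fun x hx => ((i.contDiffOn_pert hτ₀).contDiffAt
        ((isOpen_unitCylinder ℓ).mem_nhds hx)).differentiableAt (by simp))
      (fun x hx => i.norm_fderiv_pert_le hτ₀ hx) hp' hp
    rw [i.pert_eq_zero hτ₀ (p := p') hp.2.le (by change i.ratio p.snd ≤ 11 / 10; linarith),
      sub_zero, Real.norm_eq_abs] at h1
    have h2 : ‖p - p'‖ ≤ 1 := by
      rw [WithLp.prod_norm_eq_of_L2]
      have e1 : (p - p').fst = p.fst - 11 / 10 := rfl
      have e2 : (p - p').snd = 0 := sub_self p.snd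
      rw [e1, e2, norm_zero, Real.norm_eq_abs, sq_abs]
      refine Real.sqrt_le_iff.2 ⟨zero_le_one, ?_⟩
      nlinarith [hp.1]
    exact h1.trans (mul_le_of_le_one_right (by positivity) h2)

/-- The rescaled perturbation, cut off to a function on the whole space. -/
noncomputable def cutPert (ψ : RYSpace ℓ → ℝ) (p : RYSpace ℓ) : ℝ := ψ p * i.pert p

/-- The cut off perturbations are small to every order in the height, uniformly in the data, and in
`C¹` they are as small as `τ₀` with a constant `M` that depends only on the dimension. -/
theorem exists_cutPert (n m ℓ : ℕ) : ∃ ψ : RYSpace ℓ → ℝ, ∃ M : ℝ, 0 < M ∧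
    ∀ (τ₀ : ℝ) (B c : ℕ → ℕ → ℝ), τ₀ ≤ 1 / 10 →
    (∀ J, UnifSmoothOn Set.univ (fun i : PointedData n m ℓ τ₀ B c => i.weight J)
      fun i => i.cutPert ψ) ∧
    (∀ (i : PointedData n m ℓ τ₀ B c) p, |i.cutPert ψ p| ≤ M * τ₀) ∧
    (∀ (i : PointedData n m ℓ τ₀ B c) p, ‖fderiv ℝ (i.cutPert ψ) p‖ ≤ M * τ₀) ∧
    (∀ (i : PointedData n m ℓ τ₀ B c) (p : RYSpace ℓ),
      29 / 100 ≤ p.fst → p.fst ≤ 27 / 10 → ‖p.snd‖ ≤ 3 / 4 → i.cutPert ψ p = i.pert p) := by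
  obtain ⟨ψ, hψ, hψ0, hψ1, hψ2, hψ3⟩ := exists_cutoff ℓ
  obtain ⟨D, hD0, hD⟩ := ((hψ Unit).fderiv isOpen_univ).norm_le fun _ => zero_le_one
  have hD : ∀ p, ‖fderiv ℝ ψ p‖ ≤ D := fun p => by simpa using hD () p trivial
  refine ⟨ψ, 2 * D + 2, by positivity, fun τ₀ B c hτ₀ => ?_⟩
  have O := isOpen_unitCylinder ℓ
  have hSΩ : {p : RYSpace ℓ | 27 / 100 ≤ p.fst ∧ ‖p.snd‖ ≤ 9 / 10} ⊆ unitCylinder ℓ :=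
    fun p hp => ⟨lt_of_lt_of_le (by norm_num) hp.1, lt_of_le_of_lt hp.2 (by norm_num)⟩
  have hS : IsClosed {p : RYSpace ℓ | 27 / 100 ≤ p.fst ∧ ‖p.snd‖ ≤ 9 / 10} :=
    (isClosed_le continuous_const (WithLp.fstL 2 ℝ ℝ (YSpace ℓ)).continuous).inter
      (isClosed_le (WithLp.sndL 2 ℝ ℝ (YSpace ℓ)).continuous.norm continuous_const)
  have hzero : ∀ (i : PointedData n m ℓ τ₀ B c),
      ∀ p ∉ {p : RYSpace ℓ | 27 / 100 ≤ p.fst ∧ ‖p.snd‖ ≤ 9 / 10}, i.cutPert ψ p = 0 :=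
    fun i p hp => by rw [cutPert, hψ3 p hp, zero_mul]
  refine ⟨fun J => ?_, fun i p => ?_, fun i p => ?_, fun i p h1 h2 h3 => ?_⟩
  · have h1 : UnifSmoothOn (unitCylinder ℓ) (fun i : PointedData n m ℓ τ₀ B c => i.weight J)
        fun i => i.pert :=
      ⟨fun i => i.contDiffOn_pert hτ₀, fun k => ⟨_, fun i p hp =>
        i.norm_iteratedFDeriv_pert_le hτ₀ J k hp⟩⟩
    exact (((hψ _).mono_set (Set.subset_univ _)).bdd_mul O (fun i => (i.weight_pos J).le)
      h1).univ_of_eq_zero (fun i => (i.weight_pos J).le) O hS hSΩ hzero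
  · have h0 := i.h₀_lt.le.trans' i.h₀_pos.le
    by_cases hp : p ∈ {p : RYSpace ℓ | 27 / 100 ≤ p.fst ∧ ‖p.snd‖ ≤ 9 / 10}
    · rw [cutPert, abs_mul, abs_of_nonneg (hψ0 p)]
      have := i.abs_pert_le hτ₀ (hSΩ hp)
      have h2 := mul_nonneg hD0 h0
      calc _ ≤ 1 * (2 * τ₀) := mul_le_mul (hψ1 p) this (abs_nonneg _) zero_le_one
        _ ≤ _ := by linarith
    · rw [hzero i p hp, abs_zero]; positivity
  · have h0 := i.h₀_lt.le.trans' i.h₀_pos.le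
    by_cases hp : p ∈ {p : RYSpace ℓ | 27 / 100 ≤ p.fst ∧ ‖p.snd‖ ≤ 9 / 10}
    · have hd := ((i.contDiffOn_pert hτ₀).contDiffAt (O.mem_nhds (hSΩ hp))).differentiableAt
        (by simp)
      have hdψ := (((hψ Unit).contDiff ()).differentiable (by simp)) p
      have e : fderiv ℝ (i.cutPert ψ) p = ψ p • fderiv ℝ i.pert p + i.pert p • fderiv ℝ ψ p :=
        (hdψ.hasFDerivAt.mul hd.hasFDerivAt).fderiv
      rw [e]
      refine (norm_add_le _ _).trans ?_
      rw [norm_smul, norm_smul, Real.norm_eq_abs, Real.norm_eq_abs, abs_of_nonneg (hψ0 p)]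
      have k1 : ψ p * ‖fderiv ℝ i.pert p‖ ≤ 1 * (2 * τ₀) :=
        mul_le_mul (hψ1 p) (i.norm_fderiv_pert_le hτ₀ (hSΩ hp)) (norm_nonneg _) zero_le_one
      have k2 : |i.pert p| * ‖fderiv ℝ ψ p‖ ≤ 2 * τ₀ * D :=
        mul_le_mul (i.abs_pert_le hτ₀ (hSΩ hp)) (hD p) (norm_nonneg _) (by positivity)
      linarith
    · have h1 : i.cutPert ψ =ᶠ[nhds p] fun _ => 0 :=
        Filter.eventuallyEq_of_mem (hS.isOpen_compl.mem_nhds hp) (hzero i)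
      rw [h1.fderiv_eq]
      simp only [fderiv_fun_const, Pi.zero_apply, norm_zero]
      positivity
  · rw [cutPert, hψ2 p h1 h2 h3, one_mul]

end PointedData

/-! ### The metric factor near a point of the domain -/

namespace PointedData
variable {n m ℓ : ℕ} {τ₀ : ℝ} {B c : ℕ → ℕ → ℝ} (i : PointedData n m ℓ τ₀ B c)

/-- The rescaled solution of the symmetric minimal surface equation. -/
noncomputable def soln : RYSpace ℓ → ℝ := rescale i.scale (yDir i.y) i.u

/-- The same data with another base point. -/
def move (y : YSpace ℓ) (hy : y ∉ i.K) : PointedData n m ℓ τ₀ B c :=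
  { i with y := y, notMem := hy }

theorem scale_move (z : YSpace ℓ) (hz : i.y + i.scale • z ∉ i.K) :
    (i.move _ hz).scale = i.scale * i.ratio z := (i.ratio_mul_scale z).symm

/-- Moving the base point rescales the rescaled solution by a ratio close to `1`. -/
theorem soln_move (z : YSpace ℓ) (hz : i.y + i.scale • z ∉ i.K) :
    (i.move _ hz).soln = rescale (i.ratio z) (yDir z) i.soln := by
  funext p
  have e : yDir (i.y + i.scale • z) + (i.scale * i.ratio z) • p =
      yDir i.y + i.scale • (yDir z + i.ratio z • p) := by
    rw [smul_add, smul_smul, ← add_assoc]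
    congr 1
    refine (WithLp.ofLp_injective 2) ?_
    simp [yDir]
  rw [soln, soln, rescale, rescale, rescale, scale_move, mul_inv, ← e, ← mul_assoc,
    mul_comm (i.ratio z)⁻¹]
  rfl

theorem perturbedCone_cutPert_eventuallyEq {ψ : RYSpace ℓ → ℝ}
    (hψ : ∀ p : RYSpace ℓ, 29 / 100 ≤ p.fst → p.fst ≤ 27 / 10 → ‖p.snd‖ ≤ 3 / 4 →
      i.cutPert ψ p = i.pert p) {p : RYSpace ℓ} (h1 : 29 / 100 < p.fst) (h2 : p.fst < 27 / 10)
    (h3 : ‖p.snd‖ < 3 / 4) :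
    perturbedCone (coneSlope n m) (i.cutPert ψ) =ᶠ[nhds p] i.soln := by
  have c1 := (WithLp.fstL 2 ℝ ℝ (YSpace ℓ)).continuous
  have c2 := (WithLp.sndL 2 ℝ ℝ (YSpace ℓ)).continuous
  filter_upwards [(isOpen_lt continuous_const c1).mem_nhds h1,
    (isOpen_lt c1 continuous_const).mem_nhds h2,
    (isOpen_lt c2.norm continuous_const).mem_nhds h3] with q k1 k2 k3
  rw [perturbedCone, hψ q (le_of_lt k1) (le_of_lt k2) (le_of_lt k3), pert, soln, rescale, rescale]
  have : (yDir i.y + i.scale • q).fst = i.scale * q.fst := i.toOrig_fst q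
  rw [this]
  have := i.scale_pos.ne'
  field_simp
  ring

/-- Where `u` solves the symmetric minimal surface equation, `f = 1` solves the equation for the
metric factor. -/
theorem metricRHS_soln_one (hτ₀ : τ₀ ≤ 1 / 10) {p : RYSpace ℓ} (h1 : 0 < p.fst)
    (h2 : ‖p.snd‖ ≤ 1) (h3 : p.fst < i.ratio p.snd / 2) : metricRHS n m i.soln p 1 = 0 := by
  have h := (i.isNearCone.sme (i.toOrig p) (i.toOrig_snd_notMem hτ₀ h2)
    (by rw [toOrig_fst]; exact mul_pos i.scale_pos h1) (by
      rw [toOrig_fst, toOrig_snd, ← ratio_mul_scale, mul_div_assoc]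
      exact mul_lt_mul_of_pos_left h3 i.scale_pos)).2
  refine metricRHS_one_of_smeOp_eq_zero ?_
  rw [soln, smeOp_rescale _ _ _ i.scale_pos.ne' rfl]
  change i.scale * smeOp n m i.u (i.toOrig p) = 0
  rw [h, mul_zero]

/-- The metric factor near each base point, in rescaled coordinates. The exponent `J` is the order
in `h` of the estimate; it does not affect the function, nor does the choice of the base point. -/
structure IsPointedFactor (F : ℕ → PointedData n m ℓ τ₀ B c → RYSpace ℓ → ℝ) : Prop where
  unifSmoothOn : ∀ J, UnifSmoothOn Set.univ (fun i : PointedData n m ℓ τ₀ B c => i.weight J)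
    fun i p => F J i p - 1
  lower_bound : ∀ J, ∃ c₁ : ℝ, 0 < c₁ ∧ ∀ i (p : RYSpace ℓ), p.fst < 2 → c₁ ≤ F J i p
  eq_one : ∀ J i (p : RYSpace ℓ), ‖p.snd‖ ≤ 1 / 2 → p.fst < i.ratio p.snd / 2 → F J i p = 1
  eqn : ∀ J i (p : RYSpace ℓ), 2 / 5 ≤ p.fst → p.fst < 2 → ‖p.snd‖ < 3 / 4 →
    fderiv ℝ (F J i) p (gradient i.soln p) = metricRHS n m i.soln p (F J i p)
  eq_move : ∀ J J' i (p : RYSpace ℓ) (hp : i.y + i.scale • p.snd ∉ i.K), ‖p.snd‖ ≤ 3 / 10 →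
    p.fst ≤ 19 / 10 →
    F J i p = F J' (i.move _ hp) (WithLp.toLp 2 ((i.ratio p.snd)⁻¹ * p.fst, 0))

/-- `exists_localMetricFactor` applied to all pointed data at once. That the factors agree for
neighbouring base points and for all orders `J` follows from `metricFactor_unique`. -/
theorem exists_isPointedFactor (ℓ : ℕ) (hn : 2 ≤ n) (hm : 2 ≤ m) :
    ∃ τ₀ : ℝ, 0 < τ₀ ∧ τ₀ ≤ 1 / 10 ∧ ∀ B c : ℕ → ℕ → ℝ,
    ∃ F : ℕ → PointedData n m ℓ τ₀ B c → RYSpace ℓ → ℝ, IsPointedFactor F := by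
  have hα := coneSlope_pos hn hm
  obtain ⟨ψ, M, hM, hψ⟩ := exists_cutPert n m ℓ
  refine ⟨min (1 / 10) (coneSlope n m / (20 * M)), by positivity, min_le_left _ _,
    fun B c => ?_⟩
  have hτM : M * min (1 / 10) (coneSlope n m / (20 * M)) ≤ coneSlope n m / 20 := by
    calc _ ≤ M * (coneSlope n m / (20 * M)) :=
          mul_le_mul_of_nonneg_left (min_le_right _ _) hM.le
      _ = _ := by field_simp
  have hτ₀ : min (1 / 10) (coneSlope n m / (20 * M)) ≤ 1 / 10 := min_le_left _ _
  generalize min (1 / 10) (coneSlope n m / (20 * M)) = τ₀ at hτM hτ₀ ⊢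
  obtain ⟨hW, hb0, hb1, hψe⟩ := hψ τ₀ B c hτ₀
  have hb0' := fun i p => (hb0 i p).trans hτM
  have hb1' := fun i p => (hb1 i p).trans hτM
  have hex := fun J => exists_localMetricFactor hn hm (hW J) (fun i => i.weight_pos J)
    (fun i => i.weight_le_one (by linarith) J) hb0' hb1'
  choose χ hχ1 hχ2 φ hφ hφ0 c₁ hc₁ hφc using hex
  have hFd : ∀ J i, Differentiable ℝ (fun p => 1 + i.weight J * φ J i p) := fun J i =>
    (((hφ J).contDiff i).differentiable (by simp)).const_mul _ |>.const_add _
  have hFf : ∀ J i p, fderiv ℝ (fun p => 1 + i.weight J * φ J i p) p =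
      i.weight J • fderiv ℝ (φ J i) p := fun J i p => by
    have := ((((hφ J).contDiff i).differentiable (by simp)) p).hasFDerivAt
    exact ((this.const_mul (i.weight J)).const_add 1).fderiv
  have hg1 : ∀ i : PointedData n m ℓ τ₀ B c, UnifSmoothOn Set.univ 1
      (fun _ : Unit => i.cutPert ψ) :=
    fun i => ((hW 0).mono_weight (fun i => (i.weight_pos 0).le) (c := 1) (w' := 1) (by
      simpa using fun i : PointedData n m ℓ τ₀ B c => i.weight_le_one (by linarith) 0)).reindex
      fun _ => i
  -- at the bottom, by comparison with the solution `1`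
  have hbot : ∀ J i (p : RYSpace ℓ), ‖p.snd‖ ≤ 1 / 2 → p.fst < i.ratio p.snd / 2 →
      1 + i.weight J * φ J i p = 1 := fun J i p h1 h2 => by
    rcases le_or_gt p.fst (3 / 10) with h3 | h3
    · rw [hφ0 J i p h3, mul_zero, add_zero]
    have hr := (i.ratio_bounds hτ₀ (h1.trans (by norm_num))).2
    have hcone : ∀ p' ∈ backwardCone (3 / 10) p, ‖p'.snd‖ < 3 / 4 ∧
        p'.fst < i.ratio p'.snd / 2 := fun p' hp' => by
      obtain ⟨k1, k2, k3⟩ := hp'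
      have k4 : ‖p'.snd‖ < 3 / 4 := by
        have := norm_le_norm_add_norm_sub' p'.snd p.snd
        linarith
      have k5 := i.abs_ratio_sub_le hτ₀ (k4.le.trans (by norm_num)) (h1.trans (by norm_num))
      have k6 := (abs_le.1 k5).1
      exact ⟨k4, by linarith⟩
    refine metricFactor_unique hn hm (hg1 i) (hb0' i) (hb1' i) (b := 3 / 10) (q := p) le_rfl h3.le
      (by linarith) (hχ1 J) (f₂ := fun _ => 1) (fun p' hp' => ⟨?_, hFd J i p', ?_⟩)
      (fun p' hp' => ⟨one_pos, differentiableAt_const _, ?_⟩) (fun p' hp' h => ?_)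
    · exact (hc₁ J).trans_le (hφc J i p' (by linarith [hp'.2.1])).1
    · rw [hFf]
      exact (hφc J i p' (by linarith [hp'.2.1])).2
    · obtain ⟨k1, k2⟩ := hcone p' hp'
      rw [metricRHS_congr (i.perturbedCone_cutPert_eventuallyEq (hψe i) (by linarith [hp'.1])
        (by linarith [hp'.2.1]) k1), i.metricRHS_soln_one hτ₀ (by linarith [hp'.1])
        (by linarith) k2]
      simp
    · rw [hφ0 J i p' h.le, mul_zero, add_zero]
  -- the cutoff `χ` is inactive from the level `2/5` on
  have heqn : ∀ J i (p : RYSpace ℓ), 2 / 5 ≤ p.fst → p.fst < 2 → ‖p.snd‖ < 3 / 4 →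
      fderiv ℝ (fun p => 1 + i.weight J * φ J i p) p (gradient i.soln p) =
        metricRHS n m i.soln p (1 + i.weight J * φ J i p) := fun J i p h1 h2 h3 => by
    have he := i.perturbedCone_cutPert_eventuallyEq (hψe i) (by linarith) (by linarith) h3
    have := (hφc J i p h2).2
    rw [hχ2 J _ h1 (by linarith), one_mul, gradient_congr he, metricRHS_congr he] at this
    rw [hFf]
    exact this
  refine ⟨fun J i p => 1 + i.weight J * φ J i p, fun J => ?_, fun J => ⟨c₁ J, hc₁ J, fun i p hp =>
    (hφc J i p hp).1⟩, hbot, heqn, fun J J' i p hp h1 h2 => ?_⟩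
  · have h1 : UnifSmoothOn Set.univ (fun i : PointedData n m ℓ τ₀ B c => i.weight J)
        (fun i (_ : RYSpace ℓ) => i.weight J) :=
      UnifSmoothOn.of_const (C := 1) fun i => by
        rw [Real.norm_eq_abs, abs_of_pos (i.weight_pos J), one_mul]
    simpa using h1.mul_bdd isOpen_univ (fun i => (i.weight_pos J).le) (hφ J)
  -- independence of the base point, by comparison above the level `21/50`
  set i' := i.move _ hp with hi'
  set ρ := i.ratio p.snd with hρ
  have hz1 : ‖p.snd‖ ≤ 1 := h1.trans (by norm_num)
  obtain ⟨r1, r2⟩ := i.ratio_bounds hτ₀ hz1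
  have hρ0 : 0 < ρ := i.ratio_pos hτ₀ hz1
  have hinv : ρ⁻¹ ≤ 50 / 49 := by
    rw [inv_le_comm₀ hρ0 (by norm_num)]; linarith
  have hinv' : 100 / 103 ≤ ρ⁻¹ := by
    rw [le_inv_comm₀ (by norm_num) hρ0]; linarith
  -- the change of coordinates from the base point of `i` to that of `i'`
  let A : RYSpace ℓ → RYSpace ℓ := fun p' => ρ⁻¹ • (p' - yDir p.snd)
  have hA1 : ∀ p', (A p').fst = ρ⁻¹ * p'.fst := fun p' => by simp [A, yDir]
  have hA2 : ∀ p', (A p').snd = ρ⁻¹ • (p'.snd - p.snd) := fun p' => by simp [A, yDir]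
  have hA3 : ∀ p', yDir p.snd + ρ • A p' = p' := fun p' => by
    simp only [A, smul_smul, mul_inv_cancel₀ hρ0.ne', one_smul, add_sub_cancel]
  have hA4 : ∀ p', A (yDir p.snd + ρ • p') = p' := fun p' => by
    simp only [A, add_sub_cancel_left, smul_smul, inv_mul_cancel₀ hρ0.ne', one_smul]
  have hAp : A p = WithLp.toLp 2 (ρ⁻¹ * p.fst, 0) := by
    refine (WithLp.ofLp_injective 2) (Prod.ext (hA1 p) ((hA2 p).trans ?_))
    rw [sub_self, smul_zero]
  have hF2bot : ∀ p' : RYSpace ℓ, ‖p'.snd - p.snd‖ ≤ 2 / 5 → p'.fst ≤ 21 / 50 →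
      1 + i'.weight J' * φ J' i' (A p') = 1 := fun p' k1 k2 => by
    have k3 : ‖(A p').snd‖ ≤ 1 / 2 := by
      rw [hA2, norm_smul, norm_inv, Real.norm_eq_abs, abs_of_pos hρ0]
      calc _ ≤ 50 / 49 * (2 / 5) := mul_le_mul hinv k1 (norm_nonneg _) (by norm_num)
        _ ≤ _ := by norm_num
    refine hbot J' i' _ k3 ?_
    have := (i'.ratio_bounds hτ₀ (k3.trans (by norm_num))).1
    rw [hA1]
    have k4 : ρ⁻¹ * p'.fst ≤ ρ⁻¹ * (21 / 50) := mul_le_mul_of_nonneg_left k2 (inv_pos.2 hρ0).le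
    linarith
  rw [← hAp]
  rcases le_or_gt p.fst (21 / 50) with h3 | h3
  · rw [hF2bot p (by rw [sub_self, norm_zero]; norm_num) h3, hbot J i p (by linarith) (by linarith)]
  have hs1 : ∀ p' ∈ backwardCone (21 / 50) p, ‖p'.snd - p.snd‖ ≤ 9 / 100 := fun p' hp' => by
    linarith [hp'.1, hp'.2.2]
  have hs2 : ∀ p' ∈ backwardCone (21 / 50) p, ‖p'.snd‖ ≤ 39 / 100 := fun p' hp' => by
    have := norm_le_norm_add_norm_sub' p'.snd p.snd
    linarith [hs1 p' hp']
  refine metricFactor_unique hn hm (hg1 i) (hb0' i) (hb1' i) (b := 21 / 50) (q := p) (by norm_num)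
    h3.le (by linarith) (χ := fun _ => 1) (f₂ := fun p' => 1 + i'.weight J' * φ J' i' (A p'))
    (by simp) (fun p' hp' => ⟨?_, hFd J i p', ?_⟩)
    (fun p' hp' => ⟨?_, ?_, ?_⟩) (fun p' hp' h => ?_)
  · exact (hc₁ J).trans_le (hφc J i p' (by linarith [hp'.2.1])).1
  · have he := i.perturbedCone_cutPert_eventuallyEq (hψe i) (p := p') (by linarith [hp'.1])
      (by linarith [hp'.2.1]) (by linarith [hs2 p' hp'])
    rw [one_mul, gradient_congr he, metricRHS_congr he]
    exact heqn J i p' (by linarith [hp'.1]) (by linarith [hp'.2.1]) (by linarith [hs2 p' hp'])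
  · refine (hc₁ J').trans_le (hφc J' i' (A p') ?_).1
    rw [hA1]
    calc ρ⁻¹ * p'.fst ≤ 50 / 49 * (19 / 10) :=
          mul_le_mul hinv (hp'.2.1.trans h2) (by linarith [hp'.1]) (by norm_num)
      _ < 2 := by norm_num
  · have : Differentiable ℝ A := by
      change Differentiable ℝ fun p' => ρ⁻¹ • (p' - yDir p.snd)
      fun_prop
    exact (hFd J' i').differentiableAt.comp p' this.differentiableAt
  · have he := i.perturbedCone_cutPert_eventuallyEq (hψe i) (p := p') (by linarith [hp'.1])
      (by linarith [hp'.2.1]) (by linarith [hs2 p' hp'])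
    rw [one_mul, gradient_congr he, metricRHS_congr he]
    have k1 : 2 / 5 ≤ (A p').fst := by
      rw [hA1]
      calc (2 / 5 : ℝ) ≤ 100 / 103 * (21 / 50) := by norm_num
        _ ≤ _ := mul_le_mul hinv' hp'.1 (by norm_num) (by positivity)
    have k2 : (A p').fst < 2 := by
      rw [hA1]
      calc ρ⁻¹ * p'.fst ≤ 50 / 49 * (19 / 10) :=
            mul_le_mul hinv (hp'.2.1.trans h2) (by linarith [hp'.1]) (by norm_num)
        _ < 2 := by norm_num
    have k3 : ‖(A p').snd‖ < 3 / 4 := by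
      rw [hA2, norm_smul, norm_inv, Real.norm_eq_abs, abs_of_pos hρ0]
      calc _ ≤ 50 / 49 * (9 / 100) := mul_le_mul hinv (hs1 p' hp') (norm_nonneg _) (by norm_num)
        _ < _ := by norm_num
    have k4 := heqn J' i' (A p') k1 k2 k3
    have k5 : i'.soln = rescale ρ (yDir p.snd) i.soln := i.soln_move _ hp
    have k6 := fderiv_comp_add_smul_gradient_rescale (yDir p.snd) i.soln
      (fun p' => 1 + i'.weight J' * φ J' i' (A p')) (A p') hρ0.ne'
    simp only [hA4, hA3] at k6
    rw [k5, metricRHS_rescale _ _ _ hρ0.ne' rfl, k6, hA3] at k4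
    exact mul_left_cancel₀ hρ0.ne' k4
  · rw [hF2bot p' (by linarith [hs1 p' hp']) h.le]
    refine hbot J i p' (by linarith [hs2 p' hp']) ?_
    have := (i.ratio_bounds hτ₀ (z := p'.snd) (by linarith [hs2 p' hp'])).1
    linarith

end PointedData

/-! ### The profile over the cone -/

/-- Over the exact cone `u = α r` the equation for `f(r)` integrates: with `a = α²` and a suitable
exponent `κ`, the function `r^β * coneProfile a κ (f r)` is constant. -/
noncomputable def coneProfile (a κ f : ℝ) : ℝ := (f - 1) * (1 + a * f) ^ (-κ)

/-- The derivative of `coneProfile`. -/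
noncomputable def coneProfileDeriv (a κ f : ℝ) : ℝ :=
  (1 + κ * a + a * (1 - κ) * f) * (1 + a * f) ^ (-κ - 1)

section profile
variable {a κ f : ℝ}

theorem hasDerivAt_coneProfile (h : 0 < 1 + a * f) :
    HasDerivAt (coneProfile a κ) (coneProfileDeriv a κ f) f := by
  have h1 : HasDerivAt (fun f => 1 + a * f) a f := by
    simpa using ((hasDerivAt_id f).const_mul a).const_add 1
  have h2 := ((hasDerivAt_id f).sub_const 1).mul (h1.rpow_const (p := -κ) (Or.inl h.ne'))
  refine h2.congr_deriv ?_
  have h3 : (1 + a * f) ^ (-κ) = (1 + a * f) * (1 + a * f) ^ (-κ - 1) := by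
    rw [mul_comm (1 + a * f), ← Real.rpow_add_one h.ne', sub_add_cancel]
  rw [h3, coneProfileDeriv]
  simp only [id]
  ring

theorem coneProfileDeriv_pos (ha : 0 < a) (hκ0 : 0 < κ) (hκ1 : κ < 1) (hf : 0 ≤ f) :
    0 < coneProfileDeriv a κ f := by
  have : 0 < 1 - κ := by linarith
  rw [coneProfileDeriv]
  positivity

theorem strictMonoOn_coneProfile (ha : 0 < a) (hκ0 : 0 < κ) (hκ1 : κ < 1) :
    StrictMonoOn (coneProfile a κ) (Set.Ici 0) := by
  have hd : ∀ f ∈ Set.Ici (0 : ℝ), HasDerivAt (coneProfile a κ) (coneProfileDeriv a κ f) f :=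
    fun f hf => hasDerivAt_coneProfile (by have := mul_nonneg ha.le hf; linarith)
  refine strictMonoOn_of_deriv_pos (convex_Ici 0)
    (fun f hf => (hd f hf).continuousAt.continuousWithinAt) fun f hf => ?_
  rw [(hd f (interior_subset hf)).deriv]
  exact coneProfileDeriv_pos ha hκ0 hκ1 (interior_subset hf)

theorem coneProfile_zero : coneProfile a κ 0 = -1 := by simp [coneProfile]

theorem coneProfile_one : coneProfile a κ 1 = 0 := by simp [coneProfile]

theorem neg_one_lt_coneProfile (ha : 0 < a) (hκ0 : 0 < κ) (hκ1 : κ < 1) (hf : 0 < f) :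
    -1 < coneProfile a κ f := by
  rw [← coneProfile_zero (a := a) (κ := κ)]
  exact strictMonoOn_coneProfile ha hκ0 hκ1 Set.self_mem_Ici hf.le hf

theorem tendsto_coneProfile_atTop (ha : 0 < a) (hκ1 : κ < 1) :
    Filter.Tendsto (coneProfile a κ) Filter.atTop Filter.atTop := by
  have h1 : Filter.Tendsto (fun f : ℝ => (2 * (1 + a))⁻¹ * (1 + a * f) ^ (1 - κ)) Filter.atTop
      Filter.atTop := by
    refine ((tendsto_rpow_atTop (by linarith : 0 < 1 - κ)).comp ?_).const_mul_atTop (by positivity)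
    exact Filter.tendsto_atTop_add_const_left _ _ (Filter.tendsto_id.const_mul_atTop ha)
  refine Filter.tendsto_atTop_mono' _ ?_ h1
  filter_upwards [Filter.eventually_ge_atTop 2] with f hf
  have h2 : 0 < 1 + a * f := by positivity
  have h3 : (1 + a * f) ^ (1 - κ) = (1 + a * f) * (1 + a * f) ^ (-κ) := by
    rw [mul_comm (1 + a * f), ← Real.rpow_add_one h2.ne', neg_add_eq_sub]
  rw [h3, coneProfile, ← mul_assoc]
  refine mul_le_mul_of_nonneg_right ?_ (Real.rpow_pos_of_pos h2 _).le
  rw [inv_mul_le_iff₀ (by positivity)]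
  nlinarith

theorem contDiffAt_coneProfile (h : 0 < 1 + a * f) : ContDiffAt ℝ ∞ (coneProfile a κ) f := by
  have h1 : ContDiffAt ℝ ∞ (fun f : ℝ => 1 + a * f) f :=
    contDiffAt_const.add (contDiffAt_const.mul contDiffAt_id)
  exact (contDiffAt_id.sub contDiffAt_const).mul (h1.rpow_const_of_ne h.ne')

/-- The inverse of `coneProfile`. -/
theorem exists_coneProfile_inverse (ha : 0 < a) (hκ0 : 0 < κ) (hκ1 : κ < 1) :
    ∃ Ψ : ℝ → ℝ, (∀ f, 0 < f → Ψ (coneProfile a κ f) = f) ∧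
      (∀ x, -1 < x → 0 < Ψ x ∧ coneProfile a κ (Ψ x) = x) ∧
      ContDiffOn ℝ ∞ Ψ (Set.Ioi (-1)) := by
  have hmono := strictMonoOn_coneProfile ha hκ0 hκ1
  have hsurj : ∀ x : ℝ, ∃ f, -1 < x → 0 < f ∧ coneProfile a κ f = x := fun x => by
    by_cases hx : -1 < x
    · obtain ⟨N, hN0, hN⟩ := ((Filter.eventually_ge_atTop 0).and
        ((tendsto_coneProfile_atTop ha hκ1).eventually_ge_atTop x)).exists
      obtain ⟨f, hf, he⟩ := intermediate_value_Icc (f := coneProfile a κ) hN0 (fun f hf =>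
        (hasDerivAt_coneProfile (by have := mul_nonneg ha.le hf.1; linarith)
          ).continuousAt.continuousWithinAt)
          (show x ∈ _ from ⟨by rw [coneProfile_zero]; exact hx.le, hN⟩)
      refine ⟨f, fun _ => ⟨hf.1.lt_of_ne fun h0 => ?_, he⟩⟩
      rw [← h0, coneProfile_zero] at he
      exact hx.ne he
    · exact ⟨0, fun h => absurd h hx⟩
  choose Ψ hΨ using hsurj
  have hleft : ∀ f, 0 < f → Ψ (coneProfile a κ f) = f := fun f hf => by
    obtain ⟨h1, h2⟩ := hΨ _ (neg_one_lt_coneProfile ha hκ0 hκ1 hf)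
    exact hmono.injOn h1.le hf.le h2
  refine ⟨Ψ, hleft, hΨ, fun x hx => ContDiffAt.contDiffWithinAt ?_⟩
  obtain ⟨h1, h2⟩ := hΨ x hx
  have hpos : 0 < 1 + a * Ψ x := by positivity
  have hc := contDiffAt_coneProfile (κ := κ) hpos
  have hd := (hasDerivAt_coneProfile (κ := κ) hpos)
  have hd0 := (coneProfileDeriv_pos ha hκ0 hκ1 h1.le).ne'
  have hf' := hd.hasFDerivAt_equiv hd0
  have hs := hc.hasStrictFDerivAt' hf' (by simp)
  have hloc := hc.to_localInverse hf' (by simp)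
  rw [h2] at hloc
  refine hloc.congr_of_eventuallyEq ?_
  have e1 := hs.eventually_right_inverse
  have e2 := hs.localInverse_continuousAt
  rw [h2] at e1 e2
  have e3 : hs.localInverse _ _ _ x = Ψ x := by
    have := hs.localInverse_apply_image
    rwa [h2] at this
  have e4 : ∀ᶠ z in nhds x, 0 < hs.localInverse _ _ _ z :=
    e2.eventually (by rw [e3]; exact lt_mem_nhds h1)
  filter_upwards [e1, e4] with z hz1 hz2
  rw [← hz1, hleft _ hz2]
  exact congrArg _ hz1.symm
end profile

/-- The exponent of the profile over the cone. -/
noncomputable def coneExponent (n m : ℕ) : ℝ := (m * (1 + coneSlope n m ^ 2) + 1)⁻¹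

theorem coneExponent_pos (n m : ℕ) : 0 < coneExponent n m := by
  rw [coneExponent]; positivity

theorem coneExponent_lt_one {n m : ℕ} (hm : 1 ≤ m) : coneExponent n m < 1 := by
  have : (1 : ℝ) ≤ m := mod_cast hm
  rw [coneExponent]
  exact inv_lt_one_of_one_lt₀ (by nlinarith [sq_nonneg (coneSlope n m)])

theorem decayRate_pos {n m : ℕ} (hn : 2 ≤ n) : 0 < decayRate n m := by
  have : (2 : ℝ) ≤ n := mod_cast hn
  have : 0 < (n : ℝ) - 1 := by linarith
  rw [decayRate]; positivity

/-- The equation for `f` over the cone is `r * D_r (coneProfile f) = -β * coneProfile f`. -/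
theorem coneProfileDeriv_mul {n m : ℕ} (hm : 1 ≤ m) {f : ℝ} (hf : 0 < f) :
    coneProfileDeriv (coneSlope n m ^ 2) (coneExponent n m) f *
      (2 * (n - 1) * ((1 - f) * (1 + coneSlope n m ^ 2 * f)) /
        (m * (1 + coneSlope n m ^ 2 * f) + 1)) =
    -(decayRate n m * coneProfile (coneSlope n m ^ 2) (coneExponent n m) f) := by
  have hm0 : (1 : ℝ) ≤ m := mod_cast hm
  set a := coneSlope n m ^ 2 with ha
  have ha0 : 0 ≤ a := sq_nonneg _
  have h1 : 0 < 1 + a * f := by positivity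
  have h3 : (1 + a * f) ^ (-coneExponent n m) =
      (1 + a * f) * (1 + a * f) ^ (-coneExponent n m - 1) := by
    rw [mul_comm (1 + a * f), ← Real.rpow_add_one h1.ne', sub_add_cancel]
  rw [coneProfileDeriv, coneProfile, h3, decayRate, ← ha]
  generalize (1 + a * f) ^ (-coneExponent n m - 1) = X
  rw [coneExponent, ← ha]
  have h4 : (m : ℝ) * (1 + a) + 1 ≠ 0 := by positivity
  have h5 : (m : ℝ) * (1 + a * f) + 1 ≠ 0 := by positivity
  have h6 : 1 + a ≠ 0 := by positivity
  have h7 : (m : ℝ) + (1 + a)⁻¹ ≠ 0 := by positivity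
  field_simp
  ring

/-- The equation for the metric factor over the cone. -/
theorem metricRHS_cone {ℓ n m : ℕ} (hn : 2 ≤ n) (hm : 2 ≤ m) {u : RYSpace ℓ → ℝ} {q : RYSpace ℓ}
    (hq : 0 < q.fst) (hu : u =ᶠ[nhds q] fun q => coneSlope n m * q.fst) {f : ℝ} (hf : 0 < f) :
    gradient u q = coneSlope n m • radialDir ℓ ∧
    metricRHS n m u q f = coneSlope n m * ((2 * (n - 1) * ((1 - f) * (1 + coneSlope n m ^ 2 * f)) /
        (m * (1 + coneSlope n m ^ 2 * f) + 1)) / q.fst) := by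
  have hα := coneSlope_pos hn hm
  have hα2 := coneSlope_sq hn hm
  have hu' : u =ᶠ[nhds q] perturbedCone (coneSlope n m) (fun _ => 0) := by
    simpa [Filter.EventuallyEq, perturbedCone] using hu
  have h0 : ContDiff ℝ ∞ (fun _ : RYSpace ℓ => (0 : ℝ)) := contDiff_const
  have hg0 : gradient (fun _ : RYSpace ℓ => (0 : ℝ)) q = 0 := by simp [gradient]
  have hD : fderiv ℝ (fun _ : RYSpace ℓ => (0 : ℝ)) = 0 := by
    funext x; simp
  have hDD : fderiv ℝ (fderiv ℝ (fun _ : RYSpace ℓ => (0 : ℝ))) q = 0 := by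
    rw [hD]; exact fderiv_const_apply 0
  have hgr : gradient u q = coneSlope n m • radialDir ℓ := by
    rw [gradient_congr hu', gradient_perturbedCone h0, hg0, add_zero]
  refine ⟨hgr, ?_⟩
  have hH : hessQuad u q = 0 := by
    rw [hessQuad_congr hu', hessQuad_perturbedCone h0, hDD]; rfl
  have hL : radialLaplacian n u q = (n - 1) / q.fst * coneSlope n m := by
    rw [radialLaplacian_congr hu', radialLaplacian, laplacian_perturbedCone h0,
      fderiv_perturbedCone_radialDir h0, hDD, hD]
    simp
  have hw : ((m : ℝ) - 1) / u q = (n - 1) / q.fst * coneSlope n m := by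
    rw [hu.eq_of_nhds, ← hα2]
    field_simp
  rw [metricRHS, hH, hL, hw, hgr, norm_smul, norm_radialDir, mul_one, Real.norm_eq_abs, sq_abs,
    metricNum, metricDen]
  have h5 : (m : ℝ) * (1 + f * coneSlope n m ^ 2) + 1 ≠ 0 := by positivity
  have h6 : (m : ℝ) * (1 + coneSlope n m ^ 2 * f) + 1 ≠ 0 := by positivity
  field_simp
  ring

/-- Along rays over the cone, `f` solves the equation exactly when `r^β * coneProfile f` is
stationary. -/
theorem hasDerivAt_rpow_mul_coneProfile {n m : ℕ} {f : ℝ → ℝ} {f' r : ℝ} (hr : 0 < r)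
    (hf : 0 < f r) (hf' : HasDerivAt f f' r) :
    HasDerivAt (fun r => r ^ decayRate n m *
        coneProfile (coneSlope n m ^ 2) (coneExponent n m) (f r))
      (r ^ decayRate n m * (decayRate n m / r *
        coneProfile (coneSlope n m ^ 2) (coneExponent n m) (f r) +
        coneProfileDeriv (coneSlope n m ^ 2) (coneExponent n m) (f r) * f')) r := by
  have h1 := (hasDerivAt_coneProfile (a := coneSlope n m ^ 2) (κ := coneExponent n m) (f := f r)
    (by positivity)).comp r hf'
  have h2 := (Real.hasDerivAt_rpow_const (p := decayRate n m) (Or.inl hr.ne')).mul h1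
  refine h2.congr_deriv ?_
  rw [Real.rpow_sub_one hr.ne']
  simp only [Function.comp]
  ring

/-! ### The global metric factor -/

namespace PointedData
variable {n m ℓ : ℕ} {τ₀ : ℝ} {B c : ℕ → ℕ → ℝ} (i : PointedData n m ℓ τ₀ B c)

/-- Over the base point, at height `s` in rescaled coordinates. -/
def axisPoint (ℓ : ℕ) (s : ℝ) : RYSpace ℓ := WithLp.toLp 2 (s, 0)

/-- `coneProfile` with the constants of the problem. -/
noncomputable def profile (n m : ℕ) : ℝ → ℝ := coneProfile (coneSlope n m ^ 2) (coneExponent n m)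

theorem hasDerivAt_axisPoint (ℓ : ℕ) (s : ℝ) :
    HasDerivAt (fun s => axisPoint ℓ s) (radialDir ℓ) s := by
  have : (fun s => axisPoint ℓ s) = fun s => s • radialDir ℓ := by
    funext s
    refine (WithLp.ofLp_injective 2) ?_
    simp [axisPoint, radialDir]
  rw [this]
  simpa using (hasDerivAt_id s).smul_const (radialDir ℓ)

open Classical in
/-- The metric factor on the whole domain: near the set where it starts to differ from `1` it is
read off from the factor of the base point below, and further out it is continued by the
explicit solution over the cone, `Ψ` being the inverse of the profile. The definition does not
involve the base point of `i`. -/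
noncomputable def globalFactor (F : ℕ → PointedData n m ℓ τ₀ B c → RYSpace ℓ → ℝ) (Ψ : ℝ → ℝ)
    (q : RYSpace ℓ) : ℝ :=
  if hq : q.snd ∉ i.K then
    if q.fst ≤ 3 / 2 * i.h q.snd ^ 2 then
      F 0 (i.move _ hq) (axisPoint ℓ (q.fst / i.h q.snd ^ 2))
    else
      Ψ ((11 / 10 / (q.fst / i.h q.snd ^ 2)) ^ decayRate n m *
        profile n m (F 0 (i.move _ hq) (axisPoint ℓ (11 / 10))))
  else 1

/-- From the level `11/10` on the rescaled solution is the cone. -/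
theorem soln_eventuallyEq_cone (hτ₀ : τ₀ ≤ 1 / 10) {p : RYSpace ℓ} (h1 : 11 / 10 ≤ p.fst)
    (h2 : ‖p.snd‖ < 1) : i.soln =ᶠ[nhds p] fun p => coneSlope n m * p.fst := by
  have c1 := (WithLp.fstL 2 ℝ ℝ (YSpace ℓ)).continuous
  have c2 := (WithLp.sndL 2 ℝ ℝ (YSpace ℓ)).continuous
  filter_upwards [(isOpen_lt continuous_const c1).mem_nhds (lt_of_lt_of_le (by norm_num) h1 :
    (103 / 100 : ℝ) < p.fst), (isOpen_lt c2.norm continuous_const).mem_nhds h2] with q k1 k2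
  have k3 : (103 / 100 : ℝ) < q.fst := k1
  have k4 : ‖q.snd‖ < 1 := k2
  have h := i.pert_eq_zero hτ₀ k4.le ((i.ratio_bounds hτ₀ k4.le).2.trans k3.le)
  rw [pert, rescale, mul_eq_zero, or_iff_right (inv_ne_zero i.scale_pos.ne'), sub_eq_zero] at h
  rw [soln, rescale, h]
  have : (yDir i.y + i.scale • q).fst = i.scale * q.fst := i.toOrig_fst q
  rw [this]
  have := i.scale_pos.ne'
  field_simp

section factor
variable {F : ℕ → PointedData n m ℓ τ₀ B c → RYSpace ℓ → ℝ} {Ψ : ℝ → ℝ}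

theorem IsPointedFactor.contDiff (hF : IsPointedFactor F) (J : ℕ) (i) : ContDiff ℝ ∞ (F J i) := by
  have := ((hF.unifSmoothOn J).contDiff i).add (contDiff_const (c := (1 : ℝ)))
  simpa using this

theorem IsPointedFactor.pos (hF : IsPointedFactor F) (J : ℕ) (i) {p : RYSpace ℓ}
    (hp : p.fst < 2) : 0 < F J i p := by
  obtain ⟨c₁, h1, h2⟩ := hF.lower_bound J
  exact h1.trans_le (h2 i p hp)

/-- The decay law along the axis, on the part of the cone where the local factor is defined. -/
theorem IsPointedFactor.profile_axis (hF : IsPointedFactor F) (hn : 2 ≤ n) (hm : 2 ≤ m)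
    (hτ₀ : τ₀ ≤ 1 / 10) (J : ℕ) (i : PointedData n m ℓ τ₀ B c) {s : ℝ} (h1 : 11 / 10 ≤ s)
    (h2 : s ≤ 19 / 10) :
    profile n m (F J i (axisPoint ℓ s)) =
      (11 / 10 / s) ^ decayRate n m * profile n m (F J i (axisPoint ℓ (11 / 10))) := by
  have hα := coneSlope_pos hn hm
  have hder : ∀ s ∈ Set.Icc (11 / 10 : ℝ) (19 / 10), HasDerivAt (fun s =>
      s ^ decayRate n m * profile n m (F J i (axisPoint ℓ s))) 0 s := fun s hs => by
    have hs0 : 0 < s := by linarith [hs.1]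
    have hpos : 0 < F J i (axisPoint ℓ s) := hF.pos J i (show s < 2 by linarith [hs.2])
    have hd := (((hF.contDiff J i).differentiable (by simp)) (axisPoint ℓ s)
      ).hasFDerivAt.comp_hasDerivAt s (hasDerivAt_axisPoint ℓ s)
    have heq := hF.eqn J i (axisPoint ℓ s) (show (2 / 5 : ℝ) ≤ s by linarith [hs.1])
      (show s < 2 by linarith [hs.2]) (show ‖(0 : YSpace ℓ)‖ < 3 / 4 by simp)
    obtain ⟨e1, e2⟩ := metricRHS_cone hn hm (q := axisPoint ℓ s) (show 0 < s from hs0)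
      (i.soln_eventuallyEq_cone hτ₀ (p := axisPoint ℓ s) hs.1
        (show ‖(0 : YSpace ℓ)‖ < 1 by simp)) hpos
    rw [e1, e2, map_smul, smul_eq_mul] at heq
    have heq := mul_left_cancel₀ hα.ne' heq
    have hD := hasDerivAt_rpow_mul_coneProfile (n := n) (m := m)
      (f := fun s => F J i (axisPoint ℓ s)) hs0 hpos hd
    refine hD.congr_deriv ?_
    have key := coneProfileDeriv_mul (n := n) (m := m) (by omega) hpos
    have h3 : (axisPoint ℓ s).fst = s := rfl
    rw [heq, h3, ← mul_div_assoc, key]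
    ring
  have hconst := constant_of_has_deriv_right_zero
    (fun s hs => (hder s hs).continuousAt.continuousWithinAt)
    (fun s hs => (hder s ⟨hs.1, hs.2.le⟩).hasDerivWithinAt) s ⟨h1, h2⟩
  have hs0 : 0 < s := by linarith
  have hsβ := Real.rpow_pos_of_pos hs0 (decayRate n m)
  rw [Real.div_rpow (by norm_num) hs0.le, div_mul_eq_mul_div, eq_div_iff hsβ.ne', mul_comm]
  exact hconst

/-- The properties of the inverse of the profile. -/
structure IsProfileInverse (n m : ℕ) (Ψ : ℝ → ℝ) : Prop where
  left_inv : ∀ f, 0 < f → Ψ (profile n m f) = f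
  right_inv : ∀ x, -1 < x → 0 < Ψ x ∧ profile n m (Ψ x) = x
  contDiffOn : ContDiffOn ℝ ∞ Ψ (Set.Ioi (-1))

theorem exists_isProfileInverse (hn : 2 ≤ n) (hm : 2 ≤ m) : ∃ Ψ, IsProfileInverse n m Ψ := by
  obtain ⟨Ψ, h1, h2, h3⟩ := exists_coneProfile_inverse (pow_pos (coneSlope_pos hn hm) 2)
    (coneExponent_pos n m) (coneExponent_lt_one (by omega))
  exact ⟨Ψ, h1, h2, h3⟩

theorem axisPoint_snd_move {p : RYSpace ℓ} :
    (WithLp.toLp 2 ((i.ratio p.snd)⁻¹ * p.fst, 0) : RYSpace ℓ) =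
      axisPoint ℓ (p.fst / i.ratio p.snd) := by
  rw [axisPoint, div_eq_inv_mul]

theorem toOrig_fst_div (hτ₀ : τ₀ ≤ 1 / 10) {p : RYSpace ℓ} (hp : ‖p.snd‖ ≤ 1) :
    (i.toOrig p).fst / i.h (i.toOrig p).snd ^ 2 = p.fst / i.ratio p.snd := by
  have h1 := i.scale_pos.ne'
  have h2 := (i.ratio_pos hτ₀ hp).ne'
  rw [toOrig_fst, toOrig_snd, ← ratio_mul_scale]
  field_simp

/-- The global factor in the rescaled coordinates of a nearby base point. -/
theorem globalFactor_toOrig (F : ℕ → PointedData n m ℓ τ₀ B c → RYSpace ℓ → ℝ) (Ψ : ℝ → ℝ)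
    (hτ₀ : τ₀ ≤ 1 / 10) {p : RYSpace ℓ} (hp : ‖p.snd‖ ≤ 1)
    (hz : i.y + i.scale • p.snd ∉ i.K) :
    i.globalFactor F Ψ (i.toOrig p) =
      if p.fst / i.ratio p.snd ≤ 3 / 2 then F 0 (i.move _ hz) (axisPoint ℓ (p.fst / i.ratio p.snd))
      else Ψ ((11 / 10 / (p.fst / i.ratio p.snd)) ^ decayRate n m *
        profile n m (F 0 (i.move _ hz) (axisPoint ℓ (11 / 10)))) := by
  have h1 := i.toOrig_snd_notMem hτ₀ hp
  have h2 : 0 < i.h (i.toOrig p).snd ^ 2 := pow_pos (i.isHeight.pos _ h1) 2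
  have h3 : ((i.toOrig p).fst ≤ 3 / 2 * i.h (i.toOrig p).snd ^ 2) ↔
      p.fst / i.ratio p.snd ≤ 3 / 2 := by
    rw [← div_le_iff₀ h2, i.toOrig_fst_div hτ₀ hp]
  have h4 : ∀ (y : YSpace ℓ) (hy : y ∉ i.K), y = i.y + i.scale • p.snd →
      i.move y hy = i.move _ hz := fun y hy h => by subst h; rfl
  rw [globalFactor, dif_pos h1, i.toOrig_fst_div hτ₀ hp, h4 _ h1 (i.toOrig_snd p)]
  by_cases h5 : p.fst / i.ratio p.snd ≤ 3 / 2
  · rw [if_pos h5, if_pos (h3.2 h5)]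
  · rw [if_neg h5, if_neg (fun h => h5 (h3.1 h))]

/-- Near a base point the global factor is the local one. -/
theorem IsPointedFactor.globalFactor_near (hF : IsPointedFactor F) (hΨ : IsProfileInverse n m Ψ)
    (hn : 2 ≤ n) (hm : 2 ≤ m) (hτ₀ : τ₀ ≤ 1 / 10) (J : ℕ) (i : PointedData n m ℓ τ₀ B c)
    {p : RYSpace ℓ} (h1 : p.fst ≤ 9 / 5) (h2 : ‖p.snd‖ ≤ 3 / 10) :
    i.globalFactor F Ψ (i.toOrig p) = F J i p := by
  have hp : ‖p.snd‖ ≤ 1 := h2.trans (by norm_num)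
  have hz := i.notMem_of_norm_le hτ₀ hp
  have hr := i.ratio_pos hτ₀ hp
  rw [i.globalFactor_toOrig F Ψ hτ₀ hp hz, hF.eq_move J 0 i p hz h2 (by linarith),
    i.axisPoint_snd_move]
  split_ifs with h
  · rfl
  · have h3 : p.fst / i.ratio p.snd ≤ 19 / 10 := by
      rw [div_le_iff₀ hr]; linarith [(i.ratio_bounds hτ₀ hp).1]
    rw [← hF.profile_axis hn hm hτ₀ 0 _ (by linarith) h3]
    exact hΨ.left_inv _ (hF.pos 0 _ (lt_of_le_of_lt h3 (by norm_num)))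

/-- Over the cone the global factor is given by the decay law. -/
theorem IsPointedFactor.globalFactor_far (hF : IsPointedFactor F) (hΨ : IsProfileInverse n m Ψ)
    (hn : 2 ≤ n) (hm : 2 ≤ m) (hτ₀ : τ₀ ≤ 1 / 10) (J : ℕ) (i : PointedData n m ℓ τ₀ B c)
    {p : RYSpace ℓ} (h1 : 23 / 20 ≤ p.fst) (h2 : ‖p.snd‖ ≤ 3 / 10) :
    i.globalFactor F Ψ (i.toOrig p) = Ψ ((23 / 20 / p.fst) ^ decayRate n m *
      profile n m (F J i (WithLp.toLp 2 (23 / 20, p.snd)))) := by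
  have hp : ‖p.snd‖ ≤ 1 := h2.trans (by norm_num)
  have hz := i.notMem_of_norm_le hτ₀ hp
  have hr := i.ratio_pos hτ₀ hp
  obtain ⟨r1, r2⟩ := i.ratio_bounds hτ₀ hp
  have k1 : 11 / 10 ≤ 23 / 20 / i.ratio p.snd := by rw [le_div_iff₀ hr]; linarith
  have k2 : 23 / 20 / i.ratio p.snd ≤ 19 / 10 := by rw [div_le_iff₀ hr]; linarith
  have k3 : 11 / 10 ≤ p.fst / i.ratio p.snd := by rw [le_div_iff₀ hr]; linarith
  have hp0 : 0 < p.fst := by linarith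
  have e1 : F J i (WithLp.toLp 2 (23 / 20, p.snd)) =
      F 0 (i.move _ hz) (axisPoint ℓ (23 / 20 / i.ratio p.snd)) := by
    rw [axisPoint, div_eq_inv_mul (23 / 20 : ℝ)]
    exact hF.eq_move J 0 i (WithLp.toLp 2 (23 / 20, p.snd)) hz h2
      (show (23 / 20 : ℝ) ≤ 19 / 10 by norm_num)
  have e2 : (23 / 20 / p.fst) ^ decayRate n m * (11 / 10 / (23 / 20 / i.ratio p.snd)) ^
      decayRate n m = (11 / 10 / (p.fst / i.ratio p.snd)) ^ decayRate n m := by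
    rw [← Real.mul_rpow (by positivity) (by positivity)]
    congr 1
    field_simp
  rw [e1, hF.profile_axis hn hm hτ₀ 0 _ k1 k2, ← mul_assoc, e2,
    i.globalFactor_toOrig F Ψ hτ₀ hp hz]
  split_ifs with h
  · rw [← hF.profile_axis hn hm hτ₀ 0 _ k3 (by linarith)]
    exact (hΨ.left_inv _ (hF.pos 0 _ (lt_of_le_of_lt h (by norm_num)))).symm
  · rfl

end factor
end PointedData

/-! ### Smoothness and the equation -/

/-- The map `(r, y) ↦ (R r, t y)`. -/
noncomputable def diagL (ℓ : ℕ) (R t : ℝ) : RYSpace ℓ →L[ℝ] RYSpace ℓ :=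
  t • ContinuousLinearMap.id ℝ (RYSpace ℓ) + (R - t) • (radialL ℓ).smulRight (radialDir ℓ)

theorem diagL_apply {ℓ : ℕ} (R t : ℝ) (p : RYSpace ℓ) :
    diagL ℓ R t p = WithLp.toLp 2 (R * p.fst, t • p.snd) := by
  refine (WithLp.ofLp_injective 2) (Prod.ext ?_ ?_)
  · simp [diagL, radialDir]; ring
  · simp [diagL, radialDir]

/-- `diagL` as an equivalence. -/
noncomputable def diagE (ℓ : ℕ) (R t : ℝ) (hR : R ≠ 0) (ht : t ≠ 0) : RYSpace ℓ ≃L[ℝ] RYSpace ℓ :=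
  ContinuousLinearEquiv.equivOfInverse (diagL ℓ R t) (diagL ℓ R⁻¹ t⁻¹)
    (fun p => by
      rw [diagL_apply, diagL_apply]
      refine (WithLp.ofLp_injective 2) (Prod.ext ?_ ?_)
      · exact inv_mul_cancel_left₀ hR _
      · exact inv_smul_smul₀ ht _)
    (fun p => by
      rw [diagL_apply, diagL_apply]
      refine (WithLp.ofLp_injective 2) (Prod.ext ?_ ?_)
      · exact mul_inv_cancel_left₀ hR _
      · exact smul_inv_smul₀ ht _)

theorem norm_diagL_le {ℓ : ℕ} {R t : ℝ} (hR : 0 ≤ R) (hRt : R ≤ t) : ‖diagL ℓ R t‖ ≤ t := by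
  refine ContinuousLinearMap.opNorm_le_bound _ (hR.trans hRt) fun p => ?_
  rw [diagL_apply, ← sq_le_sq₀ (norm_nonneg _) (by have := hR.trans hRt; positivity), mul_pow,
    WithLp.prod_norm_sq_eq_of_L2, WithLp.prod_norm_sq_eq_of_L2, mul_add]
  have e1 : ‖(WithLp.toLp 2 (R * p.fst, t • p.snd) : RYSpace ℓ).fst‖ = R * ‖p.fst‖ := by
    change ‖R * p.fst‖ = _
    rw [norm_mul, Real.norm_eq_abs, abs_of_nonneg hR]
  have e2 : ‖(WithLp.toLp 2 (R * p.fst, t • p.snd) : RYSpace ℓ).snd‖ = t * ‖p.snd‖ := by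
    change ‖t • p.snd‖ = _
    rw [norm_smul, Real.norm_eq_abs, abs_of_nonneg (hR.trans hRt)]
  rw [e1, e2, mul_pow, mul_pow]
  gcongr

section affine
variable {E F : Type*} [NormedAddCommGroup E] [NormedSpace ℝ E] [NormedAddCommGroup F]
  [NormedSpace ℝ F]

theorem iteratedFDeriv_comp_add_equiv (f : E → F) (e : E ≃L[ℝ] E) (a x : E) (k : ℕ) :
    iteratedFDeriv ℝ k (fun p => f (a + e p)) x =
      (iteratedFDeriv ℝ k f (a + e x)).compContinuousLinearMap fun _ => (e : E →L[ℝ] E) := by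
  have h1 := e.iteratedFDerivWithin_comp_right (fun p => f (a + p)) uniqueDiffOn_univ
    (x := x) trivial k
  rw [Set.preimage_univ, iteratedFDerivWithin_univ, iteratedFDerivWithin_univ,
    iteratedFDeriv_comp_add_left] at h1
  exact h1

theorem contDiffAt_of_comp_add_equiv {f : E → F} {e : E ≃L[ℝ] E} {a x : E} {N : WithTop ℕ∞}
    (h : ContDiffAt ℝ N (fun p => f (a + e p)) x) : ContDiffAt ℝ N f (a + e x) := by
  have h1 : f = (fun p => f (a + e p)) ∘ fun q => e.symm (q - a) := by
    funext q; simp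
  have h2 : ContDiff ℝ N fun q => e.symm (q - a) :=
    e.symm.contDiff.comp (contDiff_id.sub contDiff_const)
  rw [h1]
  refine ContDiffAt.comp (a + e x) ?_ h2.contDiffAt
  simpa using h

end affine

namespace PointedData
variable {n m ℓ : ℕ} {τ₀ : ℝ} {B c : ℕ → ℕ → ℝ} (i : PointedData n m ℓ τ₀ B c)
variable {F : ℕ → PointedData n m ℓ τ₀ B c → RYSpace ℓ → ℝ} {Ψ : ℝ → ℝ}

theorem profile_strictMonoOn (hn : 2 ≤ n) (hm : 2 ≤ m) :
    StrictMonoOn (profile n m) (Set.Ici 0) :=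
  strictMonoOn_coneProfile (pow_pos (coneSlope_pos hn hm) 2) (coneExponent_pos n m)
    (coneExponent_lt_one (by omega))

theorem neg_one_lt_profile (hn : 2 ≤ n) (hm : 2 ≤ m) {f : ℝ} (hf : 0 < f) :
    -1 < profile n m f :=
  neg_one_lt_coneProfile (pow_pos (coneSlope_pos hn hm) 2) (coneExponent_pos n m)
    (coneExponent_lt_one (by omega)) hf

theorem neg_one_lt_mul_profile (hn : 2 ≤ n) (hm : 2 ≤ m) {f e : ℝ} (hf : 0 < f) (he0 : 0 ≤ e)
    (he1 : e ≤ 1) : -1 < e * profile n m f := by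
  have := neg_one_lt_profile hn hm hf
  rcases le_or_gt 0 (profile n m f) with h | h
  · have := mul_nonneg he0 h
    linarith
  · nlinarith

theorem contDiffAt_profile (n m : ℕ) {f : ℝ} (hf : 0 < f) : ContDiffAt ℝ ∞ (profile n m) f :=
  contDiffAt_coneProfile (by positivity)

theorem IsPointedFactor.globalFactor_near_eventuallyEq (hF : IsPointedFactor F)
    (hΨ : IsProfileInverse n m Ψ) (hn : 2 ≤ n) (hm : 2 ≤ m) (hτ₀ : τ₀ ≤ 1 / 10) (J : ℕ)
    (i : PointedData n m ℓ τ₀ B c) {s : ℝ} (hs : s < 9 / 5) :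
    (fun p => i.globalFactor F Ψ (i.toOrig p)) =ᶠ[nhds (axisPoint ℓ s)] F J i := by
  have c1 := (WithLp.fstL 2 ℝ ℝ (YSpace ℓ)).continuous
  have c2 := (WithLp.sndL 2 ℝ ℝ (YSpace ℓ)).continuous
  filter_upwards [(isOpen_lt c1 continuous_const).mem_nhds (x := axisPoint ℓ s) hs,
    (isOpen_lt c2.norm continuous_const).mem_nhds (x := axisPoint ℓ s)
      (show ‖(0 : YSpace ℓ)‖ < 3 / 10 by simp)] with q k1 k2
  exact hF.globalFactor_near hΨ hn hm hτ₀ J i (le_of_lt k1) (le_of_lt k2)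

theorem IsPointedFactor.globalFactor_far_eventuallyEq (hF : IsPointedFactor F)
    (hΨ : IsProfileInverse n m Ψ) (hn : 2 ≤ n) (hm : 2 ≤ m) (hτ₀ : τ₀ ≤ 1 / 10) (J : ℕ)
    (i : PointedData n m ℓ τ₀ B c) {s : ℝ} (hs : 23 / 20 < s) :
    (fun p => i.globalFactor F Ψ (i.toOrig p)) =ᶠ[nhds (axisPoint ℓ s)]
      fun p : RYSpace ℓ => Ψ ((23 / 20 / p.fst) ^ decayRate n m *
        profile n m (F J i (WithLp.toLp 2 (23 / 20, p.snd)))) := by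
  have c1 := (WithLp.fstL 2 ℝ ℝ (YSpace ℓ)).continuous
  have c2 := (WithLp.sndL 2 ℝ ℝ (YSpace ℓ)).continuous
  filter_upwards [(isOpen_lt continuous_const c1).mem_nhds (x := axisPoint ℓ s) hs,
    (isOpen_lt c2.norm continuous_const).mem_nhds (x := axisPoint ℓ s)
      (show ‖(0 : YSpace ℓ)‖ < 3 / 10 by simp)] with q k1 k2
  exact hF.globalFactor_far hΨ hn hm hτ₀ J i (le_of_lt k1) (le_of_lt k2)

/-- Every point of the domain lies on the axis over its own base point, so it suffices to consider
the points of the axes. -/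
theorem IsPointedFactor.contDiffAt_globalFactor (hF : IsPointedFactor F)
    (hΨ : IsProfileInverse n m Ψ) (hn : 2 ≤ n) (hm : 2 ≤ m) (hτ₀ : τ₀ ≤ 1 / 10)
    (i : PointedData n m ℓ τ₀ B c) (s : ℝ) :
    ContDiffAt ℝ ∞ (fun p => i.globalFactor F Ψ (i.toOrig p)) (axisPoint ℓ s) := by
  rcases lt_or_ge s (9 / 5) with hs | hs
  · exact ((hF.contDiff 0 i).contDiffAt).congr_of_eventuallyEq
      (hF.globalFactor_near_eventuallyEq hΨ hn hm hτ₀ 0 i hs)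
  · have hs' : 23 / 20 < s := by linarith
    refine ContDiffAt.congr_of_eventuallyEq ?_
      (hF.globalFactor_far_eventuallyEq hΨ hn hm hτ₀ 0 i hs')
    have hs0 : 0 < s := by linarith
    have hpos : 0 < F 0 i (axisPoint ℓ (23 / 20)) :=
      hF.pos 0 i (show (23 / 20 : ℝ) < 2 by norm_num)
    have h1 : ContDiff ℝ ∞ (fun p : RYSpace ℓ => (WithLp.toLp 2 (23 / 20, p.snd) : RYSpace ℓ)) :=
      (WithLp.prodContinuousLinearEquiv 2 ℝ ℝ (YSpace ℓ)).symm.contDiff.comp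
        (contDiff_const.prodMk (WithLp.sndL 2 ℝ ℝ (YSpace ℓ)).contDiff)
    have h2 : ContDiffAt ℝ ∞ (fun p : RYSpace ℓ => (23 / 20 / p.fst) ^ decayRate n m)
        (axisPoint ℓ s) := by
      refine ContDiffAt.rpow_const_of_ne (contDiffAt_const.div
        (radialL ℓ).contDiff.contDiffAt (show s ≠ 0 from hs0.ne')) ?_
      change 23 / 20 / s ≠ 0
      positivity
    have h3 : ContDiffAt ℝ ∞ (fun p : RYSpace ℓ =>
        profile n m (F 0 i (WithLp.toLp 2 (23 / 20, p.snd)))) (axisPoint ℓ s) :=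
      ContDiffAt.comp (axisPoint ℓ s) (contDiffAt_profile n m hpos)
        (((hF.contDiff 0 i).comp h1).contDiffAt)
    refine ContDiffAt.comp (axisPoint ℓ s) (hΨ.contDiffOn.contDiffAt (isOpen_Ioi.mem_nhds ?_))
      (h2.mul h3)
    refine neg_one_lt_mul_profile hn hm hpos (Real.rpow_nonneg (div_nonneg (by norm_num) hs0.le) _)
      (Real.rpow_le_one (div_nonneg (by norm_num) hs0.le) ?_ (decayRate_pos hn).le)
    change 23 / 20 / s ≤ 1
    rw [div_le_one hs0]; exact hs'.le

theorem IsPointedFactor.globalFactor_pos (hF : IsPointedFactor F)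
    (hΨ : IsProfileInverse n m Ψ) (hn : 2 ≤ n) (hm : 2 ≤ m) (hτ₀ : τ₀ ≤ 1 / 10)
    (i : PointedData n m ℓ τ₀ B c) (s : ℝ) :
    0 < i.globalFactor F Ψ (i.toOrig (axisPoint ℓ s)) := by
  rcases lt_or_ge s (9 / 5) with hs | hs
  · rw [(hF.globalFactor_near_eventuallyEq hΨ hn hm hτ₀ 0 i hs).eq_of_nhds]
    exact hF.pos 0 i (show s < 2 by linarith)
  · have hs0 : 0 < s := by linarith
    rw [(hF.globalFactor_far_eventuallyEq hΨ hn hm hτ₀ 0 i (by linarith)).eq_of_nhds]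
    refine (hΨ.right_inv _ (neg_one_lt_mul_profile hn hm
      (hF.pos 0 i (p := WithLp.toLp 2 (23 / 20, (axisPoint ℓ s).snd))
        (show (23 / 20 : ℝ) < 2 by norm_num))
      (Real.rpow_nonneg (div_nonneg (by norm_num) hs0.le) _)
      (Real.rpow_le_one (div_nonneg (by norm_num) hs0.le) ?_ (decayRate_pos hn).le))).1
    change 23 / 20 / s ≤ 1
    rw [div_le_one hs0]; linarith

/-- The equation for the metric factor, in rescaled coordinates. -/
theorem IsPointedFactor.eqn_globalFactor (hF : IsPointedFactor F)
    (hΨ : IsProfileInverse n m Ψ) (hn : 2 ≤ n) (hm : 2 ≤ m) (hτ₀ : τ₀ ≤ 1 / 10)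
    (i : PointedData n m ℓ τ₀ B c) {s : ℝ} (hs0 : 0 < s) :
    fderiv ℝ (fun p => i.globalFactor F Ψ (i.toOrig p)) (axisPoint ℓ s)
        (gradient i.soln (axisPoint ℓ s)) =
      metricRHS n m i.soln (axisPoint ℓ s) (i.globalFactor F Ψ (i.toOrig (axisPoint ℓ s))) := by
  have hnorm : ∀ x : ℝ, 0 < x → ‖(axisPoint ℓ s).snd‖ < x := fun x hx =>
    show ‖(0 : YSpace ℓ)‖ < x by simpa using hx
  rcases lt_or_ge s (9 / 5) with hs | hs
  · have he := hF.globalFactor_near_eventuallyEq hΨ hn hm hτ₀ 0 i hs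
    rw [he.fderiv_eq, he.eq_of_nhds]
    rcases le_or_gt (2 / 5) s with h | h
    · exact hF.eqn 0 i _ h (show s < 2 by linarith) (hnorm _ (by norm_num))
    · have c1 := (WithLp.fstL 2 ℝ ℝ (YSpace ℓ)).continuous
      have c2 := (WithLp.sndL 2 ℝ ℝ (YSpace ℓ)).continuous
      have h1 : F 0 i =ᶠ[nhds (axisPoint ℓ s)] fun _ => 1 := by
        filter_upwards [(isOpen_lt c1 continuous_const).mem_nhds (x := axisPoint ℓ s) h,
          (isOpen_lt c2.norm continuous_const).mem_nhds (hnorm (1 / 2) (by norm_num))] with q k1 k2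
        have k1' : q.fst < 2 / 5 := k1
        have k2' : ‖q.snd‖ < 1 / 2 := k2
        exact hF.eq_one 0 i q k2'.le
          (by linarith [(i.ratio_bounds hτ₀ (z := q.snd) (by linarith)).1])
      rw [h1.fderiv_eq, h1.eq_of_nhds, i.metricRHS_soln_one hτ₀
        (p := axisPoint ℓ s) (show 0 < s from hs0)
        (hnorm 1 one_pos).le]
      · simp
      · rw [show (axisPoint ℓ s).snd = 0 from rfl, ratio_zero]
        change s < 1 / 2
        linarith
  · -- over the cone `r ^ β * profile (f r)` is constant
    have hα := coneSlope_pos hn hm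
    have hs' : 23 / 20 < s := by linarith
    obtain ⟨e1, e2⟩ := metricRHS_cone hn hm (q := axisPoint ℓ s) (show 0 < s from hs0)
      (i.soln_eventuallyEq_cone hτ₀ (p := axisPoint ℓ s) (show (11 / 10 : ℝ) ≤ s by linarith)
        (hnorm 1 one_pos)) (hF.globalFactor_pos hΨ hn hm hτ₀ i s)
    have hd := ((hF.contDiffAt_globalFactor hΨ hn hm hτ₀ i s).differentiableAt
      (by simp)).hasFDerivAt.comp_hasDerivAt s (hasDerivAt_axisPoint ℓ s)
    have hD := hasDerivAt_rpow_mul_coneProfile (n := n) (m := m)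
      (f := fun s => i.globalFactor F Ψ (i.toOrig (axisPoint ℓ s))) hs0
      (hF.globalFactor_pos hΨ hn hm hτ₀ i s) hd
    have hconst : (fun r => r ^ decayRate n m * coneProfile (coneSlope n m ^ 2) (coneExponent n m)
        (i.globalFactor F Ψ (i.toOrig (axisPoint ℓ r)))) =ᶠ[nhds s]
        fun _ => (23 / 20) ^ decayRate n m *
          profile n m (F 0 i (WithLp.toLp 2 (23 / 20, 0))) := by
      filter_upwards [lt_mem_nhds hs'] with r hr
      have hr0 : 0 < r := by linarith
      have hrβ := Real.rpow_pos_of_pos hr0 (decayRate n m)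
      have h1 := (hF.globalFactor_far_eventuallyEq hΨ hn hm hτ₀ 0 i hr).eq_of_nhds
      beta_reduce at h1
      have h2 := (hΨ.right_inv _ (neg_one_lt_mul_profile hn hm
        (hF.pos 0 i (show (23 / 20 : ℝ) < 2 by norm_num) (p := WithLp.toLp 2 (23 / 20, 0)))
        (Real.rpow_nonneg (div_nonneg (by norm_num) hr0.le) _)
        (Real.rpow_le_one (x := 23 / 20 / r) (div_nonneg (by norm_num) hr0.le)
          (by rw [div_le_one hr0]; exact hr.le) (decayRate_pos (m := m) hn).le))).2
      have h3 : (axisPoint ℓ r).snd = 0 := rfl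
      have h4 : (axisPoint ℓ r).fst = r := rfl
      rw [h1, h3, h4]
      change r ^ decayRate n m * profile n m _ = _
      rw [h2, Real.div_rpow (by norm_num) hr0.le]
      field_simp
    have hzero := hD.unique (((hasDerivAt_const s _).congr_of_eventuallyEq hconst))
    have hsβ := (Real.rpow_pos_of_pos hs0 (decayRate n m)).ne'
    rw [mul_eq_zero, or_iff_right hsβ] at hzero
    have key := coneProfileDeriv_mul (n := n) (m := m) (by omega)
      (hF.globalFactor_pos hΨ hn hm hτ₀ i s)
    have hH := coneProfileDeriv_pos (pow_pos hα 2) (coneExponent_pos n m)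
      (coneExponent_lt_one (by omega)) (hF.globalFactor_pos hΨ hn hm hτ₀ i s).le
    rw [e1, e2, map_smul, smul_eq_mul]
    congr 1
    refine mul_left_cancel₀ hH.ne' ?_
    have h4 : (axisPoint ℓ s).fst = s := rfl
    rw [h4, ← mul_div_assoc, key]
    rw [eq_div_iff hs0.ne']
    have h5 := eq_neg_of_add_eq_zero_right hzero
    rw [h5]
    field_simp

end PointedData

/-! ### Estimates -/

namespace PointedData
variable {n m ℓ : ℕ} {τ₀ : ℝ} {B c : ℕ → ℕ → ℝ} (i : PointedData n m ℓ τ₀ B c)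
variable {F : ℕ → PointedData n m ℓ τ₀ B c → RYSpace ℓ → ℝ} {Ψ : ℝ → ℝ}

theorem profile_one (n m : ℕ) : profile n m 1 = 0 := coneProfile_one

/-- The estimates where `r` is comparable with `h²`. Undoing the rescaling costs powers of `h²`,
which are later absorbed by increasing `J`. -/
theorem IsPointedFactor.near_bound (hF : IsPointedFactor F)
    (hΨ : IsProfileInverse n m Ψ) (hn : 2 ≤ n) (hm : 2 ≤ m) (hτ₀ : τ₀ ≤ 1 / 10) (J k : ℕ) :
    ∃ C : ℝ, 0 ≤ C ∧ ∀ (i : PointedData n m ℓ τ₀ B c) (s : ℝ), s < 9 / 5 →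
      i.scale ^ k * ‖iteratedFDeriv ℝ k (fun q => i.globalFactor F Ψ q - 1)
        (i.toOrig (axisPoint ℓ s))‖ ≤ C * i.weight J := by
  obtain ⟨C, hC0, hC⟩ := (hF.unifSmoothOn J).bound_nonneg (fun i => (i.weight_pos J).le) k
  refine ⟨C, hC0, fun i s hs => ?_⟩
  have h1 := iteratedFDeriv_comp_add_smul (fun q => i.globalFactor F Ψ q - 1) i.scale_pos.ne'
    (yDir i.y) (axisPoint ℓ s) k
  have h2 : (fun p => i.globalFactor F Ψ (yDir i.y + i.scale • p) - 1) =ᶠ[nhds (axisPoint ℓ s)]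
      fun p => F J i p - 1 :=
    (hF.globalFactor_near_eventuallyEq hΨ hn hm hτ₀ J i hs).sub (Filter.EventuallyEq.rfl)
  rw [(h2.iteratedFDeriv ℝ k).eq_of_nhds] at h1
  have h3 := hC i (axisPoint ℓ s) trivial
  rw [h1, norm_smul, norm_pow, Real.norm_eq_abs, abs_of_pos i.scale_pos] at h3
  exact h3

/-- The region, in coordinates rescaled by `r` in the first variable and by `h²` in the others,
on which the far part of the metric factor is estimated. -/
def farRegion (ℓ : ℕ) : Set (RYSpace ℓ) := {p | 23 / 24 < p.fst ∧ p.fst < 2 ∧ ‖p.snd‖ < 3 / 10}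

theorem isOpen_farRegion (ℓ : ℕ) : IsOpen (farRegion ℓ) :=
  (isOpen_lt continuous_const (WithLp.fstL 2 ℝ ℝ (YSpace ℓ)).continuous).inter
    ((isOpen_lt (WithLp.fstL 2 ℝ ℝ (YSpace ℓ)).continuous continuous_const).inter
    (isOpen_lt (WithLp.sndL 2 ℝ ℝ (YSpace ℓ)).continuous.norm continuous_const))

/-- The decay of `f - 1` from `r = 23/20 h²` to `r = R`. -/
noncomputable def decay (R : ℝ) : ℝ := (23 / 20 * i.scale / R) ^ decayRate n m

/-- Pairs of a base point and a radius over the cone. -/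
abbrev FarIndex (n m ℓ : ℕ) (τ₀ : ℝ) (B c : ℕ → ℕ → ℝ) : Type :=
  {x : PointedData n m ℓ τ₀ B c × ℝ // 6 / 5 * x.1.scale ≤ x.2}

theorem radius_pos (x : FarIndex n m ℓ τ₀ B c) : 0 < x.1.2 :=
  lt_of_lt_of_le (mul_pos (by norm_num) x.1.1.scale_pos) x.2

theorem decay_pos (x : FarIndex n m ℓ τ₀ B c) : 0 < x.1.1.decay x.1.2 :=
  Real.rpow_pos_of_pos (div_pos (mul_pos (by norm_num) x.1.1.scale_pos) (radius_pos x)) _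

theorem decay_le_one (hn : 2 ≤ n) (x : FarIndex n m ℓ τ₀ B c) : x.1.1.decay x.1.2 ≤ 1 := by
  refine Real.rpow_le_one (div_nonneg (mul_nonneg (by norm_num) x.1.1.scale_pos.le)
    (radius_pos x).le) ?_ (decayRate_pos hn).le
  rw [div_le_one (radius_pos x)]
  linarith [x.2, x.1.1.scale_pos]

/-- The values of the profile on the section `r = 23/20 h²` of the cone, from which the decay
starts. -/
theorem unifSmoothOn_profile_boundary (hF : IsPointedFactor F)
    (hτ₀ : τ₀ ≤ 1 / 10) (J : ℕ) :
    UnifSmoothOn Set.univ (fun i : PointedData n m ℓ τ₀ B c => i.weight J)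
      (fun i (p : RYSpace ℓ) => profile n m (F J i (WithLp.toLp 2 (23 / 20, p.snd)))) ∧
    ∃ c₁ C₁ : ℝ, 0 < c₁ ∧ c₁ ≤ 1 ∧ 1 ≤ C₁ ∧ ∀ (i : PointedData n m ℓ τ₀ B c) (z : YSpace ℓ),
      c₁ ≤ F J i (WithLp.toLp 2 (23 / 20, z)) ∧ F J i (WithLp.toLp 2 (23 / 20, z)) ≤ C₁ := by
  have O := isOpen_univ (X := RYSpace ℓ)
  have hw : ∀ i : PointedData n m ℓ τ₀ B c, 0 ≤ i.weight J := fun i => (i.weight_pos J).le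
  have hw1 : ∀ i : PointedData n m ℓ τ₀ B c, i.weight J ≤ 1 :=
    fun i => i.weight_le_one (by linarith) J
  obtain ⟨c₀, hc₀, hlow⟩ := hF.lower_bound J
  obtain ⟨D, hD0, hD⟩ := (hF.unifSmoothOn J).norm_le hw
  have hbd : ∀ (i : PointedData n m ℓ τ₀ B c) (z : YSpace ℓ),
      min c₀ 1 ≤ F J i (WithLp.toLp 2 (23 / 20, z)) ∧
        F J i (WithLp.toLp 2 (23 / 20, z)) ≤ 1 + D := fun i z => by
    refine ⟨(min_le_left _ _).trans (hlow i _ (show (23 / 20 : ℝ) < 2 by norm_num)), ?_⟩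
    have h1 := (abs_le.1 (hD i (WithLp.toLp 2 (23 / 20, z)) trivial)).2
    have h2 : D * i.weight J ≤ D := mul_le_of_le_one_right hD0 (hw1 i)
    linarith
  refine ⟨?_, min c₀ 1, 1 + D, by positivity, min_le_right _ _, by linarith, hbd⟩
  have hc1 : (0 : ℝ) < min c₀ 1 := by positivity
  let L : RYSpace ℓ →L[ℝ] RYSpace ℓ :=
    ContinuousLinearMap.id ℝ (RYSpace ℓ) - (radialL ℓ).smulRight (radialDir ℓ)
  have hL : ∀ p : RYSpace ℓ, L p + (23 / 20 : ℝ) • radialDir ℓ = WithLp.toLp 2 (23 / 20, p.snd) :=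
    fun p => by
      refine (WithLp.ofLp_injective 2) (Prod.ext ?_ ?_) <;> simp [L, radialDir]
  have hG : UnifSmoothOn Set.univ (fun i : PointedData n m ℓ τ₀ B c => i.weight J)
      (fun i (p : RYSpace ℓ) => F J i (WithLp.toLp 2 (23 / 20, p.snd)) - 1) := by
    have h1 : UnifSmoothOn Set.univ 1 (fun (_ : PointedData n m ℓ τ₀ B c) (_ : RYSpace ℓ) =>
        (23 / 20 : ℝ) • radialDir ℓ) :=
      UnifSmoothOn.of_const (C := ‖(23 / 20 : ℝ) • radialDir ℓ‖) (by simp)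
    have h2 := (hF.unifSmoothOn J).comp_clm_add isOpen_univ O hw L h1
      (fun _ => Set.mapsTo_univ _ _)
    simpa only [hL] using h2
  have hΦ : ContDiffOn ℝ ∞ (fun x => profile n m (1 + x)) (Set.Ioi (-1)) := fun x hx =>
    (ContDiffAt.comp x (contDiffAt_profile n m (f := 1 + x) (by linarith [Set.mem_Ioi.1 hx]))
      (contDiffAt_const.add contDiffAt_id)).contDiffWithinAt
  have h3 := hG.comp_fixed_zero O hw hw1 (isOpen_Ioi (a := (-1 : ℝ)))
    (isCompact_Icc (a := min c₀ 1 - 1) (b := D)) (convex_Icc _ _)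
    ⟨by linarith [min_le_right c₀ 1], hD0⟩ (fun x hx => lt_of_lt_of_le (by linarith) hx.1)
    (fun i p _ => ⟨by linarith [(hbd i p.snd).1], by linarith [(hbd i p.snd).2]⟩) hΦ
    (by rw [add_zero, profile_one])
  simpa using h3

/-- The metric factor over the cone, with `r` rescaled by its size and `y` by `h²`. -/
noncomputable def farFactor (F : ℕ → PointedData n m ℓ τ₀ B c → RYSpace ℓ → ℝ) (Ψ : ℝ → ℝ)
    (x : FarIndex n m ℓ τ₀ B c) (p : RYSpace ℓ) : ℝ :=
  x.1.1.globalFactor F Ψ (yDir x.1.1.y +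
    diagE ℓ x.1.2 x.1.1.scale (radius_pos x).ne' x.1.1.scale_pos.ne' p)

/-- The decay law in the coordinates of `farFactor`. -/
theorem IsPointedFactor.farFactor_eq (hF : IsPointedFactor F)
    (hΨ : IsProfileInverse n m Ψ) (hn : 2 ≤ n) (hm : 2 ≤ m) (hτ₀ : τ₀ ≤ 1 / 10) (J : ℕ)
    (x : FarIndex n m ℓ τ₀ B c) {p : RYSpace ℓ} (hp : p ∈ farRegion ℓ) :
    farFactor F Ψ x p = Ψ (x.1.1.decay x.1.2 * (p.fst ^ (-decayRate n m) *
      profile n m (F J x.1.1 (WithLp.toLp 2 (23 / 20, p.snd))))) ∧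
      x.1.1.decay x.1.2 * p.fst ^ (-decayRate n m) ≤ 1 := by
  obtain ⟨⟨i, R⟩, hx⟩ := x
  have hR : 0 < R := radius_pos ⟨(i, R), hx⟩
  have ht := i.scale_pos
  obtain ⟨h1, h2, h3⟩ := hp
  have hp0 : 0 < p.fst := by linarith
  change 6 / 5 * i.scale ≤ R at hx
  have e1 : i.decay R * p.fst ^ (-decayRate n m) =
      (23 / 20 / (R / i.scale * p.fst)) ^ decayRate n m := by
    rw [decay, Real.rpow_neg hp0.le, ← Real.inv_rpow hp0.le, ← Real.mul_rpow (by positivity)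
      (by positivity)]
    congr 1
    field_simp
  have h4 : 23 / 20 ≤ R / i.scale * p.fst := by
    have : 6 / 5 ≤ R / i.scale := by rwa [le_div_iff₀ ht]
    nlinarith
  refine ⟨?_, ?_⟩
  · have e2 : yDir i.y + diagE ℓ R i.scale hR.ne' ht.ne' p =
        i.toOrig (WithLp.toLp 2 (R / i.scale * p.fst, p.snd)) := by
      have : diagE ℓ R i.scale hR.ne' ht.ne' p = diagL ℓ R i.scale p := rfl
      rw [toOrig, this, diagL_apply]
      congr 1
      refine (WithLp.ofLp_injective 2) (Prod.ext ?_ rfl)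
      change R * p.fst = i.scale * (R / i.scale * p.fst)
      field_simp
    rw [← mul_assoc]
    change i.globalFactor F Ψ (yDir i.y + diagE ℓ R i.scale hR.ne' ht.ne' p) = Ψ (i.decay R * _ * _)
    rw [e1, e2]
    exact hF.globalFactor_far hΨ hn hm hτ₀ J i h4 h3.le
  · change i.decay R * _ ≤ 1
    rw [e1]
    refine Real.rpow_le_one (by positivity) ?_ (decayRate_pos hn).le
    rw [div_le_one (by positivity)]
    exact h4

/-- Over the cone `f - 1` is small by the factor `decay`, uniformly with all rescaled
derivatives. -/
theorem IsPointedFactor.unifSmoothOn_farFactor (hF : IsPointedFactor F)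
    (hΨ : IsProfileInverse n m Ψ) (hn : 2 ≤ n) (hm : 2 ≤ m) (hτ₀ : τ₀ ≤ 1 / 10) (J : ℕ) :
    UnifSmoothOn (farRegion ℓ) (fun x : FarIndex n m ℓ τ₀ B c => x.1.1.decay x.1.2 *
      x.1.1.weight J) fun x p => farFactor F Ψ x p - 1 := by
  have O := isOpen_farRegion ℓ
  have w1 : ∀ x : FarIndex n m ℓ τ₀ B c, (0 : ℝ) ≤ (1 : FarIndex n m ℓ τ₀ B c → ℝ) x :=
    fun _ => zero_le_one
  have hw : ∀ x : FarIndex n m ℓ τ₀ B c, 0 ≤ x.1.1.weight J := fun x => (x.1.1.weight_pos J).le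
  have hw1 : ∀ x : FarIndex n m ℓ τ₀ B c, x.1.1.decay x.1.2 * x.1.1.weight J ≤ 1 := fun x =>
    mul_le_one₀ (decay_le_one hn x) (hw x) (x.1.1.weight_le_one (by linarith) J)
  obtain ⟨hW, c₁, C₁, hc₁, hc₁', hC₁, hbd⟩ := unifSmoothOn_profile_boundary hF hτ₀ J
  have hmono := profile_strictMonoOn hn hm
  have hW' : UnifSmoothOn (farRegion ℓ) (fun x : FarIndex n m ℓ τ₀ B c => x.1.1.weight J)
      (fun x (p : RYSpace ℓ) => profile n m (F J x.1.1 (WithLp.toLp 2 (23 / 20, p.snd)))) :=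
    (hW.reindex fun x : FarIndex n m ℓ τ₀ B c => x.1.1).mono_set (Set.subset_univ _)
  obtain ⟨η, hη, -, hη2⟩ := exists_smooth_modification
  have hs : UnifSmoothOn (farRegion ℓ) 1
      (fun (_ : FarIndex n m ℓ τ₀ B c) (p : RYSpace ℓ) => p.fst ^ (-decayRate n m)) := by
    have h1 : UnifSmoothOn (farRegion ℓ) 1
        (fun (_ : FarIndex n m ℓ τ₀ B c) (p : RYSpace ℓ) => p.fst) :=
      ((hη _).comp_clm isOpen_univ O w1 (radialL ℓ) (Set.mapsTo_univ _ _)).congr O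
        fun _ p hp => (hη2 p.fst (by linarith [hp.1]) (by linarith [hp.2.1])).symm
    exact h1.comp_fixed O isOpen_Ioi (isCompact_Icc (a := (23 / 24 : ℝ)) (b := 2)) (O := Set.Ioi 0)
      (fun s hs => lt_of_lt_of_le (by norm_num) hs.1) (fun _ p hp => ⟨hp.1.le, hp.2.1.le⟩)
      (Φ := fun s : ℝ => s ^ (-decayRate n m)) fun s hs =>
        (contDiffAt_id.rpow_const_of_ne (ne_of_gt hs)).contDiffWithinAt
  have hdec : UnifSmoothOn (farRegion ℓ) (fun x : FarIndex n m ℓ τ₀ B c => x.1.1.decay x.1.2)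
      (fun (x : FarIndex n m ℓ τ₀ B c) (_ : RYSpace ℓ) => x.1.1.decay x.1.2) :=
    UnifSmoothOn.of_const (C := 1) fun x => by
      rw [Real.norm_eq_abs, abs_of_pos (decay_pos x), one_mul]
  have harg := hdec.mul O (fun x => (decay_pos x).le) hw (hs.bdd_mul O hw hW')
  have hΦ : ContDiffOn ℝ ∞ (fun y => Ψ y - 1) (Set.Ioi (-1)) := hΨ.contDiffOn.sub contDiffOn_const
  have hΨ0 : Ψ 0 - 1 = 0 := by
    have := hΨ.left_inv 1 one_pos
    rw [profile_one] at this
    rw [this, sub_self]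
  have hc0 : profile n m c₁ ≤ 0 := by
    have := hmono.monotoneOn hc₁.le (Set.mem_Ici.2 zero_le_one) hc₁'
    rwa [profile_one] at this
  have hC0 : 0 ≤ profile n m C₁ := by
    have := hmono.monotoneOn (Set.mem_Ici.2 zero_le_one) (zero_le_one.trans hC₁) hC₁
    rwa [profile_one] at this
  refine (harg.comp_fixed_zero O (fun x => mul_nonneg (decay_pos x).le (hw x)) hw1
    (isOpen_Ioi (a := (-1 : ℝ)))
    (isCompact_Icc (a := profile n m c₁) (b := profile n m C₁)) (convex_Icc _ _)
    ⟨hc0, hC0⟩ (fun y hy => lt_of_lt_of_le (neg_one_lt_profile hn hm hc₁) hy.1)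
    (fun x p hp => ?_) hΦ hΨ0).congr O fun x p hp => by
      rw [(hF.farFactor_eq hΨ hn hm hτ₀ J x hp).1]
  have h1 := (hF.farFactor_eq hΨ hn hm hτ₀ J x hp).2
  have hp0 : 0 < p.fst := by linarith [hp.1]
  have h2 : 0 ≤ x.1.1.decay x.1.2 * p.fst ^ (-decayRate n m) :=
    mul_nonneg (decay_pos x).le (Real.rpow_nonneg hp0.le _)
  obtain ⟨h3, h4⟩ := hbd x.1.1 p.snd
  have h5 := hmono.monotoneOn hc₁.le (hc₁.le.trans h3) h3
  have h6 := hmono.monotoneOn (hc₁.le.trans h3) (zero_le_one.trans hC₁) h4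
  rw [← mul_assoc]
  constructor
  · nlinarith
  · nlinarith

theorem iteratedFDeriv_sub_const {E : Type*} [NormedAddCommGroup E] [NormedSpace ℝ E] {f : E → ℝ}
    {x : E} {k : ℕ} (hk : 1 ≤ k) (hf : ContDiffAt ℝ ∞ f x) (a : ℝ) :
    iteratedFDeriv ℝ k (fun q => f q - a) x = iteratedFDeriv ℝ k f x := by
  have h := iteratedFDeriv_sub_apply (i := k) (hf.of_le (mod_cast le_top))
    (contDiffAt_const (c := a) (x := x) (n := (k : WithTop ℕ∞)))
  rw [iteratedFDeriv_const_of_ne (by omega)] at h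
  rw [Pi.zero_apply, sub_zero] at h
  exact h

theorem axisPoint_one_mem (ℓ : ℕ) : axisPoint ℓ 1 ∈ farRegion ℓ :=
  ⟨by change (23 / 24 : ℝ) < 1; norm_num, by change (1 : ℝ) < 2; norm_num,
    by change ‖(0 : YSpace ℓ)‖ < 3 / 10; simp⟩

theorem norm_yDir {ℓ : ℕ} (v : YSpace ℓ) : ‖yDir v‖ = ‖v‖ := by
  rw [WithLp.prod_norm_eq_of_L2]; simp [yDir]

/-- The estimates over the cone. Without regard to directions each derivative costs a factor
`scale⁻¹`; derivatives in `r` cost only `r⁻¹`, and the factor `decay` is kept. -/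
theorem IsPointedFactor.far_bound (hF : IsPointedFactor F)
    (hΨ : IsProfileInverse n m Ψ) (hn : 2 ≤ n) (hm : 2 ≤ m) (hτ₀ : τ₀ ≤ 1 / 10) (J k : ℕ) :
    ∃ C : ℝ, 0 ≤ C ∧ ∀ x : FarIndex n m ℓ τ₀ B c,
      x.1.1.scale ^ k * ‖iteratedFDeriv ℝ k (fun q => x.1.1.globalFactor F Ψ q - 1)
        (WithLp.toLp 2 (x.1.2, x.1.1.y))‖ ≤ C * x.1.1.weight J ∧
      ∀ a b : ℕ, a + b = k → ∀ v : Fin b → YSpace ℓ, (∀ j, ‖v j‖ ≤ 1) →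
        x.1.2 ^ a * x.1.1.scale ^ b * |iteratedFDeriv ℝ (a + b)
          (fun q => x.1.1.globalFactor F Ψ q - 1) (WithLp.toLp 2 (x.1.2, x.1.1.y))
          (Fin.append (fun _ : Fin a => radialDir ℓ) (fun j => yDir (v j)))| ≤
        C * (x.1.1.decay x.1.2 * x.1.1.weight J) := by
  obtain ⟨C, hC0, hC⟩ := (hF.unifSmoothOn_farFactor hΨ hn hm hτ₀ J).bound_nonneg
    (fun x => mul_nonneg (decay_pos x).le (x.1.1.weight_pos J).le) k
  refine ⟨C, hC0, fun x => ?_⟩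
  have hx := hC x _ (axisPoint_one_mem ℓ)
  have hdec := decay_le_one hn x
  obtain ⟨⟨i, R⟩, hR⟩ := x
  have hR0 : 0 < R := radius_pos ⟨(i, R), hR⟩
  have ht := i.scale_pos
  have hw := (i.weight_pos J)
  change i.decay R ≤ 1 at hdec
  change 6 / 5 * i.scale ≤ R at hR
  change i.scale ^ k * ‖iteratedFDeriv ℝ k (fun q => i.globalFactor F Ψ q - 1)
        (WithLp.toLp 2 (R, i.y))‖ ≤ C * i.weight J ∧
      ∀ a b : ℕ, a + b = k → ∀ v : Fin b → YSpace ℓ, (∀ j, ‖v j‖ ≤ 1) →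
        R ^ a * i.scale ^ b * |iteratedFDeriv ℝ (a + b)
          (fun q => i.globalFactor F Ψ q - 1) (WithLp.toLp 2 (R, i.y))
          (Fin.append (fun _ : Fin a => radialDir ℓ) (fun j => yDir (v j)))| ≤
        C * (i.decay R * i.weight J)
  set e := diagE ℓ R i.scale hR0.ne' ht.ne' with he
  have happ : ∀ p, e p = WithLp.toLp 2 (R * p.fst, i.scale • p.snd) := fun p =>
    diagL_apply R i.scale p
  have hq : yDir i.y + e (axisPoint ℓ 1) = WithLp.toLp 2 (R, i.y) := by
    rw [happ]
    refine (WithLp.ofLp_injective 2) (Prod.ext ?_ ?_)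
    · change 0 + R * 1 = R
      ring
    · change i.y + i.scale • (0 : YSpace ℓ) = i.y
      rw [smul_zero, add_zero]
  have hcomp := iteratedFDeriv_comp_add_equiv (fun q => i.globalFactor F Ψ q - 1) e (yDir i.y)
    (axisPoint ℓ 1) k
  rw [hq] at hcomp
  have hx : ‖iteratedFDeriv ℝ k (fun p => i.globalFactor F Ψ (yDir i.y + e p) - 1)
      (axisPoint ℓ 1)‖ ≤ C * (i.decay R * i.weight J) := hx
  constructor
  · have h1 : iteratedFDeriv ℝ k (fun q => i.globalFactor F Ψ q - 1) (WithLp.toLp 2 (R, i.y)) =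
        (iteratedFDeriv ℝ k (fun p => i.globalFactor F Ψ (yDir i.y + e p) - 1)
          (axisPoint ℓ 1)).compContinuousLinearMap fun _ => diagL ℓ R⁻¹ i.scale⁻¹ := by
      rw [hcomp]
      ext v
      simp only [ContinuousMultilinearMap.compContinuousLinearMap_apply]
      congr 1
      funext j
      exact (e.apply_symm_apply (v j)).symm
    have h2 : ‖diagL ℓ R⁻¹ i.scale⁻¹‖ ≤ i.scale⁻¹ :=
      norm_diagL_le (inv_pos.2 hR0).le (inv_anti₀ ht (by linarith))
    have h3 := ContinuousMultilinearMap.norm_compContinuousLinearMap_le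
      (iteratedFDeriv ℝ k (fun p => i.globalFactor F Ψ (yDir i.y + e p) - 1) (axisPoint ℓ 1))
      (fun _ => diagL ℓ R⁻¹ i.scale⁻¹)
    rw [← h1, Finset.prod_const, Finset.card_univ, Fintype.card_fin] at h3
    have h4 : ‖diagL ℓ R⁻¹ i.scale⁻¹‖ ^ k ≤ (i.scale ^ k)⁻¹ := by
      rw [← inv_pow]; exact pow_le_pow_left₀ (norm_nonneg _) h2 k
    have h5 : C * (i.decay R * i.weight J) ≤ C * i.weight J :=
      mul_le_mul_of_nonneg_left (mul_le_of_le_one_left hw.le hdec) hC0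
    have h6 := h3.trans (mul_le_mul (hx.trans h5) h4 (by positivity) (by positivity))
    rw [← div_eq_mul_inv, le_div_iff₀ (by positivity), mul_comm] at h6
    exact h6
  · rintro a b rfl v hv
    set A : Fin (a + b) → RYSpace ℓ :=
      Fin.append (fun _ : Fin a => radialDir ℓ) (fun j => yDir (v j)) with hA
    set s : Fin (a + b) → ℝ := Fin.append (fun _ : Fin a => R) (fun _ : Fin b => i.scale) with hs
    have h1 : (fun j => (e : RYSpace ℓ →L[ℝ] RYSpace ℓ) (A j)) = fun j => s j • A j := by
      funext j
      change e (A j) = s j • A j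
      rw [happ]
      refine Fin.addCases (fun j => ?_) (fun j => ?_) j
      · rw [hA, hs, Fin.append_left, Fin.append_left]
        refine (WithLp.ofLp_injective 2) (Prod.ext ?_ ?_) <;> simp [radialDir]
      · rw [hA, hs, Fin.append_right, Fin.append_right]
        refine (WithLp.ofLp_injective 2) (Prod.ext ?_ ?_) <;> simp [yDir]
    have h2 : ∏ j, s j = R ^ a * i.scale ^ b := by
      rw [Fin.prod_univ_add]
      simp only [hs, Fin.append_left, Fin.append_right, Finset.prod_const, Finset.card_univ,
        Fintype.card_fin]
    have h3 : iteratedFDeriv ℝ (a + b) (fun p => i.globalFactor F Ψ (yDir i.y + e p) - 1)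
        (axisPoint ℓ 1) A = R ^ a * i.scale ^ b * iteratedFDeriv ℝ (a + b)
          (fun q => i.globalFactor F Ψ q - 1) (WithLp.toLp 2 (R, i.y)) A := by
      rw [hcomp, ContinuousMultilinearMap.compContinuousLinearMap_apply, h1,
        ContinuousMultilinearMap.map_smul_univ, h2, smul_eq_mul]
    have h4 := (iteratedFDeriv ℝ (a + b) (fun p => i.globalFactor F Ψ (yDir i.y + e p) - 1)
        (axisPoint ℓ 1)).le_opNorm A
    have h5 : ∏ j, ‖A j‖ ≤ 1 := by
      refine Finset.prod_le_one (fun _ _ => norm_nonneg _) fun j _ => ?_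
      refine Fin.addCases (fun j => ?_) (fun j => ?_) j
      · rw [hA, Fin.append_left, norm_radialDir]
      · rw [hA, Fin.append_right, norm_yDir]; exact hv j
    rw [h3, norm_mul, Real.norm_eq_abs, Real.norm_eq_abs, abs_of_pos (by positivity)] at h4
    exact h4.trans ((mul_le_of_le_one_right (norm_nonneg _) h5).trans hx)

theorem toOrig_axisPoint (r : ℝ) :
    i.toOrig (axisPoint ℓ (r / i.scale)) = WithLp.toLp 2 (r, i.y) := by
  refine (WithLp.ofLp_injective 2) (Prod.ext ?_ ?_)
  · change 0 + i.scale * (r / i.scale) = r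
    rw [zero_add, mul_div_cancel₀ _ i.scale_pos.ne']
  · change i.y + i.scale • (0 : YSpace ℓ) = i.y
    rw [smul_zero, add_zero]

/-- Orders in `h` pay for the powers of `h²` lost by rescaling. -/
theorem weight_add_two_mul (j k : ℕ) :
    i.weight (j + 2 * k) = i.scale ^ k * (i.τ * i.h₀ ^ j) := by
  rw [weight, scale, pow_add, pow_mul]; ring

theorem scale_le_one (hτ₀ : τ₀ ≤ 1 / 10) : i.scale ≤ 1 / 100 := by
  rw [scale]
  have h1 := i.h₀_pos
  have h2 := i.h₀_lt
  nlinarith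

/-- All estimates for the global metric factor: the size of `f - 1` everywhere, the derivatives up
to any fixed height, and the decaying mixed derivatives over the cone. -/
theorem IsPointedFactor.exists_bound (hF : IsPointedFactor F)
    (hΨ : IsProfileInverse n m Ψ) (hn : 2 ≤ n) (hm : 2 ≤ m) (hτ₀ : τ₀ ≤ 1 / 10) (j k : ℕ) :
    ∃ C : ℝ, 0 ≤ C ∧ ∀ (i : PointedData n m ℓ τ₀ B c) (r : ℝ),
      |i.globalFactor F Ψ (WithLp.toLp 2 (r, i.y)) - 1| ≤ C * (i.τ * i.h₀ ^ j) ∧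
      ‖iteratedFDeriv ℝ k (fun q => i.globalFactor F Ψ q - 1) (WithLp.toLp 2 (r, i.y))‖ ≤
        C * (i.τ * i.h₀ ^ j) ∧
      (1 ≤ r → ∀ a b : ℕ, a + b = k → ∀ v : Fin b → YSpace ℓ, (∀ j, ‖v j‖ ≤ 1) →
        r ^ ((a : ℝ) + min (b : ℝ) (decayRate n m)) * |iteratedFDeriv ℝ (a + b)
          (fun q => i.globalFactor F Ψ q - 1) (WithLp.toLp 2 (r, i.y))
          (Fin.append (fun _ : Fin a => radialDir ℓ) (fun j => yDir (v j)))| ≤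
        C * (i.τ * i.h₀ ^ j)) := by
  obtain ⟨C1, hC1, h1⟩ := hF.near_bound hΨ hn hm hτ₀ j 0
  obtain ⟨C2, hC2, h2⟩ := hF.near_bound hΨ hn hm hτ₀ (j + 2 * k) k
  obtain ⟨C3, hC3, h3⟩ := hF.far_bound hΨ hn hm hτ₀ j 0
  obtain ⟨C4, hC4, h4⟩ := hF.far_bound hΨ hn hm hτ₀ (j + 2 * k) k
  refine ⟨C1 + C2 + C3 + C4, by positivity, fun i r => ?_⟩
  have ht := i.scale_pos
  have ht1 := i.scale_le_one hτ₀
  have hX : 0 < i.τ * i.h₀ ^ j := i.weight_pos j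
  have hmono : ∀ {D y : ℝ}, y ≤ D * (i.τ * i.h₀ ^ j) → D ≤ C1 + C2 + C3 + C4 →
      y ≤ (C1 + C2 + C3 + C4) * (i.τ * i.h₀ ^ j) := fun hy hD =>
    hy.trans (mul_le_mul_of_nonneg_right hD hX.le)
  have hdiv : ∀ {D y : ℝ}, i.scale ^ k * y ≤ D * i.weight (j + 2 * k) →
      y ≤ D * (i.τ * i.h₀ ^ j) := fun {D y} h => by
    rw [weight_add_two_mul, mul_left_comm] at h
    exact le_of_mul_le_mul_left h (by positivity)
  have hfar : ∀ hr : 6 / 5 * i.scale ≤ r, _ := fun hr => h4 ⟨(i, r), hr⟩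
  refine ⟨?_, ?_, fun hr a b hab v hv => ?_⟩
  · rcases le_or_gt (6 / 5 * i.scale) r with hr | hr
    · have := (h3 ⟨(i, r), hr⟩).1
      rw [norm_iteratedFDeriv_zero, pow_zero, one_mul] at this
      exact hmono this (by linarith)
    · have := h1 i (r / i.scale) (by rw [div_lt_iff₀ ht]; linarith)
      rw [norm_iteratedFDeriv_zero, pow_zero, one_mul, toOrig_axisPoint] at this
      exact hmono this (by linarith)
  · rcases le_or_gt (6 / 5 * i.scale) r with hr | hr
    · exact hmono (hdiv (hfar hr).1) (by linarith)
    · have := h2 i (r / i.scale) (by rw [div_lt_iff₀ ht]; linarith)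
      rw [toOrig_axisPoint] at this
      exact hmono (hdiv this) (by linarith)
  · have hr6 : 6 / 5 * i.scale ≤ r := by linarith
    have hr0 : 0 < r := by linarith
    have h5 := (hfar hr6).2 a b hab v hv
    change r ^ a * i.scale ^ b * _ ≤ C4 * (i.decay r * i.weight (j + 2 * k)) at h5
    refine hmono ?_ (by linarith : C4 ≤ _)
    generalize |iteratedFDeriv ℝ (a + b) (fun q => i.globalFactor F Ψ q - 1)
      (WithLp.toLp 2 (r, i.y)) (Fin.append (fun _ : Fin a => radialDir ℓ)
        (fun j => yDir (v j)))| = Y at h5 ⊢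
    -- the decay of `f - 1` pays for the power of `r`
    have h6 : r ^ min (b : ℝ) (decayRate n m) * i.decay r ≤ 1 := by
      have k1 : r ^ min (b : ℝ) (decayRate n m) ≤ r ^ decayRate n m :=
        Real.rpow_le_rpow_of_exponent_le hr (min_le_right _ _)
      have k2 : 0 ≤ i.decay r := (decay_pos ⟨(i, r), hr6⟩).le
      refine (mul_le_mul_of_nonneg_right k1 k2).trans ?_
      rw [decay, ← Real.mul_rpow hr0.le (by positivity), mul_div_cancel₀ _ hr0.ne']
      exact Real.rpow_le_one (by positivity) (by linarith) (decayRate_pos hn).le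
    have h7 : i.scale ^ k ≤ i.scale ^ b := pow_le_pow_of_le_one ht.le (by linarith) (by omega)
    rw [Real.rpow_add hr0, Real.rpow_natCast, weight_add_two_mul] at *
    have hP : 0 ≤ r ^ min (b : ℝ) (decayRate n m) := Real.rpow_nonneg hr0.le _
    have hdec : 0 ≤ i.decay r := (decay_pos ⟨(i, r), hr6⟩).le
    refine le_of_mul_le_mul_left (a := i.scale ^ b) ?_ (by positivity)
    calc i.scale ^ b * (r ^ a * r ^ min (b : ℝ) (decayRate n m) * Y) =
          r ^ min (b : ℝ) (decayRate n m) * (r ^ a * i.scale ^ b * Y) := by ring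
      _ ≤ r ^ min (b : ℝ) (decayRate n m) *
          (C4 * (i.decay r * (i.scale ^ k * (i.τ * i.h₀ ^ j)))) := mul_le_mul_of_nonneg_left h5 hP
      _ = r ^ min (b : ℝ) (decayRate n m) * i.decay r *
          (C4 * (i.scale ^ k * (i.τ * i.h₀ ^ j))) := by ring
      _ ≤ 1 * (C4 * (i.scale ^ b * (i.τ * i.h₀ ^ j))) := by gcongr
      _ = i.scale ^ b * (C4 * (i.τ * i.h₀ ^ j)) := by ring

end PointedData

/-! ### The metric factor on the axes through all points -/

namespace PointedData
variable {n m ℓ : ℕ} {τ₀ : ℝ} {B c : ℕ → ℕ → ℝ}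
variable {F : ℕ → PointedData n m ℓ τ₀ B c → RYSpace ℓ → ℝ} {Ψ : ℝ → ℝ}

theorem IsPointedFactor.contDiffAt_axis (hF : IsPointedFactor F) (hΨ : IsProfileInverse n m Ψ)
    (hn : 2 ≤ n) (hm : 2 ≤ m) (hτ₀ : τ₀ ≤ 1 / 10) (i : PointedData n m ℓ τ₀ B c) (r : ℝ) :
    ContDiffAt ℝ ∞ (i.globalFactor F Ψ) (WithLp.toLp 2 (r, i.y)) := by
  have h := contDiffAt_of_comp_add_equiv (f := i.globalFactor F Ψ) (a := yDir i.y)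
    (e := ContinuousLinearEquiv.smulLeft (Units.mk0 i.scale i.scale_pos.ne'))
    (hF.contDiffAt_globalFactor hΨ hn hm hτ₀ i (r / i.scale))
  rw [← i.toOrig_axisPoint r]
  exact h

theorem IsPointedFactor.metricEqn_axis (hF : IsPointedFactor F) (hΨ : IsProfileInverse n m Ψ)
    (hn : 2 ≤ n) (hm : 2 ≤ m) (hτ₀ : τ₀ ≤ 1 / 10) (i : PointedData n m ℓ τ₀ B c) {r : ℝ}
    (hr : 0 < r) : 0 < i.globalFactor F Ψ (WithLp.toLp 2 (r, i.y)) ∧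
      MetricEqn n m i.u (i.globalFactor F Ψ) (WithLp.toLp 2 (r, i.y)) := by
  have hpos := hF.globalFactor_pos hΨ hn hm hτ₀ i (r / i.scale)
  have heq := hF.eqn_globalFactor hΨ hn hm hτ₀ i (div_pos hr i.scale_pos)
  have h1 := fderiv_comp_add_smul_gradient_rescale (yDir i.y) i.u (i.globalFactor F Ψ)
    (axisPoint ℓ (r / i.scale)) i.scale_pos.ne'
  have h2 := metricRHS_rescale (n := n) (m := m) (yDir i.y) i.u (axisPoint ℓ (r / i.scale))
    i.scale_pos.ne' rfl (i.globalFactor F Ψ (i.toOrig (axisPoint ℓ (r / i.scale))))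
  have h3 := (h1.symm.trans heq).trans h2
  change i.scale * fderiv ℝ _ (i.toOrig _) (gradient i.u (i.toOrig _)) =
    i.scale * metricRHS n m i.u (i.toOrig _) _ at h3
  rw [i.toOrig_axisPoint r] at h3 hpos
  exact ⟨hpos, (metricEqn_iff hpos).2 (mul_left_cancel₀ i.scale_pos.ne' h3)⟩

theorem IsPointedFactor.eq_one_axis (hF : IsPointedFactor F) (hΨ : IsProfileInverse n m Ψ)
    (hn : 2 ≤ n) (hm : 2 ≤ m) (hτ₀ : τ₀ ≤ 1 / 10) (i : PointedData n m ℓ τ₀ B c) {r : ℝ}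
    (hr : r ≤ i.scale / 2) : i.globalFactor F Ψ (WithLp.toLp 2 (r, i.y)) = 1 := by
  have hs : r / i.scale ≤ 1 / 2 := by
    rw [div_le_iff₀ i.scale_pos]; linarith
  have h0 : ‖(axisPoint ℓ (r / i.scale)).snd‖ ≤ 3 / 10 := by
    change ‖(0 : YSpace ℓ)‖ ≤ 3 / 10
    rw [norm_zero]; norm_num
  rw [← i.toOrig_axisPoint r, hF.globalFactor_near hΨ hn hm hτ₀ 0 i
    (p := axisPoint ℓ (r / i.scale)) (show r / i.scale ≤ 9 / 5 by linarith) h0]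
  have hcont : Continuous fun s => F 0 i (axisPoint ℓ s) :=
    (hF.contDiff 0 i).continuous.comp (continuous_iff_continuousAt.2 fun s =>
      (hasDerivAt_axisPoint ℓ s).continuousAt)
  have hsub : Set.Iio (1 / 2 : ℝ) ⊆ {s | F 0 i (axisPoint ℓ s) = 1} := fun s h =>
    hF.eq_one 0 i _ (by change ‖(0 : YSpace ℓ)‖ ≤ 1 / 2; rw [norm_zero]; norm_num) (by
      change s < i.ratio 0 / 2
      rw [ratio_zero]; exact h)
  have hcl := closure_minimal hsub (isClosed_eq hcont continuous_const)
  rw [closure_Iio] at hcl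
  exact hcl hs

end PointedData

theorem mainTheorem9 (n m ℓ : ℕ) (hn : 3 ≤ n) (hm : 2 ≤ m) (hnm : 8 ≤ n + m) (hℓ : 1 ≤ ℓ) :
    ∃ τ₀ : ℝ, 0 < τ₀ ∧ τ₀ ≤ 1 / 2 ∧
      ∀ B c : ℕ → ℕ → ℝ, ∃ C : ℕ → ℕ → ℝ,
        ∀ (K : Set (YSpace ℓ)) (h : YSpace ℓ → ℝ) (τ : ℝ) (u : RYSpace ℓ → ℝ),
          IsClosed K → K.Nonempty → IsHeight K τ₀ B h → 0 < τ → τ ≤ 1 →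
          IsNearCone n m K h τ c u →
          ∃ f : RYSpace ℓ → ℝ,
            ContDiffOn ℝ ∞ f {q | q.snd ∉ K ∧ h q.snd ^ 2 / 4 < q.fst} ∧
            (∀ q : RYSpace ℓ, q.snd ∉ K → h q.snd ^ 2 / 4 < q.fst →
              0 < f q ∧ MetricEqn n m u f q) ∧
            (∀ q : RYSpace ℓ, q.snd ∉ K → h q.snd ^ 2 / 4 ≤ q.fst →
              q.fst ≤ h q.snd ^ 2 / 2 → f q = 1) ∧
            (∀ j k : ℕ, 1 ≤ k → ∀ q : RYSpace ℓ, q.snd ∉ K →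
              h q.snd ^ 2 / 4 < q.fst → q.fst ≤ 1 →
              |f q - 1| + q.fst ^ k * ‖iteratedFDeriv ℝ k f q‖ ≤ C j k * τ * h q.snd ^ j) ∧
            (∀ j a b : ℕ, 1 ≤ a + b → ∀ q : RYSpace ℓ, q.snd ∉ K →
              h q.snd ^ 2 / 4 < q.fst →
              ∀ v : Fin b → YSpace ℓ, (∀ i, ‖v i‖ ≤ 1) →
              |f q - 1| + q.fst ^ ((a : ℝ) + min (b : ℝ) (decayRate n m)) *
                  |iteratedFDeriv ℝ (a + b) f q
                    (Fin.append (fun _ : Fin a => radialDir ℓ) (fun i => yDir (v i)))| ≤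
                C j (a + b) * τ * h q.snd ^ j) := by
  have hn2 : 2 ≤ n := by omega
  obtain ⟨τ₀, hτ0, hτ1, hex⟩ := PointedData.exists_isPointedFactor (n := n) (m := m) ℓ hn2 hm
  obtain ⟨Ψ, hΨ⟩ := PointedData.exists_isProfileInverse hn2 hm
  refine ⟨τ₀, hτ0, by linarith, fun B c => ?_⟩
  obtain ⟨F, hF⟩ := hex B c
  choose C hC0 hC using hF.exists_bound hΨ hn2 hm hτ1
  refine ⟨fun j k => 2 * C j k, fun K h τ u hK _ hh hτ hτ' hu => ?_⟩
  by_cases hU : ∃ y, y ∉ K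
  swap
  · have hU' : ∀ {P : Prop} {y : YSpace ℓ}, y ∉ K → P := fun hy => (hU ⟨_, hy⟩).elim
    exact ⟨fun _ => 1, contDiffOn_const, fun q hq => hU' hq, fun q hq => hU' hq,
      fun _ _ _ q hq => hU' hq, fun _ _ _ _ q hq => hU' hq⟩
  obtain ⟨y₀, hy₀⟩ := hU
  let i₀ : PointedData n m ℓ τ₀ B c := ⟨K, h, τ, u, y₀, hK, hh, hτ, hτ', hu, hy₀⟩
  have hr : ∀ q : RYSpace ℓ, h q.snd ^ 2 / 4 < q.fst → 0 < q.fst := fun q hq =>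
    lt_of_le_of_lt (by positivity) hq
  have hsmooth : ∀ q : RYSpace ℓ, q.snd ∉ K → ContDiffAt ℝ ∞ (i₀.globalFactor F Ψ) q :=
    fun q hq => hF.contDiffAt_axis hΨ hn2 hm hτ1 (i₀.move q.snd hq) q.fst
  have hbound := fun (j k : ℕ) (q : RYSpace ℓ) (hq : q.snd ∉ K) =>
    hC j k (i₀.move q.snd hq) q.fst
  refine ⟨i₀.globalFactor F Ψ, fun q hq => (hsmooth q hq.1).contDiffWithinAt,
    fun q hq hq' => hF.metricEqn_axis hΨ hn2 hm hτ1 (i₀.move q.snd hq) (hr q hq'),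
    fun q hq _ hq' => hF.eq_one_axis hΨ hn2 hm hτ1 (i₀.move q.snd hq) hq',
    fun j k hk q hq hq' hq1 => ?_, fun j a b hab q hq hq' v hv => ?_⟩
  · obtain ⟨h1, h2, -⟩ := hbound j k q hq
    change ‖iteratedFDeriv ℝ k (fun q => i₀.globalFactor F Ψ q - 1) q‖ ≤
      C j k * (τ * h q.snd ^ j) at h2
    change |i₀.globalFactor F Ψ q - 1| ≤ C j k * (τ * h q.snd ^ j) at h1
    rw [PointedData.iteratedFDeriv_sub_const hk (hsmooth q hq)] at h2
    have h3 := (mul_le_of_le_one_left (norm_nonneg _)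
      (pow_le_one₀ (n := k) (hr q hq').le hq1)).trans h2
    linarith
  · obtain ⟨h1, h2, h3⟩ := hbound j (a + b) q hq
    change ‖iteratedFDeriv ℝ (a + b) (fun q => i₀.globalFactor F Ψ q - 1) q‖ ≤
      C j (a + b) * (τ * h q.snd ^ j) at h2
    change |i₀.globalFactor F Ψ q - 1| ≤ C j (a + b) * (τ * h q.snd ^ j) at h1
    rw [PointedData.iteratedFDeriv_sub_const hab (hsmooth q hq)] at h2
    have h4 : q.fst ^ ((a : ℝ) + min (b : ℝ) (decayRate n m)) *
        |iteratedFDeriv ℝ (a + b) (i₀.globalFactor F Ψ) q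
          (Fin.append (fun _ : Fin a => radialDir ℓ) (fun i => yDir (v i)))| ≤
        C j (a + b) * (τ * h q.snd ^ j) := by
      rcases le_or_gt 1 q.fst with hq1 | hq1
      · have h5 := h3 hq1 a b rfl v hv
        change q.fst ^ ((a : ℝ) + min (b : ℝ) (decayRate n m)) *
          |iteratedFDeriv ℝ (a + b) (fun q => i₀.globalFactor F Ψ q - 1) q
            (Fin.append (fun _ : Fin a => radialDir ℓ) (fun i => yDir (v i)))| ≤
          C j (a + b) * (τ * h q.snd ^ j) at h5
        rwa [PointedData.iteratedFDeriv_sub_const hab (hsmooth q hq)] at h5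
      · have h5 : q.fst ^ ((a : ℝ) + min (b : ℝ) (decayRate n m)) ≤ 1 :=
          Real.rpow_le_one (hr q hq').le hq1.le (add_nonneg a.cast_nonneg
            (le_min b.cast_nonneg (decayRate_pos hn2).le))
        have h6 := (iteratedFDeriv ℝ (a + b) (i₀.globalFactor F Ψ) q).le_opNorm
          (Fin.append (fun _ : Fin a => radialDir ℓ) (fun i => yDir (v i)))
        have h7 : ∏ l, ‖Fin.append (fun _ : Fin a => radialDir ℓ) (fun i => yDir (v i)) l‖ ≤ 1 := by
          refine Finset.prod_le_one (fun _ _ => norm_nonneg _) fun l _ => ?_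
          refine Fin.addCases (fun l => ?_) (fun l => ?_) l
          · rw [Fin.append_left, norm_radialDir]
          · rw [Fin.append_right, PointedData.norm_yDir]; exact hv l
        exact (mul_le_of_le_one_left (abs_nonneg _) h5).trans
          ((h6.trans (mul_le_of_le_one_right (norm_nonneg _) h7)).trans h2)
    linarith
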